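/- Fix integers $d,\ell,m\ge 1$, reals $T,\sigma>0$, and globally Lipschitz maps $H_1,H_2,K_1,K_2:\mathbb R^d\to\mathbb R^d$. Let $\mathcal W_1(\mathbb R^d)$ be the space of Borel probability measures on $\mathbb R^d$ with finite first moment, with the 1-Wasserstein distance, and write $(H*\mu)(x)=\int H(x-z)\,d\mu(z)$. **Controls.** Let $\mathcal U\subset\mathbb R^{d\times\ell}$ be compact, let $M,L>0$, and let $\mathcal G$ be the set of functions $g:\mathcal W_1(\mathbb R^d)\to\mathbb R^\ell$ that are $M$-bounded and $L$-Lipschitz. Set $E=L^1([0,T];\mathcal U)\times\mathcal G$, with the product of the weak topology of $L^1([0,T];\mathbb R^{d\times \ell})$ and the topology of uniform convergence on $\mathcal W_1(\mathbb R^d)$; $E^m$ carries the product topology. An element $(\mathbf h,\mathbf g)=(h^i,g^i)_{i\le m}$ of $E^m$ defines the controls $u^i(t,\mu)=h^i(t)g^i(\mu)$. **Data.** Let $p>1$, let $\mu_0$ be a Borel probability measure on $\mathbb R^d$ with finite $p$-th moment, and let $\mathbf Y_0=(Y_0^1,\dots,Y_0^m)\in(\mathbb R^d)^m$. On a probability space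 $(\Omega,\mathcal F,\mathbb P)$ let $X_0^1,X_0^2,\dots$ be random variables of law $\mu_0$ and $W^1,W^2,\dots$ be $d$-dimensional Brownian motions, all independent. Let also $\overline X_0$ be a random variable of law $\mu_0$ and $W$ a $d$-dimensional Brownian motion independent of $\overline X_0$. **Particle system.** For $N\ge1$ and $(\mathbf h,\mathbf g)\in E^m$, let $X^1,\dots,X^N,Y^1,\dots,Y^m$ solve on $[0,T]$, with $\mu_N(t)=\frac1N\sum_{n=1}^N\delta_{X^n(t)}$, $$dX^n=\Big(\frac1N\sum_{l=1}^N H_1(X^n-X^l)+\frac1m\sum_{j=1}^mK_1(Y^j-X^n)\Big)dt+\sqrt{2\sigma}\,dW^n,\qquad X^n(0)=X^n_0,$$ $$\frac{d}{dt}Y^i=\frac1N\sum_{l=1}^N K_2(Y^i-X^l)+\frac1m\sum_{j=1}^mH_2(Y^j-Y^i)+h^i(t)\,g^i(\mu_N(t)),\qquad Y^i(0)=Y^i_0 .$$ **Limit system.** Let $\overline X,\overline Y^1,\dots,\overline Y^m$, with $\overline\mu_t=\mathrm{Law}(\overline X(t))$, solve on $[0,T]$ $$d\overline X=\Big((H_1*\overline\mu_t)(\overline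 X)+\frac1m\sum_{j=1}^mK_1(\overline Y^j-\overline X)\Big)dt+\sqrt{2\sigma}\,dW,\qquad \overline X(0)=\overline X_0,$$ $$\frac{d}{dt}\overline Y^i=(K_2*\overline\mu_t)(\overline Y^i)+\frac1m\sum_{j=1}^mH_2(\overline Y^j-\overline Y^i)+h^i(t)\,g^i(\overline\mu_t),\qquad \overline Y^i(0)=Y^i_0 ,$$ in the class of solutions with $\mathbb E\big[\sup_{t\in[0,T]}|\overline X(t)|\big]<\infty$. Solutions of both systems are pathwise solutions with continuous paths (almost surely the integrated equations hold for all $t\in[0,T]$). **Costs.** Let $\mathcal L:[0,T]\times(\mathbb R^d)^m\times\mathcal W_1(\mathbb R^d)\to\mathbb R$ be uniformly continuous and let $\Psi:(\mathbb R^{d\times\ell})^m\times(\mathbb R^\ell)^m\to\mathbb R$ be continuous, and convex in the first variable. Set $$\mathcal F_N(\mathbf h,\mathbf g)=\mathbb E\Big[\int_0^T\mathcal L\big(t,\mathbf Y(t),\mu_N(t)\big)dt+\int_0^T\Psi\big(\mathbf h(t),\mathbf g(\mu_N(t))\big)dt\Big],$$ $$\mathcal F(\mathbf h,\mathbf g)=\int_0^T\mathcal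 L\big(t,\overline{\mathbf Y}(t),\overline\mu_t\big)dt+\int_0^T\Psi\big(\mathbf h(t),\mathbf g(\overline\mu_t)\big)dt .$$ **Theorem.** For all $N\ge1$ and $(\mathbf h,\mathbf g)\in E^m$ both systems have a pathwise unique solution and the integrals and the expectation in $\mathcal F_N(\mathbf h,\mathbf g)$ and $\mathcal F(\mathbf h,\mathbf g)$ converge, so that $\mathcal F_N,\mathcal F:E^m\to\mathbb R$ are well defined. As $N\to\infty$, $\mathcal F_N$ $\Gamma$-converges to $\mathcal F$ on $E^m$: for each $(\mathbf h,\mathbf g)\in E^m$, one has $\mathcal F(\mathbf h,\mathbf g)\le\liminf_{N}\mathcal F_N(\mathbf h_N,\mathbf g_N)$ for every sequence $(\mathbf h_N,\mathbf g_N)\to(\mathbf h,\mathbf g)$ in $E^m$, and there is such a sequence with $\limsup_N\mathcal F_N(\mathbf h_N,\mathbf g_N)\le\mathcal F(\mathbf h,\mathbf g)$. Moreover $\mathcal F_N(\mathbf h,\mathbf g)\to\mathcal F(\mathbf h,\mathbf g)$ for each $(\mathbf h,\mathbf g)\in E^m$. -/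

import Mathlib

open MeasureTheory ProbabilityTheory Filter Topology
open scoped NNReal ENNReal BoundedContinuousFunction

noncomputable section

/-- The Euclidean space `ℝ^d`. -/
abbrev Euc (d : ℕ) : Type := EuclideanSpace ℝ (Fin d)

/-- The space `ℝ^{d × ℓ}` of real `d × ℓ` matrices, seen as the linear maps `ℝ^ℓ → ℝ^d`;
the matrix-vector product is the application of the map. -/
abbrev Mat (d ℓ : ℕ) : Type := Euc ℓ →L[ℝ] Euc d

/-! ### The 1-Wasserstein space of `ℝ^d` -/

/-- The Borel probability measures on `ℝ^d` with finite first moment. -/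
structure W1 (d : ℕ) where
  /-- the underlying measure -/
  val : Measure (Euc d)
  isProb : IsProbabilityMeasure val
  moment : Integrable (fun x : Euc d => ‖x‖) val

namespace W1

variable {d : ℕ}

instance (μ : W1 d) : IsProbabilityMeasure μ.val := μ.isProb

/-- `γ` is a coupling of `μ` and `ν`. -/
def IsCoupling (γ : Measure (Euc d × Euc d)) (μ ν : W1 d) : Prop :=
  γ.map Prod.fst = μ.val ∧ γ.map Prod.snd = ν.val

/-- The transport costs of all the couplings of `μ` and `ν`. -/
def costs (μ ν : W1 d) : Set ℝ :=
  {r | ∃ γ : Measure (Euc d × Euc d), IsCoupling γ μ ν ∧ r = ∫ z, dist z.1 z.2 ∂γ}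

/-- The 1-Wasserstein distance. -/
def wdist (μ ν : W1 d) : ℝ := sInf (costs μ ν)

theorem IsCoupling.isProb {γ : Measure (Euc d × Euc d)} {μ ν : W1 d} (h : IsCoupling γ μ ν) :
    IsProbabilityMeasure γ := by
  have h1 : IsProbabilityMeasure (γ.map Prod.fst) := by rw [h.1]; infer_instance
  exact Measure.isProbabilityMeasure_of_map Prod.fst

theorem IsCoupling.integrable {γ : Measure (Euc d × Euc d)} {μ ν : W1 d}
    (h : IsCoupling γ μ ν) : Integrable (fun z : Euc d × Euc d => dist z.1 z.2) γ := by
  have h1 : Integrable (fun z : Euc d × Euc d => ‖z.1‖) γ := by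
    have := μ.moment
    rw [← h.1] at this
    exact this.comp_measurable measurable_fst
  have h2 : Integrable (fun z : Euc d × Euc d => ‖z.2‖) γ := by
    have := ν.moment
    rw [← h.2] at this
    exact this.comp_measurable measurable_snd
  refine (h1.add h2).mono' (by fun_prop) (Eventually.of_forall fun z => ?_)
  rw [Real.norm_of_nonneg dist_nonneg, dist_eq_norm]
  exact norm_sub_le _ _

theorem costs_nonneg {μ ν : W1 d} {r : ℝ} (h : r ∈ costs μ ν) : 0 ≤ r := by
  obtain ⟨γ, -, rfl⟩ := h
  exact integral_nonneg fun _ => dist_nonneg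

theorem costs_bddBelow (μ ν : W1 d) : BddBelow (costs μ ν) := ⟨0, fun _ h => costs_nonneg h⟩

theorem costs_nonempty (μ ν : W1 d) : (costs μ ν).Nonempty :=
  ⟨_, μ.val.prod ν.val, ⟨by simp, by simp⟩, rfl⟩

theorem wdist_self (μ : W1 d) : wdist μ μ = 0 := by
  refine le_antisymm (csInf_le (costs_bddBelow μ μ) ?_)
    (le_csInf (costs_nonempty μ μ) fun _ h => costs_nonneg h)
  refine ⟨μ.val.map (fun x => (x, x)), ⟨?_, ?_⟩, ?_⟩
  · rw [Measure.map_map measurable_fst (by fun_prop)]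
    exact Measure.map_id
  · rw [Measure.map_map measurable_snd (by fun_prop)]
    exact Measure.map_id
  · rw [integral_map (by fun_prop) (by fun_prop)]
    simp

theorem costs_swap {μ ν : W1 d} {r : ℝ} (h : r ∈ costs μ ν) : r ∈ costs ν μ := by
  obtain ⟨γ, hγ, rfl⟩ := h
  refine ⟨γ.map Prod.swap, ⟨?_, ?_⟩, ?_⟩
  · rw [Measure.map_map measurable_fst measurable_swap]
    exact hγ.2
  · rw [Measure.map_map measurable_snd measurable_swap]
    exact hγ.1
  · rw [integral_map measurable_swap.aemeasurable (by fun_prop)]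
    simp [dist_comm]

theorem wdist_comm (μ ν : W1 d) : wdist μ ν = wdist ν μ := by
  unfold wdist
  congr 1
  exact Set.ext fun _ => ⟨costs_swap, costs_swap⟩

/-- Gluing of two couplings with a common marginal. -/
theorem costs_glue {μ ν ρ : W1 d} {a b : ℝ} (ha : a ∈ costs μ ν) (hb : b ∈ costs ν ρ) :
    ∃ c ∈ costs μ ρ, c ≤ a + b := by
  obtain ⟨γ, hγ, rfl⟩ := ha
  obtain ⟨δ, hδ, rfl⟩ := hb
  have := hγ.isProb
  have := hδ.isProb
  let κ : Kernel (Euc d × Euc d) (Euc d) := δ.condKernel.comap Prod.snd measurable_snd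
  let π : Measure ((Euc d × Euc d) × Euc d) := γ ⊗ₘ κ
  have hπ1 : π.map Prod.fst = γ := Measure.fst_compProd γ κ
  have hπ2 : π.map (fun z => (z.1.2, z.2)) = δ := by
    have hd : δ.fst ⊗ₘ δ.condKernel = δ := δ.disintegrate δ.condKernel
    have hf : δ.fst = γ.map Prod.snd := by rw [hγ.2]; exact hδ.1
    conv_rhs => rw [← hd]
    ext s hs
    rw [Measure.map_apply (by fun_prop) hs,
      Measure.compProd_apply (hs.preimage (by fun_prop)), Measure.compProd_apply hs, hf,
      lintegral_map (Kernel.measurable_kernel_prodMk_left hs) measurable_snd]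
    rfl
  have hcp : IsCoupling (π.map (fun z => (z.1.1, z.2))) μ ρ := by
    constructor
    · rw [Measure.map_map measurable_fst (by fun_prop), ← hγ.1, ← hπ1,
        Measure.map_map measurable_fst measurable_fst]
      rfl
    · rw [Measure.map_map measurable_snd (by fun_prop), ← hδ.2, ← hπ2,
        Measure.map_map measurable_snd (by fun_prop)]
      rfl
  have e1 : ∫ z, dist z.1 z.2 ∂γ = ∫ z, dist z.1.1 z.1.2 ∂π := by
    rw [← hπ1, integral_map measurable_fst.aemeasurable (by fun_prop)]
  have e2 : ∫ z, dist z.1 z.2 ∂δ = ∫ z, dist z.1.2 z.2 ∂π := by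
    rw [← hπ2, integral_map (by fun_prop) (by fun_prop)]
  have e3 : ∫ z, dist z.1 z.2 ∂(π.map (fun z => (z.1.1, z.2))) = ∫ z, dist z.1.1 z.2 ∂π := by
    rw [integral_map (by fun_prop) (by fun_prop)]
  have i1 : Integrable (fun z : (Euc d × Euc d) × Euc d => dist z.1.1 z.1.2) π := by
    have := hγ.integrable
    rw [← hπ1] at this
    exact this.comp_measurable measurable_fst
  have i2 : Integrable (fun z : (Euc d × Euc d) × Euc d => dist z.1.2 z.2) π := by
    have := hδ.integrable
    rw [← hπ2] at this
    exact this.comp_measurable (by fun_prop)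
  have i3 : Integrable (fun z : (Euc d × Euc d) × Euc d => dist z.1.1 z.2) π :=
    hcp.integrable.comp_measurable (by fun_prop)
  refine ⟨_, ⟨_, hcp, rfl⟩, ?_⟩
  rw [e1, e2, e3, ← integral_add i1 i2]
  exact integral_mono i3 (i1.add i2) fun z => dist_triangle _ _ _

theorem wdist_triangle (μ ν ρ : W1 d) : wdist μ ρ ≤ wdist μ ν + wdist ν ρ := by
  refine le_of_forall_pos_le_add fun ε hε => ?_
  obtain ⟨a, ha, ha'⟩ := exists_lt_of_csInf_lt (costs_nonempty μ ν)
    (lt_add_of_pos_right (sInf (costs μ ν)) (half_pos hε))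
  obtain ⟨b, hb, hb'⟩ := exists_lt_of_csInf_lt (costs_nonempty ν ρ)
    (lt_add_of_pos_right (sInf (costs ν ρ)) (half_pos hε))
  obtain ⟨c, hc, hcab⟩ := costs_glue ha hb
  have := csInf_le (costs_bddBelow μ ρ) hc
  unfold wdist
  linarith

/-- The Wasserstein space `𝒲₁(ℝ^d)`, with the 1-Wasserstein distance. -/
instance : PseudoMetricSpace (W1 d) where
  dist := wdist
  dist_self := wdist_self
  dist_comm := wdist_comm
  dist_triangle := wdist_triangle

/-- The empirical measure `(1/N) ∑ₙ δ_{xₙ}`. -/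
def empirical {N : ℕ} [NeZero N] (x : Fin N → Euc d) : W1 d where
  val := (N : ℝ≥0∞)⁻¹ • ∑ n, Measure.dirac (x n)
  isProb := ⟨by
    simp [ENNReal.inv_mul_cancel (Nat.cast_ne_zero.2 (NeZero.ne N)) (ENNReal.natCast_ne_top N)]⟩
  moment := by
    refine Integrable.smul_measure ?_ (by simp [NeZero.ne N])
    exact integrable_finsetSum_measure.2 fun n _ => integrable_dirac (by simp)

end W1

/-! ### The controls -/

/-- The set `L¹([0,T]; U)` of the classes of integrable functions on `[0,T]` with values in `U`. -/
structure TimeControl {d ℓ : ℕ} (T : ℝ) (U : Set (Mat d ℓ)) where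
  /-- the underlying element of `L¹([0,T]; ℝ^{d × ℓ})` -/
  toLp : Lp (Mat d ℓ) 1 ((volume : Measure ℝ).restrict (Set.Icc 0 T))
  mem : ∀ᵐ t ∂((volume : Measure ℝ).restrict (Set.Icc 0 T)), toLp t ∈ U

/-- `L¹([0,T]; U)` carries the weak topology of `L¹([0,T]; ℝ^{d × ℓ})`. -/
instance {d ℓ : ℕ} (T : ℝ) (U : Set (Mat d ℓ)) : TopologicalSpace (TimeControl T U) :=
  TopologicalSpace.induced (fun h => toWeakSpace ℝ _ h.toLp) inferInstance

/-- The set `𝒢` of the `M`-bounded and `L`-Lipschitz functions in `C⁰(𝒲₁(ℝ^d); ℝ^ℓ)`, with the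
topology of uniform convergence. -/
abbrev Feedback (d ℓ : ℕ) (M : ℝ) (L : ℝ≥0) : Type :=
  {g : W1 d →ᵇ Euc ℓ // (∀ μ, ‖g μ‖ ≤ M) ∧ LipschitzWith L g}

/-- The space `E^m` with `E = L¹([0,T]; U) × 𝒢`, with the product topology. -/
abbrev Controls {d ℓ : ℕ} (m : ℕ) (T : ℝ) (U : Set (Mat d ℓ)) (M : ℝ) (L : ℝ≥0) : Type :=
  Fin m → TimeControl T U × Feedback d ℓ M L

namespace Controls

variable {d ℓ m : ℕ} {T : ℝ} {U : Set (Mat d ℓ)} {M : ℝ} {L : ℝ≥0}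

/-- The time-dependent factors `𝐡(t) = (h¹(t), …, hᵐ(t))`. -/
def h (c : Controls m T U M L) (t : ℝ) : Fin m → Mat d ℓ := fun i => (c i).1.toLp t

/-- The feedback factors `𝐠(μ) = (g¹(μ), …, gᵐ(μ))`. -/
def g (c : Controls m T U M L) (μ : W1 d) : Fin m → Euc ℓ := fun i => (c i).2.1 μ

/-- The controls `uⁱ(t, μ) = hⁱ(t) gⁱ(μ)`. -/
def u (c : Controls m T U M L) (t : ℝ) (μ : W1 d) : Fin m → Euc d := fun i => c.h t i (c.g μ i)

end Controls

/-! ### The noise and the dynamics -/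

/-- `B` is a standard `d`-dimensional Brownian motion under `P`: its components are independent
real Brownian motions. -/
structure IsBrownianVec {Ω : Type*} [MeasurableSpace Ω] {d : ℕ} (B : ℝ≥0 → Ω → Euc d)
    (P : Measure Ω) : Prop where
  measurable : ∀ t, Measurable (B t)
  brownian : ∀ k, IsBrownianReal (fun t ω => B t ω k) P
  indep : iIndepFun (fun (k : Fin d) ω (t : ℝ≥0) => B t ω k) P

/-- Initial position `ξ` of law `μ₀` and an independent Brownian motion `B`. -/
structure IsDriver {Ω : Type*} [MeasurableSpace Ω] {d : ℕ} (P : Measure Ω) (μ₀ : Measure (Euc d))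
    (ξ : Ω → Euc d) (B : ℝ≥0 → Ω → Euc d) : Prop where
  measurable : Measurable ξ
  law : P.map ξ = μ₀
  brownian : IsBrownianVec B P
  indep : IndepFun ξ (fun ω (t : ℝ≥0) => B t ω) P

/-- The four interaction kernels: `H₁` among followers, `K₁` of the leaders on a follower,
`K₂` of the followers on a leader, `H₂` among leaders. -/
structure Kernels (d : ℕ) where
  /-- follower-follower -/
  H₁ : Euc d → Euc d
  /-- leader-leader -/
  H₂ : Euc d → Euc d
  /-- leader-follower -/
  K₁ : Euc d → Euc d
  /-- follower-leader -/
  K₂ : Euc d → Euc d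

/-- All the kernels are globally Lipschitz continuous. -/
def Kernels.IsLipschitz {d : ℕ} (k : Kernels d) : Prop :=
  ∃ C : ℝ≥0, LipschitzWith C k.H₁ ∧ LipschitzWith C k.H₂ ∧ LipschitzWith C k.K₁ ∧
    LipschitzWith C k.K₂

namespace Kernels

variable {d m : ℕ} (k : Kernels d)

/-- The convolution `(H ∗ μ)(x) = ∫ H(x - z) dμ(z)`. -/
def conv (H : Euc d → Euc d) (μ : W1 d) (x : Euc d) : Euc d := ∫ z, H (x - z) ∂μ.val

/-- Drift of a follower at `x`, the leaders being at `y`, in the field of `μ`. -/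
def driftX (μ : W1 d) (y : Fin m → Euc d) (x : Euc d) : Euc d :=
  conv k.H₁ μ x + (m : ℝ)⁻¹ • ∑ j, k.K₁ (y j - x)

/-- Drift (control excluded) of the leader `i`, the leaders being at `y`, in the field of `μ`. -/
def driftY (μ : W1 d) (y : Fin m → Euc d) (i : Fin m) : Euc d :=
  conv k.K₂ μ (y i) + (m : ℝ)⁻¹ • ∑ j, k.H₂ (y j - y i)

/-- Drift of the follower `n` in the system of `N` followers at `x` and leaders at `y`. -/
def particleDriftX {N : ℕ} (x : Fin N → Euc d) (y : Fin m → Euc d) (n : Fin N) : Euc d :=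
  (N : ℝ)⁻¹ • ∑ l, k.H₁ (x n - x l) + (m : ℝ)⁻¹ • ∑ j, k.K₁ (y j - x n)

/-- Drift (control excluded) of the leader `i` in the system of `N` followers at `x` and leaders
at `y`. -/
def particleDriftY {N : ℕ} (x : Fin N → Euc d) (y : Fin m → Euc d) (i : Fin m) : Euc d :=
  (N : ℝ)⁻¹ • ∑ l, k.K₂ (y i - x l) + (m : ℝ)⁻¹ • ∑ j, k.H₂ (y j - y i)

end Kernels

/-- On `[0,T]`, `x(t) = x₀ + ∫₀ᵗ b(s) ds + w(t)` with an integrable velocity `b`. For `w = 0` and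
`b(s) = f(s, x(s))`, this says that `x` is a Carathéodory solution of `x' = f(t, x)`,
`x(0) = x₀`. -/
def SolvesIntegralEq {d : ℕ} (T : ℝ) (x₀ : Euc d) (b w x : ℝ → Euc d) : Prop :=
  IntervalIntegrable b volume 0 T ∧
    ∀ t ∈ Set.Icc 0 T, x t = x₀ + (∫ s in (0 : ℝ)..t, b s) + w t

section Systems

variable {Ω : Type*} [MeasurableSpace Ω] {d ℓ m : ℕ} {T : ℝ} {U : Set (Mat d ℓ)} {M : ℝ} {L : ℝ≥0}

/-- `(X¹, …, X^N, Y¹, …, Yᵐ)` is a pathwise solution on `[0,T]` of the system of `N` followers and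
`m` leaders
`dXⁿ = ((1/N) ∑ₗ H₁(Xⁿ - Xˡ) + (1/m) ∑ⱼ K₁(Yʲ - Xⁿ)) dt + √(2σ) dBⁿ`, `Xⁿ(0) = ξⁿ`,
`dYⁱ/dt = (1/N) ∑ₗ K₂(Yⁱ - Xˡ) + (1/m) ∑ⱼ H₂(Yʲ - Yⁱ) + uⁱ(t, (1/N) ∑ₗ δ_{Xˡ})`, `Yⁱ(0) = Y₀ⁱ`. -/
structure IsParticleSolution (P : Measure Ω) (k : Kernels d) (σ : ℝ) (Y₀ : Fin m → Euc d)
    (c : Controls m T U M L) {N : ℕ} [NeZero N] (ξ : Fin N → Ω → Euc d)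
    (B : Fin N → ℝ≥0 → Ω → Euc d) (X : Fin N → ℝ → Ω → Euc d) (Y : Fin m → ℝ → Ω → Euc d) :
    Prop where
  measurable_X : ∀ n, ∀ t ∈ Set.Icc 0 T, Measurable (X n t)
  continuous_X : ∀ n ω, ContinuousOn (fun t => X n t ω) (Set.Icc 0 T)
  measurable_Y : ∀ i, ∀ t ∈ Set.Icc 0 T, Measurable (Y i t)
  continuous_Y : ∀ i ω, ContinuousOn (fun t => Y i t ω) (Set.Icc 0 T)
  eq_X : ∀ᵐ ω ∂P, ∀ n, SolvesIntegralEq T (ξ n ω)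
    (fun s => k.particleDriftX (fun l => X l s ω) (fun j => Y j s ω) n)
    (fun t => √(2 * σ) • B n t.toNNReal ω) (fun t => X n t ω)
  eq_Y : ∀ᵐ ω ∂P, ∀ i, SolvesIntegralEq T (Y₀ i)
    (fun s => k.particleDriftY (fun l => X l s ω) (fun j => Y j s ω) i +
      c.u s (W1.empirical fun l => X l s ω) i)
    0 (fun t => Y i t ω)

/-- `(X, Y¹, …, Yᵐ)`, with `μ t = Law(X(t))`, is a pathwise solution on `[0,T]` of the
McKean-Vlasov system
`dX = (H₁ ∗ μₜ(X) + (1/m) ∑ⱼ K₁(Yʲ - X)) dt + √(2σ) dB`, `X(0) = ξ`,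
`dYⁱ/dt = K₂ ∗ μₜ(Yⁱ) + (1/m) ∑ⱼ H₂(Yʲ - Yⁱ) + uⁱ(t, μₜ)`, `Yⁱ(0) = Y₀ⁱ`.
The field `moment` says that the law of `X` on `C⁰([0,T]; ℝ^d)` has a finite first moment. -/
structure IsMeanFieldSolution (P : Measure Ω) (k : Kernels d) (σ : ℝ) (Y₀ : Fin m → Euc d)
    (c : Controls m T U M L) (ξ : Ω → Euc d) (B : ℝ≥0 → Ω → Euc d)
    (X : ℝ → Ω → Euc d) (Y : Fin m → ℝ → Euc d) (μ : ℝ → W1 d) : Prop where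
  measurable_X : ∀ t ∈ Set.Icc 0 T, Measurable (X t)
  continuous_X : ∀ ω, ContinuousOn (fun t => X t ω) (Set.Icc 0 T)
  moment : ∫⁻ ω, ⨆ t ∈ Set.Icc 0 T, ‖X t ω‖ₑ ∂P < ∞
  law : ∀ t ∈ Set.Icc 0 T, P.map (X t) = (μ t).val
  continuous_Y : ∀ i, ContinuousOn (Y i) (Set.Icc 0 T)
  eq_X : ∀ᵐ ω ∂P, SolvesIntegralEq T (ξ ω)
    (fun s => k.driftX (μ s) (fun j => Y j s) (X s ω))
    (fun t => √(2 * σ) • B t.toNNReal ω) (fun t => X t ω)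
  eq_Y : ∀ i, SolvesIntegralEq T (Y₀ i)
    (fun s => k.driftY (μ s) (fun j => Y j s) i + c.u s (μ s) i) 0 (Y i)

/-! ### The costs -/

/-- `∫₀ᵀ 𝓛(t, y(t), μₜ) dt + ∫₀ᵀ Ψ(𝐡(t), 𝐠(μₜ)) dt`. -/
def pathCost (𝓛 : ℝ → (Fin m → Euc d) → W1 d → ℝ)
    (Ψ : (Fin m → Mat d ℓ) → (Fin m → Euc ℓ) → ℝ) (c : Controls m T U M L)
    (y : ℝ → Fin m → Euc d) (μ : ℝ → W1 d) : ℝ :=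
  (∫ t in (0 : ℝ)..T, 𝓛 t (y t) (μ t)) + ∫ t in (0 : ℝ)..T, Ψ (c.h t) (c.g (μ t))

/-- The two integrals in `pathCost` converge. -/
def PathCostConverges (𝓛 : ℝ → (Fin m → Euc d) → W1 d → ℝ)
    (Ψ : (Fin m → Mat d ℓ) → (Fin m → Euc ℓ) → ℝ) (c : Controls m T U M L)
    (y : ℝ → Fin m → Euc d) (μ : ℝ → W1 d) : Prop :=
  IntervalIntegrable (fun t => 𝓛 t (y t) (μ t)) volume 0 T ∧
    IntervalIntegrable (fun t => Ψ (c.h t) (c.g (μ t))) volume 0 T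

/-- The random cost of a trajectory `(X, Y)` of the particle system. -/
def particlePathCost (𝓛 : ℝ → (Fin m → Euc d) → W1 d → ℝ)
    (Ψ : (Fin m → Mat d ℓ) → (Fin m → Euc ℓ) → ℝ) (c : Controls m T U M L) {N : ℕ} [NeZero N]
    (X : Fin N → ℝ → Ω → Euc d) (Y : Fin m → ℝ → Ω → Euc d) (ω : Ω) : ℝ :=
  pathCost 𝓛 Ψ c (fun t i => Y i t ω) (fun t => W1.empirical fun n => X n t ω)

/-- The cost `𝓕_N(𝐡, 𝐠)`: the expected cost of the solution of the particle system of `N` followers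
under the controls `c = (𝐡, 𝐠)`. -/
def particleCost (P : Measure Ω) (k : Kernels d) (σ : ℝ) (Y₀ : Fin m → Euc d)
    (𝓛 : ℝ → (Fin m → Euc d) → W1 d → ℝ) (Ψ : (Fin m → Mat d ℓ) → (Fin m → Euc ℓ) → ℝ)
    {N : ℕ} [NeZero N] (ξ : Fin N → Ω → Euc d) (B : Fin N → ℝ≥0 → Ω → Euc d)
    (c : Controls m T U M L) : ℝ :=
  let S : (Fin N → ℝ → Ω → Euc d) × (Fin m → ℝ → Ω → Euc d) :=
    Classical.epsilon fun S => IsParticleSolution P k σ Y₀ c ξ B S.1 S.2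
  ∫ ω, particlePathCost 𝓛 Ψ c S.1 S.2 ω ∂P

/-- The cost `𝓕(𝐡, 𝐠)`: the cost of the solution of the McKean-Vlasov system under the controls
`c = (𝐡, 𝐠)`. -/
def meanFieldCost (P : Measure Ω) (k : Kernels d) (σ : ℝ) (Y₀ : Fin m → Euc d)
    (𝓛 : ℝ → (Fin m → Euc d) → W1 d → ℝ) (Ψ : (Fin m → Mat d ℓ) → (Fin m → Euc ℓ) → ℝ)
    (ξ : Ω → Euc d) (B : ℝ≥0 → Ω → Euc d) (c : Controls m T U M L) : ℝ :=
  let S : (ℝ → Ω → Euc d) × (Fin m → ℝ → Euc d) × (ℝ → W1 d) :=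
    @Classical.epsilon _
      ⟨fun _ _ => 0, fun _ _ => 0, fun _ => W1.empirical (N := 1) fun _ => 0⟩
      fun S => IsMeanFieldSolution P k σ Y₀ c ξ B S.1 S.2.1 S.2.2
  pathCost 𝓛 Ψ c (fun t i => S.2.1 i t) S.2.2

end Systems

/-- (Sequential) Γ-convergence of a sequence of functionals: the liminf inequality along every
convergent sequence, and the existence of recovery sequences. -/
def GammaConverges {𝓧 : Type*} [TopologicalSpace 𝓧] (F : ℕ → 𝓧 → ℝ) (F' : 𝓧 → ℝ) : Prop :=
  ∀ x, (∀ x' : ℕ → 𝓧, Tendsto x' atTop (𝓝 x) →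
      (F' x : EReal) ≤ liminf (fun n => (F n (x' n) : EReal)) atTop) ∧
    ∃ x' : ℕ → 𝓧, Tendsto x' atTop (𝓝 x) ∧
      limsup (fun n => (F n (x' n) : EReal)) atTop ≤ (F' x : EReal)

end

noncomputable section

/-! ### Integral inequalities and integral equations -/

/-- Grönwall's inequality in integral form. -/
theorem gronwall_integral {u : ℝ → ℝ} {a C T : ℝ} (hC : 0 ≤ C)
    (hu : ContinuousOn u (Set.Icc 0 T))
    (h : ∀ t ∈ Set.Icc 0 T, u t ≤ a + C * ∫ s in (0 : ℝ)..t, u s) :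
    ∀ t ∈ Set.Icc 0 T, u t ≤ a * Real.exp (C * t) := by
  intro t ht
  have hT : 0 ≤ T := ht.1.trans ht.2
  set v : ℝ → ℝ := Set.IccExtend hT ((Set.Icc 0 T).domRestrict u) with hv
  have hvc : Continuous v := continuous_IccExtend_iff.2 hu.domRestrict
  have hvu : ∀ s ∈ Set.Icc 0 T, v s = u s := fun s hs => by
    rw [hv, Set.IccExtend_of_mem hT _ hs]; rfl
  have hint : ∀ r ∈ Set.Icc 0 T, ∫ s in (0 : ℝ)..r, u s = ∫ s in (0 : ℝ)..r, v s := by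
    intro r hr
    refine intervalIntegral.integral_congr fun s hs => ?_
    rw [Set.uIcc_of_le hr.1] at hs
    exact (hvu s ⟨hs.1, hs.2.trans hr.2⟩).symm
  set F : ℝ → ℝ := fun r => a + C * ∫ s in (0 : ℝ)..r, v s with hF
  have hFd : ∀ r, HasDerivAt F (C * v r) r := fun r =>
    ((intervalIntegral.integral_hasDerivAt_right (hvc.intervalIntegrable _ _)
      (hvc.stronglyMeasurableAtFilter _ _) hvc.continuousAt).const_mul C).const_add a
  set G : ℝ → ℝ := fun r => F r * Real.exp (-(C * r)) with hG
  have hGd : ∀ r, HasDerivAt G (C * v r * Real.exp (-(C * r)) +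
      F r * (Real.exp (-(C * r)) * -(C * 1))) r := fun r =>
    (hFd r).mul (((hasDerivAt_id r).const_mul C).neg.exp)
  have hanti : AntitoneOn G (Set.Icc 0 T) := by
    refine antitoneOn_of_deriv_nonpos (convex_Icc 0 T)
      (fun r _ => (hGd r).continuousAt.continuousWithinAt)
      (fun r _ => (hGd r).differentiableAt.differentiableWithinAt) fun r hr => ?_
    rw [interior_Icc] at hr
    have hr' := Set.Ioo_subset_Icc_self hr
    rw [(hGd r).deriv]
    have h1 : v r ≤ F r := by rw [hvu r hr', hF]; simpa only [hint r hr'] using h r hr'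
    have h2 := Real.exp_pos (-(C * r))
    have : C * (v r - F r) * Real.exp (-(C * r)) ≤ 0 :=
      mul_nonpos_of_nonpos_of_nonneg
        (mul_nonpos_of_nonneg_of_nonpos hC (sub_nonpos.2 h1)) h2.le
    linarith
  have h0 : G t ≤ G 0 := hanti ⟨le_rfl, hT⟩ ht ht.1
  have hG0 : G 0 = a := by simp [hG, hF]
  have h1 : u t ≤ F t := by rw [hF]; simpa only [hint t ht] using h t ht
  have h2 : F t = G t * Real.exp (C * t) := by
    rw [hG]; simp only; rw [mul_assoc, ← Real.exp_add]; simp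
  rw [h2] at h1
  exact h1.trans (mul_le_mul_of_nonneg_right (h0.trans hG0.le) (Real.exp_pos _).le)

/-- A map of a complete metric space that is a contraction of Volterra type has a unique fixed
point. -/
theorem existsUnique_fixedPoint_of_volterra {Z : Type*} [MetricSpace Z] [CompleteSpace Z]
    [Nonempty Z] {T C : ℝ} (hT : 0 ≤ T) (hC : 0 ≤ C) (Φ : Z → Z) (e : ℝ → Z → Z → ℝ)
    (hint : ∀ z z', IntervalIntegrable (fun s => e s z z') volume 0 T)
    (hle : ∀ s ∈ Set.Icc 0 T, ∀ z z', e s z z' ≤ dist z z')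
    (he : ∀ t ∈ Set.Icc 0 T, ∀ z z', e t (Φ z) (Φ z') ≤ C * ∫ s in (0 : ℝ)..t, e s z z')
    (hd : ∀ z z', dist (Φ z) (Φ z') ≤ C * ∫ s in (0 : ℝ)..T, e s z z') : ∃! z, Φ z = z := by
  have key : ∀ (n : ℕ) (z z' : Z), ∀ t ∈ Set.Icc 0 T,
      e t (Φ^[n] z) (Φ^[n] z') ≤ (C * t) ^ n / n.factorial * dist z z' := by
    intro n z z'
    induction n with
    | zero => intro t ht; simpa using hle t ht z z'
    | succ n ih =>
      intro t ht
      rw [Function.iterate_succ_apply', Function.iterate_succ_apply']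
      refine (he t ht _ _).trans ?_
      have h1 : ∫ s in (0 : ℝ)..t, e s (Φ^[n] z) (Φ^[n] z') ≤
          ∫ s in (0 : ℝ)..t, (C * s) ^ n / n.factorial * dist z z' := by
        refine intervalIntegral.integral_mono_on ht.1
          ((hint _ _).mono_set ?_) (Continuous.intervalIntegrable (by fun_prop) _ _)
          fun s hs => ih s ⟨hs.1, hs.2.trans ht.2⟩
        rw [Set.uIcc_of_le ht.1, Set.uIcc_of_le hT]
        exact Set.Icc_subset_Icc le_rfl ht.2
      refine (mul_le_mul_of_nonneg_left h1 hC).trans (le_of_eq ?_)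
      simp only [mul_pow, intervalIntegral.integral_mul_const, intervalIntegral.integral_div,
        intervalIntegral.integral_const_mul, integral_pow, Nat.factorial_succ]
      push_cast
      have := Nat.factorial_ne_zero n
      field_simp
      ring
  have keyd : ∀ (n : ℕ) (z z' : Z),
      dist (Φ^[n + 1] z) (Φ^[n + 1] z') ≤ (C * T) ^ (n + 1) / (n + 1).factorial * dist z z' := by
    intro n z z'
    rw [Function.iterate_succ_apply', Function.iterate_succ_apply']
    refine (hd _ _).trans ?_
    have h1 : ∫ s in (0 : ℝ)..T, e s (Φ^[n] z) (Φ^[n] z') ≤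
        ∫ s in (0 : ℝ)..T, (C * s) ^ n / n.factorial * dist z z' :=
      intervalIntegral.integral_mono_on hT (hint _ _)
        (Continuous.intervalIntegrable (by fun_prop) _ _) fun s hs => key n z z' s hs
    refine (mul_le_mul_of_nonneg_left h1 hC).trans (le_of_eq ?_)
    simp only [mul_pow, intervalIntegral.integral_mul_const, intervalIntegral.integral_div,
      intervalIntegral.integral_const_mul, integral_pow, Nat.factorial_succ]
    push_cast
    have := Nat.factorial_ne_zero n
    field_simp
    ring
  obtain ⟨n, hn⟩ : ∃ n : ℕ, (C * T) ^ (n + 1) / (n + 1).factorial < 1 :=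
    ((FloorSemiring.tendsto_pow_div_factorial_atTop (C * T)).comp
      (tendsto_add_atTop_nat 1)).eventually_lt_const one_pos |>.exists
  have hnn : 0 ≤ (C * T) ^ (n + 1) / (n + 1).factorial := by positivity
  have hcontr : ContractingWith ⟨_, hnn⟩ (Φ^[n + 1]) :=
    ⟨by exact_mod_cast hn, LipschitzWith.of_dist_le_mul fun z z' => keyd n z z'⟩
  refine ⟨hcontr.fixedPoint _, hcontr.isFixedPt_fixedPoint_iterate, fun z hz => ?_⟩
  exact hcontr.fixedPoint_unique (Function.IsFixedPt.iterate hz _)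

section Caratheodory

variable {E : Type*} [NormedAddCommGroup E]

/-- A time-dependent vector field on `[0,T]`, Lipschitz in space uniformly in time. -/
structure IsCaratheodoryField (T C K : ℝ) (f : ℝ → E → E) : Prop where
  aestronglyMeasurable : ∀ x : ℝ → E, Continuous x →
    AEStronglyMeasurable (fun s => f s (x s)) (volume.restrict (Set.Icc 0 T))
  lipschitz : ∀ᵐ s ∂volume.restrict (Set.Icc 0 T), ∀ x y, ‖f s x - f s y‖ ≤ C * ‖x - y‖
  bound : ∀ᵐ s ∂volume.restrict (Set.Icc 0 T), ‖f s 0‖ ≤ K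

/-- A continuous function on `[0,T]`, extended to the line by constants. -/
abbrev extendPath {T : ℝ} (hT : 0 ≤ T) (x : C(Set.Icc 0 T, E)) : ℝ → E := Set.IccExtend hT x

theorem continuous_extendPath {T : ℝ} (hT : 0 ≤ T) (x : C(Set.Icc 0 T, E)) :
    Continuous (extendPath hT x) := continuous_IccExtend_iff.2 x.continuous

theorem extendPath_of_mem {T : ℝ} (hT : 0 ≤ T) (x : C(Set.Icc 0 T, E)) {t : ℝ}
    (ht : t ∈ Set.Icc 0 T) : extendPath hT x t = x ⟨t, ht⟩ := Set.IccExtend_of_mem hT _ ht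

theorem norm_extendPath_sub_le {T : ℝ} (hT : 0 ≤ T) (x y : C(Set.Icc 0 T, E)) (t : ℝ) :
    ‖extendPath hT x t - extendPath hT y t‖ ≤ ‖x - y‖ :=
  (x - y).norm_coe_le_norm (Set.projIcc 0 T hT t)

theorem norm_extendPath_le {T : ℝ} (hT : 0 ≤ T) (x : C(Set.Icc 0 T, E)) (t : ℝ) :
    ‖extendPath hT x t‖ ≤ ‖x‖ := x.norm_coe_le_norm (Set.projIcc 0 T hT t)

theorem intervalIntegrable_zero_of_mem {F : Type*} [NormedAddCommGroup F] {T t : ℝ} {b : ℝ → F}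
    (hb : IntervalIntegrable b volume 0 T) (ht : t ∈ Set.Icc 0 T) :
    IntervalIntegrable b volume 0 t := by
  refine hb.mono_set ?_
  rw [Set.uIcc_of_le ht.1, Set.uIcc_of_le (ht.1.trans ht.2)]
  exact Set.Icc_subset_Icc le_rfl ht.2

theorem ae_restrict_uIoc_of_ae {T t : ℝ} (ht : t ∈ Set.Icc 0 T) {p : ℝ → Prop}
    (h : ∀ᵐ s ∂volume.restrict (Set.Icc 0 T), p s) : ∀ᵐ s, s ∈ Set.Ioc 0 t → p s := by
  rw [ae_restrict_iff' measurableSet_Icc] at h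
  filter_upwards [h] with s hs hs'
  exact hs ⟨hs'.1.le, hs'.2.trans ht.2⟩

variable {T C K : ℝ} {f : ℝ → E → E}

namespace IsCaratheodoryField

theorem aestronglyMeasurable_of_continuousOn (hf : IsCaratheodoryField T C K f) (hT : 0 ≤ T)
    {x : ℝ → E} (hx : ContinuousOn x (Set.Icc 0 T)) :
    AEStronglyMeasurable (fun s => f s (x s)) (volume.restrict (Set.Icc 0 T)) := by
  refine (hf.aestronglyMeasurable (Set.IccExtend hT ((Set.Icc 0 T).domRestrict x))
    (continuous_IccExtend_iff.2 hx.domRestrict)).congr ?_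
  filter_upwards [self_mem_ae_restrict measurableSet_Icc] with s hs
  rw [Set.IccExtend_of_mem hT _ hs]; rfl

theorem norm_le (hf : IsCaratheodoryField T C K f) :
    ∀ᵐ s ∂volume.restrict (Set.Icc 0 T), ∀ x, ‖f s x‖ ≤ K + C * ‖x‖ := by
  filter_upwards [hf.lipschitz, hf.bound] with s h1 h2 x
  have := h1 x 0
  rw [sub_zero] at this
  have h3 : ‖f s x‖ ≤ ‖f s 0‖ + ‖f s x - f s 0‖ := by
    simpa using norm_add_le (f s 0) (f s x - f s 0)
  linarith

theorem intervalIntegrable (hf : IsCaratheodoryField T C K f) (hT : 0 ≤ T)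
    {x : ℝ → E} (hx : ContinuousOn x (Set.Icc 0 T)) :
    IntervalIntegrable (fun s => f s (x s)) volume 0 T := by
  rw [intervalIntegrable_iff_integrableOn_Icc_of_le hT]
  have hi : IntegrableOn (fun s => K + C * ‖x s‖) (Set.Icc 0 T) :=
    ContinuousOn.integrableOn_Icc (by fun_prop)
  refine hi.mono' (hf.aestronglyMeasurable_of_continuousOn hT hx) ?_
  filter_upwards [hf.norm_le] with s hs using hs _

end IsCaratheodoryField

variable [NormedSpace ℝ E]

/-- The primitive of an integrable function, as a path. -/
def primitivePath {T : ℝ} (b : ℝ → E) (hb : IntervalIntegrable b volume 0 T) (hT : 0 ≤ T) :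
    C(Set.Icc 0 T, E) where
  toFun t := ∫ s in (0 : ℝ)..t, b s
  continuous_toFun := by
    have := intervalIntegral.continuousOn_primitive_interval (μ := volume) (a := 0) (b := T) (f := b)
      (by rw [Set.uIcc_of_le hT]; exact (intervalIntegrable_iff_integrableOn_Icc_of_le hT).1 hb)
    rw [Set.uIcc_of_le hT] at this
    exact this.domRestrict

theorem primitivePath_apply {T : ℝ} {b : ℝ → E} (hb : IntervalIntegrable b volume 0 T) (hT : 0 ≤ T)
    (t : Set.Icc 0 T) : primitivePath b hb hT t = ∫ s in (0 : ℝ)..t, b s := rfl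

namespace IsCaratheodoryField

theorem norm_integral_sub_le (hf : IsCaratheodoryField T C K f)
    {x y : ℝ → E} (hx : ContinuousOn x (Set.Icc 0 T)) (hy : ContinuousOn y (Set.Icc 0 T))
    {t : ℝ} (ht : t ∈ Set.Icc 0 T) :
    ‖(∫ s in (0 : ℝ)..t, f s (x s)) - ∫ s in (0 : ℝ)..t, f s (y s)‖ ≤
      C * ∫ s in (0 : ℝ)..t, ‖x s - y s‖ := by
  have hT : 0 ≤ T := ht.1.trans ht.2
  have hx' := intervalIntegrable_zero_of_mem (hf.intervalIntegrable hT hx) ht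
  have hy' := intervalIntegrable_zero_of_mem (hf.intervalIntegrable hT hy) ht
  rw [← intervalIntegral.integral_sub hx' hy', ← intervalIntegral.integral_const_mul]
  refine intervalIntegral.norm_integral_le_of_norm_le ht.1 ?_ ?_
  · exact ae_restrict_uIoc_of_ae ht (hf.lipschitz.mono fun s hs => hs _ _)
  · refine intervalIntegrable_zero_of_mem (T := T) ?_ ht
    refine ContinuousOn.intervalIntegrable ?_
    rw [Set.uIcc_of_le hT]
    fun_prop

theorem norm_integral_le (hf : IsCaratheodoryField T C K f)
    {x : ℝ → E} (hx : ContinuousOn x (Set.Icc 0 T)) {t : ℝ} (ht : t ∈ Set.Icc 0 T) :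
    ‖∫ s in (0 : ℝ)..t, f s (x s)‖ ≤ K * t + C * ∫ s in (0 : ℝ)..t, ‖x s‖ := by
  have hT : 0 ≤ T := ht.1.trans ht.2
  have hi : IntervalIntegrable (fun s => ‖x s‖) volume 0 t := by
    refine intervalIntegrable_zero_of_mem (T := T) ?_ ht
    refine ContinuousOn.intervalIntegrable ?_
    rw [Set.uIcc_of_le hT]
    fun_prop
  have : K * t + C * ∫ s in (0 : ℝ)..t, ‖x s‖ = ∫ s in (0 : ℝ)..t, (K + C * ‖x s‖) := by
    rw [intervalIntegral.integral_add (by simp) (hi.const_mul C)]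
    simp [mul_comm]
  rw [this]
  refine intervalIntegral.norm_integral_le_of_norm_le ht.1 ?_ ((by simp : IntervalIntegrable
    (fun _ => K) volume 0 t).add (hi.const_mul C))
  exact ae_restrict_uIoc_of_ae ht (hf.norm_le.mono fun s hs => hs _)

/-- Stability of the solutions of an integral equation. -/
theorem norm_sub_le (hf : IsCaratheodoryField T C K f) (hC : 0 ≤ C) {δ : ℝ}
    {x y v w : ℝ → E} (hx : ContinuousOn x (Set.Icc 0 T)) (hy : ContinuousOn y (Set.Icc 0 T))
    (hxv : ∀ t ∈ Set.Icc 0 T, x t = v t + ∫ s in (0 : ℝ)..t, f s (x s))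
    (hyw : ∀ t ∈ Set.Icc 0 T, y t = w t + ∫ s in (0 : ℝ)..t, f s (y s))
    (hvw : ∀ t ∈ Set.Icc 0 T, ‖v t - w t‖ ≤ δ) :
    ∀ t ∈ Set.Icc 0 T, ‖x t - y t‖ ≤ δ * Real.exp (C * t) := by
  refine gronwall_integral hC (by fun_prop) fun t ht => ?_
  have h1 := hf.norm_integral_sub_le hx hy ht
  rw [hxv t ht, hyw t ht, add_sub_add_comm]
  exact (norm_add_le _ _).trans (add_le_add (hvw t ht) h1)

variable [CompleteSpace E]

theorem exists_solution (hf : IsCaratheodoryField T C K f) (hT : 0 ≤ T) (hC : 0 ≤ C)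
    (w : C(Set.Icc 0 T, E)) :
    ∃ x : C(Set.Icc 0 T, E), ∀ t : Set.Icc 0 T,
      x t = w t + ∫ s in (0 : ℝ)..t, f s (extendPath hT x s) := by
  have hi : ∀ x : C(Set.Icc 0 T, E),
      IntervalIntegrable (fun s => f s (extendPath hT x s)) volume 0 T := fun x =>
    hf.intervalIntegrable hT (continuous_extendPath hT x).continuousOn
  set Φ : C(Set.Icc 0 T, E) → C(Set.Icc 0 T, E) := fun x => w + primitivePath _ (hi x) hT with hΦ
  have hsub : ∀ (x y : C(Set.Icc 0 T, E)) (t : Set.Icc 0 T), ‖Φ x t - Φ y t‖ ≤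
      C * ∫ s in (0 : ℝ)..t, ‖extendPath hT x s - extendPath hT y s‖ := by
    intro x y t
    simp only [hΦ, ContinuousMap.add_apply, add_sub_add_left_eq_sub]
    exact hf.norm_integral_sub_le (continuous_extendPath hT x).continuousOn
      (continuous_extendPath hT y).continuousOn t.2
  have hcont : ∀ x y : C(Set.Icc 0 T, E),
      Continuous fun s => ‖extendPath hT x s - extendPath hT y s‖ := fun x y =>
    ((continuous_extendPath hT x).sub (continuous_extendPath hT y)).norm
  obtain ⟨x, hx, -⟩ := existsUnique_fixedPoint_of_volterra hT hC Φ
    (fun s x y => ‖extendPath hT x s - extendPath hT y s‖)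
    (fun x y => (hcont x y).intervalIntegrable _ _)
    (fun s _ x y => by rw [dist_eq_norm]; exact norm_extendPath_sub_le hT x y s)
    (fun t ht x y => by
      rw [extendPath_of_mem hT _ ht, extendPath_of_mem hT _ ht]
      exact hsub x y ⟨t, ht⟩)
    (fun x y => by
      rw [dist_eq_norm]
      have hnn : ∀ t : ℝ, 0 ≤ t → 0 ≤ ∫ s in (0 : ℝ)..t,
          ‖extendPath hT x s - extendPath hT y s‖ := fun t ht =>
        intervalIntegral.integral_nonneg ht fun _ _ => norm_nonneg _
      rw [ContinuousMap.norm_le _ (mul_nonneg hC (hnn T hT))]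
      intro t
      refine (hsub x y t).trans (mul_le_mul_of_nonneg_left ?_ hC)
      exact intervalIntegral.integral_mono_interval le_rfl t.2.1 t.2.2
        (Eventually.of_forall fun _ => norm_nonneg _) ((hcont x y).intervalIntegrable _ _))
  exact ⟨x, fun t => by conv_lhs => rw [← hx]
                        rfl⟩

/-- The solution of `x(t) = w(t) + ∫₀ᵗ f(s, x(s)) ds`. -/
def solution (hf : IsCaratheodoryField T C K f) (hT : 0 ≤ T) (hC : 0 ≤ C)
    (w : C(Set.Icc 0 T, E)) : C(Set.Icc 0 T, E) := (hf.exists_solution hT hC w).choose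

variable (hf : IsCaratheodoryField T C K f) (hT : 0 ≤ T) (hC : 0 ≤ C)

theorem solution_eq (w : C(Set.Icc 0 T, E)) {t : ℝ} (ht : t ∈ Set.Icc 0 T) :
    extendPath hT (hf.solution hT hC w) t =
      extendPath hT w t + ∫ s in (0 : ℝ)..t, f s (extendPath hT (hf.solution hT hC w) s) := by
  rw [extendPath_of_mem hT _ ht, extendPath_of_mem hT _ ht]
  exact (hf.exists_solution hT hC w).choose_spec ⟨t, ht⟩

theorem norm_solution_sub_le (v w : C(Set.Icc 0 T, E)) :
    ‖hf.solution hT hC v - hf.solution hT hC w‖ ≤ ‖v - w‖ * Real.exp (C * T) := by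
  rw [ContinuousMap.norm_le _ (by positivity)]
  intro t
  have := hf.norm_sub_le hC (continuous_extendPath hT _).continuousOn
    (continuous_extendPath hT _).continuousOn (fun t ht => hf.solution_eq hT hC v ht)
    (fun t ht => hf.solution_eq hT hC w ht) (fun t _ => norm_extendPath_sub_le hT v w t) t t.2
  rw [extendPath_of_mem hT _ t.2, extendPath_of_mem hT _ t.2] at this
  refine this.trans ?_
  have := t.2.2
  gcongr

theorem continuous_solution : Continuous (hf.solution hT hC) := by
  refine (LipschitzWith.of_dist_le_mul (K := ⟨Real.exp (C * T), (Real.exp_pos _).le⟩)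
    fun v w => ?_).continuous
  rw [dist_eq_norm, dist_eq_norm, mul_comm]
  exact hf.norm_solution_sub_le hT hC v w

theorem norm_solution_le (w : C(Set.Icc 0 T, E)) :
    ‖hf.solution hT hC w‖ ≤ (‖w‖ + |K| * T) * Real.exp (C * T) := by
  rw [ContinuousMap.norm_le _ (by positivity)]
  intro t
  have := gronwall_integral (u := fun t => ‖extendPath hT (hf.solution hT hC w) t‖)
    (a := ‖w‖ + |K| * T) (T := T) hC (continuous_extendPath hT _).norm.continuousOn (fun t ht => by
      have h1 := hf.norm_integral_le (continuous_extendPath hT (hf.solution hT hC w)).continuousOn ht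
      have h2 := norm_extendPath_le hT w t
      have h3 : K * t ≤ |K| * T :=
        mul_le_mul (le_abs_self K) ht.2 ht.1 (abs_nonneg K)
      rw [hf.solution_eq hT hC w ht]
      have := norm_add_le (extendPath hT w t)
        (∫ s in (0 : ℝ)..t, f s (extendPath hT (hf.solution hT hC w) s))
      linarith) t t.2
  rw [extendPath_of_mem hT _ t.2] at this
  refine this.trans ?_
  have := t.2.2
  gcongr

theorem eq_solution (w : C(Set.Icc 0 T, E)) {x : ℝ → E} (hx : ContinuousOn x (Set.Icc 0 T))
    (h : ∀ t ∈ Set.Icc 0 T, x t = extendPath hT w t + ∫ s in (0 : ℝ)..t, f s (x s)) :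
    ∀ t ∈ Set.Icc 0 T, x t = extendPath hT (hf.solution hT hC w) t := by
  intro t ht
  have := hf.norm_sub_le (δ := 0) hC hx (continuous_extendPath hT _).continuousOn h
    (fun t ht => hf.solution_eq hT hC w ht) (by simp) t ht
  rw [zero_mul] at this
  exact sub_eq_zero.1 (norm_le_zero_iff.1 this)

end IsCaratheodoryField

end Caratheodory

namespace W1

variable {d : ℕ}

theorem ext_val {μ ν : W1 d} (h : μ.val = ν.val) : μ = ν := by
  cases μ; cases ν; congr

theorem dist_le_of_isCoupling {γ : Measure (Euc d × Euc d)} {μ ν : W1 d} (h : IsCoupling γ μ ν) :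
    dist μ ν ≤ ∫ z, dist z.1 z.2 ∂γ := csInf_le (costs_bddBelow μ ν) ⟨γ, h, rfl⟩

theorem exists_isCoupling_lt {μ ν : W1 d} {r : ℝ} (h : dist μ ν < r) :
    ∃ γ : Measure (Euc d × Euc d), IsCoupling γ μ ν ∧ ∫ z, dist z.1 z.2 ∂γ < r := by
  obtain ⟨a, ⟨γ, hγ, rfl⟩, ha⟩ := exists_lt_of_csInf_lt (costs_nonempty μ ν) h
  exact ⟨γ, hγ, ha⟩

/-- The law of an integrable random variable. -/
def law {Ω : Type*} [MeasurableSpace Ω] (P : Measure Ω) [IsProbabilityMeasure P] (f : Ω → Euc d)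
    (hf : Integrable f P) : W1 d where
  val := P.map f
  isProb := Measure.isProbabilityMeasure_map hf.aemeasurable
  moment := (integrable_map_measure (by fun_prop) hf.aemeasurable).2 hf.norm

theorem dist_law_le {Ω : Type*} [MeasurableSpace Ω] {P : Measure Ω} [IsProbabilityMeasure P]
    {f g : Ω → Euc d} (hf : Integrable f P) (hg : Integrable g P) :
    dist (law P f hf) (law P g hg) ≤ ∫ ω, ‖f ω - g ω‖ ∂P := by
  have hfg : AEMeasurable (fun ω => (f ω, g ω)) P := hf.aemeasurable.prodMk hg.aemeasurable
  refine (dist_le_of_isCoupling (γ := P.map fun ω => (f ω, g ω)) ⟨?_, ?_⟩).trans_eq ?_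
  · rw [AEMeasurable.map_map_of_aemeasurable measurable_fst.aemeasurable hfg]; rfl
  · rw [AEMeasurable.map_map_of_aemeasurable measurable_snd.aemeasurable hfg]; rfl
  · rw [integral_map hfg (by fun_prop)]
    simp [dist_eq_norm]

theorem integral_empirical {F : Type*} [NormedAddCommGroup F] [NormedSpace ℝ F]
    [CompleteSpace F] {N : ℕ} [NeZero N]
    (x : Fin N → Euc d) (f : Euc d → F) :
    ∫ z, f z ∂(empirical x).val = (N : ℝ)⁻¹ • ∑ n, f (x n) := by
  rw [empirical, integral_smul_measure, integral_finsetSum_measure fun n _ => integrable_dirac (by simp)]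
  simp

theorem dist_empirical_le {N : ℕ} [NeZero N] (x y : Fin N → Euc d) :
    dist (empirical x) (empirical y) ≤ (N : ℝ)⁻¹ * ∑ n, ‖x n - y n‖ := by
  refine (dist_le_of_isCoupling
    (γ := (N : ℝ≥0∞)⁻¹ • ∑ n, Measure.dirac (x n, y n)) ⟨?_, ?_⟩).trans_eq ?_
  · rw [Measure.map_smul, Measure.map_finset_sum (by fun_prop)]
    simp [Measure.map_dirac' measurable_fst, empirical]
  · rw [Measure.map_smul, Measure.map_finset_sum (by fun_prop)]
    simp [Measure.map_dirac' measurable_snd, empirical]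
  · rw [integral_smul_measure, integral_finsetSum_measure fun n _ => integrable_dirac (by simp)]
    simp [dist_eq_norm]

theorem dist_empirical_le_norm {N : ℕ} [NeZero N] (x y : Fin N → Euc d) :
    dist (empirical x) (empirical y) ≤ ‖x - y‖ := by
  refine (dist_empirical_le x y).trans ?_
  have h : ∑ n, ‖x n - y n‖ ≤ ∑ _n : Fin N, ‖x - y‖ :=
    Finset.sum_le_sum fun n _ => norm_le_pi_norm (x - y) n
  have hN : (0 : ℝ) < N := Nat.cast_pos.2 (NeZero.pos N)
  rw [Finset.sum_const, Finset.card_univ, Fintype.card_fin, nsmul_eq_mul] at h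
  calc (N : ℝ)⁻¹ * ∑ n, ‖x n - y n‖ ≤ (N : ℝ)⁻¹ * (N * ‖x - y‖) := by gcongr
    _ = ‖x - y‖ := by field_simp

theorem continuous_empirical {N : ℕ} [NeZero N] :
    Continuous (empirical : (Fin N → Euc d) → W1 d) :=
  (LipschitzWith.of_dist_le_mul (K := 1) fun x y => by
    simpa [dist_eq_norm x y] using dist_empirical_le_norm x y).continuous

/-- Two discrete measures with the same atoms are at Wasserstein distance at most the diameter of
the set of atoms times the distance in total variation. -/
theorem dist_le_of_discrete {ι : Type*} [Fintype ι] {a b : ι → ℝ} (ha : ∀ i, 0 ≤ a i)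
    (hb : ∀ i, 0 ≤ b i) (hab : ∑ i, a i = ∑ i, b i) {v : ι → Euc d} {D : ℝ} (hD : 0 ≤ D)
    (hv : ∀ i j, ‖v i - v j‖ ≤ D) {μ ν : W1 d}
    (hμ : μ.val = ∑ i, ENNReal.ofReal (a i) • Measure.dirac (v i))
    (hν : ν.val = ∑ i, ENNReal.ofReal (b i) • Measure.dirac (v i)) :
    dist μ ν ≤ D * ∑ i, |a i - b i| := by
  classical
  set c : ι → ℝ := fun i => min (a i) (b i) with hc
  have hc0 : ∀ i, 0 ≤ c i := fun i => le_min (ha i) (hb i)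
  have hca : ∀ i, 0 ≤ a i - c i := fun i => sub_nonneg.2 (min_le_left _ _)
  have hcb : ∀ i, 0 ≤ b i - c i := fun i => sub_nonneg.2 (min_le_right _ _)
  set r : ℝ := ∑ i, (a i - c i) with hr
  have hr' : r = ∑ i, (b i - c i) := by rw [hr, Finset.sum_sub_distrib, Finset.sum_sub_distrib, hab]
  have hr0 : 0 ≤ r := Finset.sum_nonneg fun i _ => hca i
  have hra : ∀ i, (a i - c i) * (r / r) = a i - c i := by
    intro i
    rcases eq_or_ne r 0 with h | h
    · rw [hr, Finset.sum_eq_zero_iff_of_nonneg fun i _ => hca i] at h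
      simp [h i (Finset.mem_univ i)]
    · rw [div_self h, mul_one]
  have hrb : ∀ i, (b i - c i) * (r / r) = b i - c i := by
    intro i
    rcases eq_or_ne r 0 with h | h
    · rw [hr', Finset.sum_eq_zero_iff_of_nonneg fun i _ => hcb i] at h
      simp [h i (Finset.mem_univ i)]
    · rw [div_self h, mul_one]
  set w : ι → ι → ℝ := fun i j => (if i = j then c i else 0) + (a i - c i) * (b j - c j) / r with hw
  have hw0 : ∀ i j, 0 ≤ w i j := fun i j => by
    refine add_nonneg ?_ (div_nonneg (mul_nonneg (hca i) (hcb j)) hr0)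
    split_ifs
    exacts [hc0 i, le_rfl]
  have hwa : ∀ i, ∑ j, w i j = a i := fun i => by
    have : ∑ j, (a i - c i) * (b j - c j) / r = (a i - c i) * (r / r) := by
      rw [← Finset.sum_div, ← Finset.mul_sum, ← hr', mul_div_assoc]
    simp only [hw, Finset.sum_add_distrib, Finset.sum_ite_eq, Finset.mem_univ, if_true, this, hra]
    ring
  have hwb : ∀ j, ∑ i, w i j = b j := fun j => by
    have : ∑ i, (a i - c i) * (b j - c j) / r = (b j - c j) * (r / r) := by
      rw [← Finset.sum_div, ← Finset.sum_mul, ← hr]; ring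
    simp only [hw, Finset.sum_add_distrib, Finset.sum_ite_eq', Finset.mem_univ, if_true, this, hrb]
    ring
  refine (dist_le_of_isCoupling
    (γ := ∑ i, ∑ j, ENNReal.ofReal (w i j) • Measure.dirac (v i, v j)) ⟨?_, ?_⟩).trans ?_
  · rw [Measure.map_finset_sum (by fun_prop), hμ]
    refine Finset.sum_congr rfl fun i _ => ?_
    rw [Measure.map_finset_sum (by fun_prop), ← hwa i, ENNReal.ofReal_sum_of_nonneg fun j _ => hw0 i j,
      Finset.sum_smul]
    refine Finset.sum_congr rfl fun j _ => ?_
    rw [Measure.map_smul, Measure.map_dirac' measurable_fst]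
  · rw [Finset.sum_comm, Measure.map_finset_sum (by fun_prop), hν]
    refine Finset.sum_congr rfl fun j _ => ?_
    rw [Measure.map_finset_sum (by fun_prop), ← hwb j, ENNReal.ofReal_sum_of_nonneg fun i _ => hw0 i j,
      Finset.sum_smul]
    refine Finset.sum_congr rfl fun j _ => ?_
    rw [Measure.map_smul, Measure.map_dirac' measurable_snd]
  · have hint : ∀ i j, Integrable (fun z : Euc d × Euc d => dist z.1 z.2)
        (ENNReal.ofReal (w i j) • Measure.dirac (v i, v j)) := fun i j =>
      (integrable_dirac (by simp)).smul_measure (by simp)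
    rw [integral_finsetSum_measure fun i _ => integrable_finsetSum_measure.2 fun j _ => hint i j]
    have h1 : ∀ i, ∫ z : Euc d × Euc d, dist z.1 z.2
        ∂(∑ j, ENNReal.ofReal (w i j) • Measure.dirac (v i, v j)) =
        ∑ j, w i j * ‖v i - v j‖ := by
      intro i
      rw [integral_finsetSum_measure fun j _ => hint i j]
      refine Finset.sum_congr rfl fun j _ => ?_
      rw [integral_smul_measure, integral_dirac, ENNReal.toReal_ofReal (hw0 i j), dist_eq_norm,
        smul_eq_mul]
    simp only [h1]
    have h2 : ∀ i j, w i j * ‖v i - v j‖ ≤ (a i - c i) * (b j - c j) / r * D := by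
      intro i j
      simp only [hw, add_mul]
      have h3 : (if i = j then c i else 0) * ‖v i - v j‖ = 0 := by
        split_ifs with h
        · simp [h]
        · simp
      rw [h3, zero_add]
      exact mul_le_mul_of_nonneg_left (hv i j) (div_nonneg (mul_nonneg (hca i) (hcb j)) hr0)
    refine (Finset.sum_le_sum fun i _ => Finset.sum_le_sum fun j _ => h2 i j).trans ?_
    have h3 : ∑ i, ∑ j, (a i - c i) * (b j - c j) / r * D = D * r := by
      simp only [← Finset.sum_mul, ← Finset.sum_div, ← Finset.mul_sum, ← hr', ← hr]
      rcases eq_or_ne r 0 with h | h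
      · simp [h]
      · field_simp
    rw [h3]
    refine mul_le_mul_of_nonneg_left (Finset.sum_le_sum fun i _ => ?_) hD
    simp only [hc]
    rcases le_total (a i) (b i) with h | h
    · rw [min_eq_left h, sub_self]; exact abs_nonneg _
    · rw [min_eq_right h]; exact le_abs_self _

/-- A function on `F × 𝒲₁` that varies little at small scales grows at most linearly. -/
theorem abs_sub_le_of_uniform {F : Type*} [NormedAddCommGroup F] [NormedSpace ℝ F]
    {G : F → W1 d → ℝ} {ε δ : ℝ} (hδ : 0 < δ) (hε : 0 ≤ ε)
    (h : ∀ y y' μ μ', ‖y - y'‖ < δ → dist μ μ' < δ → |G y μ - G y' μ'| ≤ ε)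
    (y y' : F) (μ μ' : W1 d) :
    |G y μ - G y' μ'| ≤ 2 * ε + ε / δ * (‖y - y'‖ + dist μ μ') := by
  obtain ⟨γ, hγ, hcost⟩ := exists_isCoupling_lt (lt_add_of_pos_right (dist μ μ') hδ)
  have := hγ.isProb
  have i1 : Integrable (fun z : Euc d × Euc d => z.1) γ := by
    have := (integrable_norm_iff (by fun_prop)).1 μ.moment
    rw [← hγ.1] at this
    exact this.comp_measurable measurable_fst
  have i2 : Integrable (fun z : Euc d × Euc d => z.2) γ := by
    have := (integrable_norm_iff (by fun_prop)).1 μ'.moment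
    rw [← hγ.2] at this
    exact this.comp_measurable measurable_snd
  have hi : ∀ θ : ℝ, Integrable (fun z : Euc d × Euc d => z.1 + θ • (z.2 - z.1)) γ := fun θ =>
    i1.add ((i2.sub i1).smul θ)
  set ρ : ℝ → W1 d := fun θ => law γ _ (hi θ) with hρ
  have hρ0 : ρ 0 = μ := ext_val (by simp [hρ, law, ← hγ.1])
  have hρ1 : ρ 1 = μ' := ext_val (by simp [hρ, law, ← hγ.2])
  set R : ℝ := ‖y - y'‖ + (dist μ μ' + δ) with hR
  have hR0 : 0 ≤ R := by positivity
  have hρd : ∀ θ θ', dist (ρ θ) (ρ θ') ≤ |θ - θ'| * (dist μ μ' + δ) := by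
    intro θ θ'
    refine (dist_law_le _ _).trans ?_
    have : ∀ z : Euc d × Euc d, ‖z.1 + θ • (z.2 - z.1) - (z.1 + θ' • (z.2 - z.1))‖ =
        |θ - θ'| * dist z.1 z.2 := fun z => by
      rw [add_sub_add_left_eq_sub, ← sub_smul, norm_smul, Real.norm_eq_abs, dist_comm, dist_eq_norm]
    simp only [this, integral_const_mul]
    gcongr
  set n : ℕ := ⌊R / δ⌋₊ + 1 with hn
  have hn0 : (0 : ℝ) < n := by positivity
  have hnR : R / n < δ := by
    rw [div_lt_iff₀ hn0, mul_comm, ← div_lt_iff₀ hδ, hn]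
    push_cast
    exact Nat.lt_floor_add_one _
  set q : ℕ → ℝ := fun k => G (y + ((k : ℝ) / n) • (y' - y)) (ρ ((k : ℝ) / n)) with hq
  have hstep : ∀ k, dist (q k) (q (k + 1)) ≤ ε := by
    intro k
    have hk : |(k : ℝ) / n - ((k + 1 : ℕ) : ℝ) / n| = 1 / n := by
      rw [← sub_div, abs_div, abs_of_pos hn0]; simp
    rw [Real.dist_eq]
    refine h _ _ _ _ ?_ ?_
    · rw [add_sub_add_left_eq_sub, ← sub_smul, norm_smul, Real.norm_eq_abs, hk, norm_sub_rev]
      refine lt_of_le_of_lt ?_ hnR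
      rw [one_div_mul_eq_div]
      gcongr
      rw [hR]
      have := dist_nonneg (x := μ) (y := μ')
      linarith
    · refine (hρd _ _).trans_lt (lt_of_le_of_lt ?_ hnR)
      rw [hk, one_div_mul_eq_div]
      gcongr
      rw [hR]
      linarith [norm_nonneg (y - y')]
  have htot := dist_le_range_sum_of_dist_le (f := q) (d := fun _ => ε) n fun {k} _ => hstep k
  have hq0 : q 0 = G y μ := by simp [hq, hρ0]
  have hqn : q n = G y' μ' := by simp [hq, hρ1]
  rw [hq0, hqn, Real.dist_eq, Finset.sum_const, Finset.card_range, nsmul_eq_mul] at htot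
  refine htot.trans ?_
  have h1 : (n : ℝ) ≤ R / δ + 1 := by
    rw [hn]; push_cast
    have := Nat.floor_le (div_nonneg hR0 hδ.le)
    linarith
  calc (n : ℝ) * ε ≤ (R / δ + 1) * ε := by gcongr
    _ = 2 * ε + ε / δ * (‖y - y'‖ + dist μ μ') := by rw [hR]; field_simp; ring

end W1

/-! ### Estimates on the drifts -/

theorem norm_average_le {F : Type*} [NormedAddCommGroup F] [NormedSpace ℝ F] {m : ℕ}
    {a : Fin m → F} {b : ℝ} (hb : 0 ≤ b) (h : ∀ j, ‖a j‖ ≤ b) : ‖(m : ℝ)⁻¹ • ∑ j, a j‖ ≤ b := by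
  rcases Nat.eq_zero_or_pos m with rfl | hm
  · simpa using hb
  have hm' : (0 : ℝ) < m := Nat.cast_pos.2 hm
  rw [norm_smul, norm_inv, Real.norm_natCast, inv_mul_le_iff₀ hm']
  refine (norm_sum_le _ _).trans ((Finset.sum_le_sum fun j _ => h j).trans ?_)
  simp

namespace Kernels

variable {d m : ℕ}

theorem integrable_comp_sub {C : ℝ≥0} {H : Euc d → Euc d} (hH : LipschitzWith C H) (μ : W1 d)
    (x : Euc d) : Integrable (fun z => H (x - z)) μ.val := by
  have hc : Continuous fun z => H (x - z) := hH.continuous.comp (by fun_prop)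
  refine ((integrable_const (‖H x‖)).add (μ.moment.const_mul (C : ℝ))).mono'
    hc.aestronglyMeasurable (Eventually.of_forall fun z => ?_)
  have h1 := hH.norm_sub_le (x - z) x
  have h2 : ‖H (x - z)‖ ≤ ‖H x‖ + ‖H (x - z) - H x‖ := by
    simpa using norm_add_le (H x) (H (x - z) - H x)
  simp only [sub_sub_cancel_left, norm_neg] at h1
  simp only [Pi.add_apply]
  linarith

theorem norm_conv_sub_le {C : ℝ≥0} {H : Euc d → Euc d} (hH : LipschitzWith C H) (μ ν : W1 d)
    (x y : Euc d) : ‖conv H μ x - conv H ν y‖ ≤ C * (‖x - y‖ + dist μ ν) := by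
  refine le_of_forall_pos_le_add fun ε hε => ?_
  have hC : (0 : ℝ) < C + 1 := by positivity
  obtain ⟨γ, hγ, hcost⟩ :=
    W1.exists_isCoupling_lt (lt_add_of_pos_right (dist μ ν) (div_pos hε hC))
  have := hγ.isProb
  have i1 := integrable_comp_sub hH μ x
  have i2 := integrable_comp_sub hH ν y
  rw [← hγ.1] at i1
  rw [← hγ.2] at i2
  have e1 : conv H μ x = ∫ z, H (x - z.1) ∂γ := by
    rw [conv, ← hγ.1, integral_map measurable_fst.aemeasurable i1.aestronglyMeasurable]
  have e2 : conv H ν y = ∫ z, H (y - z.2) ∂γ := by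
    rw [conv, ← hγ.2, integral_map measurable_snd.aemeasurable i2.aestronglyMeasurable]
  have j1 : Integrable (fun z : Euc d × Euc d => H (x - z.1)) γ := i1.comp_measurable measurable_fst
  have j2 : Integrable (fun z : Euc d × Euc d => H (y - z.2)) γ := i2.comp_measurable measurable_snd
  rw [e1, e2, ← integral_sub j1 j2]
  have hb : Integrable (fun z : Euc d × Euc d => (C : ℝ) * (‖x - y‖ + dist z.1 z.2)) γ :=
    ((integrable_const _).add hγ.integrable).const_mul _
  refine (norm_integral_le_of_norm_le hb (Eventually.of_forall fun z => ?_)).trans ?_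
  · refine (hH.norm_sub_le _ _).trans (mul_le_mul_of_nonneg_left ?_ C.coe_nonneg)
    rw [sub_sub_sub_comm, dist_eq_norm]
    exact norm_sub_le _ _
  · rw [integral_const_mul, integral_add (integrable_const _) hγ.integrable]
    simp only [integral_const, probReal_univ, one_smul]
    have h1 : (C : ℝ) * (ε / (C + 1)) ≤ ε := by
      rw [mul_div_assoc', div_le_iff₀ hC]; nlinarith
    have h2 := mul_le_mul_of_nonneg_left hcost.le C.coe_nonneg
    rw [mul_add] at h2 ⊢
    linarith

variable {k : Kernels d} {C : ℝ≥0}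

theorem norm_driftX_sub_le (h1 : LipschitzWith C k.H₁) (h2 : LipschitzWith C k.K₁) (μ μ' : W1 d)
    (y y' : Fin m → Euc d) (x x' : Euc d) :
    ‖k.driftX μ y x - k.driftX μ' y' x'‖ ≤ 3 * C * (‖x - x'‖ + ‖y - y'‖ + dist μ μ') := by
  have e : k.driftX μ y x - k.driftX μ' y' x' = (conv k.H₁ μ x - conv k.H₁ μ' x') +
      (m : ℝ)⁻¹ • ∑ j, (k.K₁ (y j - x) - k.K₁ (y' j - x')) := by
    rw [driftX, driftX, Finset.sum_sub_distrib, smul_sub]; abel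
  rw [e]
  have hb : ‖(m : ℝ)⁻¹ • ∑ j, (k.K₁ (y j - x) - k.K₁ (y' j - x'))‖ ≤
      C * (‖y - y'‖ + ‖x - x'‖) := by
    refine norm_average_le (by positivity) fun j => (h2.norm_sub_le _ _).trans ?_
    rw [sub_sub_sub_comm]
    exact mul_le_mul_of_nonneg_left ((norm_sub_le _ _).trans
      (add_le_add_left (norm_le_pi_norm (y - y') j) _)) C.coe_nonneg
  have ha := norm_conv_sub_le h1 μ μ' x x'
  refine (norm_add_le _ _).trans ((add_le_add ha hb).trans ?_)
  have := C.coe_nonneg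
  have := mul_nonneg this (norm_nonneg (x - x'))
  have := mul_nonneg C.coe_nonneg (norm_nonneg (y - y'))
  have := mul_nonneg C.coe_nonneg (dist_nonneg (x := μ) (y := μ'))
  nlinarith

theorem norm_driftY_sub_le (h1 : LipschitzWith C k.H₂) (h2 : LipschitzWith C k.K₂) (μ μ' : W1 d)
    (y y' : Fin m → Euc d) (i : Fin m) :
    ‖k.driftY μ y i - k.driftY μ' y' i‖ ≤ 3 * C * (‖y - y'‖ + dist μ μ') := by
  have e : k.driftY μ y i - k.driftY μ' y' i = (conv k.K₂ μ (y i) - conv k.K₂ μ' (y' i)) +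
      (m : ℝ)⁻¹ • ∑ j, (k.H₂ (y j - y i) - k.H₂ (y' j - y' i)) := by
    rw [driftY, driftY, Finset.sum_sub_distrib, smul_sub]; abel
  rw [e]
  have hy := norm_le_pi_norm (y - y')
  simp only [Pi.sub_apply] at hy
  have hb : ‖(m : ℝ)⁻¹ • ∑ j, (k.H₂ (y j - y i) - k.H₂ (y' j - y' i))‖ ≤
      C * (‖y - y'‖ + ‖y - y'‖) := by
    refine norm_average_le (by positivity) fun j => (h1.norm_sub_le _ _).trans ?_
    rw [sub_sub_sub_comm]
    exact mul_le_mul_of_nonneg_left ((norm_sub_le _ _).trans (add_le_add (hy j) (hy i)))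
      C.coe_nonneg
  have ha := norm_conv_sub_le h2 μ μ' (y i) (y' i)
  refine (norm_add_le _ _).trans ((add_le_add ha hb).trans ?_)
  have := mul_le_mul_of_nonneg_left (hy i) C.coe_nonneg
  have := mul_nonneg C.coe_nonneg (dist_nonneg (x := μ) (y := μ'))
  nlinarith

theorem particleDriftX_eq {N : ℕ} [NeZero N] (x : Fin N → Euc d) (y : Fin m → Euc d) (n : Fin N) :
    k.particleDriftX x y n = k.driftX (W1.empirical x) y (x n) := by
  rw [particleDriftX, driftX, conv, W1.integral_empirical]

theorem particleDriftY_eq {N : ℕ} [NeZero N] (x : Fin N → Euc d) (y : Fin m → Euc d) (i : Fin m) :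
    k.particleDriftY x y i = k.driftY (W1.empirical x) y i := by
  rw [particleDriftY, driftY, conv, W1.integral_empirical]

end Kernels

/-! ### The space of continuous paths -/

section PathSpace

variable {T : ℝ} {E : Type*} [NormedAddCommGroup E]

instance pathMeasurableSpace : MeasurableSpace C(Set.Icc 0 T, E) := borel _

instance pathBorelSpace : BorelSpace C(Set.Icc 0 T, E) := ⟨rfl⟩

variable [MeasurableSpace E] [BorelSpace E]

theorem measurable_path_eval (t : Set.Icc 0 T) : Measurable fun x : C(Set.Icc 0 T, E) => x t :=
  (continuous_eval_const t).measurable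

variable [SecondCountableTopology E]

theorem measurable_path {Ω : Type*} [MeasurableSpace Ω] {f : Ω → C(Set.Icc 0 T, E)}
    (hf : ∀ t, Measurable fun ω => f ω t) : Measurable f := by
  have hball : ∀ (c : C(Set.Icc 0 T, E)) (q : ℝ), 0 ≤ q →
      MeasurableSet (f ⁻¹' Metric.closedBall c q) := by
    intro c q hq
    obtain ⟨s, hsc, hsd⟩ := TopologicalSpace.exists_countable_dense (Set.Icc 0 T)
    have : f ⁻¹' Metric.closedBall c q = ⋂ t ∈ s, {ω | dist (f ω t) (c t) ≤ q} := by
      ext ω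
      simp only [Set.mem_preimage, Metric.mem_closedBall, ContinuousMap.dist_le hq, Set.mem_iInter,
        Set.mem_ofPred_eq]
      refine ⟨fun h t _ => h t, fun h t => ?_⟩
      exact isClosed_property hsd.denseRange_val
        (isClosed_le (by fun_prop : Continuous fun t => dist (f ω t) (c t)) continuous_const)
        (fun t => h t.1 t.2) t
    rw [this]
    exact MeasurableSet.biInter hsc fun t _ =>
      measurableSet_le ((hf t).dist measurable_const) measurable_const
  refine measurable_of_isOpen fun U hU => ?_
  obtain ⟨D, hDc, hDd⟩ := TopologicalSpace.exists_countable_dense C(Set.Icc 0 T, E)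
  have : f ⁻¹' U = ⋃ c ∈ D, ⋃ n ∈ {n : ℕ | Metric.closedBall c (1 / ((n : ℝ) + 1)) ⊆ U},
      f ⁻¹' Metric.closedBall c (1 / ((n : ℝ) + 1)) := by
    ext ω
    simp only [Set.mem_preimage, Set.mem_iUnion, exists_prop, Set.mem_ofPred_eq]
    constructor
    · intro h
      obtain ⟨ε, hε, hεU⟩ := Metric.isOpen_iff.1 hU _ h
      obtain ⟨n, hn⟩ := exists_nat_one_div_lt (half_pos hε)
      obtain ⟨c, hcD, hc⟩ := hDd.exists_dist_lt (f ω) (Nat.one_div_pos_of_nat (α := ℝ) (n := n))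
      refine ⟨c, hcD, n, fun y hy => hεU ?_, hc.le⟩
      rw [Metric.mem_ball]
      rw [Metric.mem_closedBall] at hy
      have := dist_triangle y c (f ω)
      rw [dist_comm] at hc
      linarith
    · rintro ⟨c, -, n, hn, hω⟩
      exact hn hω
  rw [this]
  exact MeasurableSet.biUnion hDc fun c _ => MeasurableSet.biUnion (Set.to_countable _) fun n _ =>
    hball c _ (by positivity)

theorem pathMeasurableSpace_eq_comap : (pathMeasurableSpace : MeasurableSpace C(Set.Icc 0 T, E)) =
    MeasurableSpace.comap (fun x t => x t) MeasurableSpace.pi := by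
  refine le_antisymm ?_ (measurable_iff_comap_le.1 (measurable_pi_lambda _ measurable_path_eval))
  have : @Measurable _ _ (MeasurableSpace.comap (fun (x : C(Set.Icc 0 T, E)) t => x t)
      MeasurableSpace.pi) pathMeasurableSpace id := by
    let _ : MeasurableSpace C(Set.Icc 0 T, E) :=
      MeasurableSpace.comap (fun (x : C(Set.Icc 0 T, E)) t => x t) MeasurableSpace.pi
    exact measurable_path fun t =>
      (measurable_pi_apply t).comp (comap_measurable fun (x : C(Set.Icc 0 T, E)) t => x t)
  exact fun s hs => this hs

/-- A measure on paths is determined by the law of the underlying process. -/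
theorem path_measure_ext {μ ν : Measure C(Set.Icc 0 T, E)}
    (h : μ.map (fun x t => x t) = ν.map (fun x t => x t)) : μ = ν := by
  ext s hs
  have hm : Measurable fun (x : C(Set.Icc 0 T, E)) t => x t :=
    measurable_pi_lambda _ measurable_path_eval
  rw [pathMeasurableSpace_eq_comap] at hs
  obtain ⟨u, hu, rfl⟩ := hs
  rw [← Measure.map_apply hm hu, ← Measure.map_apply hm hu, h]

/-- A process with almost surely continuous paths has a version in the space of paths. -/
theorem exists_path_version {Ω : Type*} [MeasurableSpace Ω] {P : Measure Ω}
    {Z : Set.Icc 0 T → Ω → E} (hZ : ∀ t, Measurable (Z t))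
    (hc : ∀ᵐ ω ∂P, Continuous fun t => Z t ω) :
    ∃ w : Ω → C(Set.Icc 0 T, E), Measurable w ∧ ∀ᵐ ω ∂P, ∀ t, w ω t = Z t ω := by
  classical
  set S := toMeasurable P {ω | ¬ Continuous fun t => Z t ω} with hS
  have hSc : ∀ ω, ω ∉ S → Continuous fun t => Z t ω := fun ω hω => by
    by_contra h
    exact hω (subset_toMeasurable _ _ h)
  have hS0 : P S = 0 := by rw [hS, measure_toMeasurable]; exact hc
  refine ⟨fun ω => if h : ω ∈ S then 0 else ⟨fun t => Z t ω, hSc ω h⟩,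
    measurable_path fun t => ?_, ?_⟩
  · have : (fun ω => (if h : ω ∈ S then (0 : C(Set.Icc 0 T, E)) else ⟨fun t => Z t ω, hSc ω h⟩) t) =
        fun ω => if ω ∈ S then 0 else Z t ω := by
      ext1 ω; by_cases h : ω ∈ S <;> simp [h]
    rw [this]
    exact Measurable.ite (measurableSet_toMeasurable _ _) measurable_const (hZ t)
  · filter_upwards [measure_eq_zero_iff_ae_notMem.1 hS0] with ω hω t
    simp [hω]

theorem iIndepFun_path {Ω ι : Type*} [MeasurableSpace Ω] {P : Measure Ω}
    {w : ι → Ω → C(Set.Icc 0 T, E)} (h : iIndepFun (fun n ω t => w n ω t) P) : iIndepFun w P := by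
  rw [iIndepFun_iff_iIndep] at h ⊢
  simpa only [pathMeasurableSpace_eq_comap, MeasurableSpace.comap_comp, Function.comp_def] using h

end PathSpace

/-! ### Brownian paths -/

section Brownian

variable {T : ℝ} {Ω : Type*} [MeasurableSpace Ω] {P : Measure Ω} [IsProbabilityMeasure P]

theorem path_prod_measure_ext {μ ν : Measure (C(Set.Icc 0 T, ℝ) × C(Set.Icc 0 T, ℝ))}
    (h : μ.map (fun p t => (p.1 t, p.2 t)) = ν.map (fun p t => (p.1 t, p.2 t))) : μ = ν := by
  set J : C(Set.Icc 0 T, ℝ) × C(Set.Icc 0 T, ℝ) → C(Set.Icc 0 T, ℝ × ℝ) :=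
    fun p => p.1.prodMk p.2 with hJ
  set R : C(Set.Icc 0 T, ℝ × ℝ) → C(Set.Icc 0 T, ℝ) × C(Set.Icc 0 T, ℝ) :=
    fun x => (ContinuousMap.fst.comp x, ContinuousMap.snd.comp x) with hR
  have hJm : Measurable J := measurable_path fun t =>
    ((measurable_path_eval t).comp measurable_fst).prodMk
      ((measurable_path_eval t).comp measurable_snd)
  have hRm : Measurable R :=
    (measurable_path fun t => measurable_fst.comp (measurable_path_eval t)).prodMk
      (measurable_path fun t => measurable_snd.comp (measurable_path_eval t))
  have hm : Measurable fun (x : C(Set.Icc 0 T, ℝ × ℝ)) t => x t :=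
    measurable_pi_lambda _ measurable_path_eval
  have hRJ : R ∘ J = id := by ext p <;> rfl
  have h1 : μ.map J = ν.map J := by
    refine path_measure_ext ?_
    rw [Measure.map_map hm hJm, Measure.map_map hm hJm]
    exact h
  rw [← Measure.map_id (μ := μ), ← Measure.map_id (μ := ν), ← hRJ, ← Measure.map_map hRm hJm, h1,
    Measure.map_map hRm hJm]

theorem map_rotation_path_eq_self {B : ℝ≥0 → Ω → ℝ} (hB : IsPreBrownianReal B P)
    {β : Ω → C(Set.Icc 0 T, ℝ)} (hβ : Measurable β)
    (hβB : ∀ᵐ ω ∂P, ∀ t, β ω t = B (t : ℝ).toNNReal ω) (θ : ℝ) :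
    ((P.map β).prod (P.map β)).map (ContinuousLinearMap.rotation θ) =
      (P.map β).prod (P.map β) := by
  have := Measure.isProbabilityMeasure_map (μ := P) hβ.aemeasurable
  set ν := P.map β with hν
  have hpair : Measurable fun (p : C(Set.Icc 0 T, ℝ) × C(Set.Icc 0 T, ℝ)) t => (p.1 t, p.2 t) :=
    measurable_pi_lambda _ fun t => ((measurable_path_eval t).comp measurable_fst).prodMk
      ((measurable_path_eval t).comp measurable_snd)
  have hrot : Measurable (ContinuousLinearMap.rotation θ :
      C(Set.Icc 0 T, ℝ) × C(Set.Icc 0 T, ℝ) →L[ℝ] _) := (ContinuousLinearMap.continuous _).measurable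
  refine path_prod_measure_ext ?_
  rw [Measure.map_map hpair hrot]
  refine (map_eq_iff_forall_finset_map_restrict_eq
    (X := fun t p => (((ContinuousLinearMap.rotation θ p).1 : C(Set.Icc 0 T, ℝ)) t,
      (ContinuousLinearMap.rotation θ p).2 t)) (Y := fun t p => (p.1 t, p.2 t))
    (hpair.comp hrot).aemeasurable hpair.aemeasurable).2 fun I => ?_
  set ev : C(Set.Icc 0 T, ℝ) → (I → ℝ) := fun x i => x i with hev
  have hevm : Measurable ev := measurable_pi_lambda _ fun i => measurable_path_eval _
  set zip : (I → ℝ) × (I → ℝ) → (I → ℝ × ℝ) := fun p i => (p.1 i, p.2 i) with hzip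
  have hzipm : Measurable zip := by fun_prop
  have hlaw : ν.map ev = P.map (fun ω => I.restrict fun t : Set.Icc 0 T => B (t : ℝ).toNNReal ω) := by
    rw [hν, Measure.map_map hevm hβ]
    refine Measure.map_congr ?_
    filter_upwards [hβB] with ω hω
    ext i
    simp [hev, hω]
  have hG : HasGaussianLaw
      (fun ω => I.restrict fun t : Set.Icc 0 T => B (t : ℝ).toNNReal ω) P :=
    (hB.isGaussianProcess.comp_right fun t : Set.Icc 0 T => (t : ℝ).toNNReal).hasGaussianLaw I
  have hgauss : IsGaussian (ν.map ev) := by rw [hlaw]; exact hG.isGaussian_map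
  have hmean : ∫ x, id x ∂(ν.map ev) = 0 := by
    rw [hlaw, integral_map hG.aemeasurable (by fun_prop)]
    ext i
    simp only [id_eq]
    refine (eval_integral (fun j => hB.integrable_eval _) i).trans ?_
    exact hB.integral_eval _
  have hrotI := IsGaussian.map_rotation_eq_self hmean θ
  have hmap : (ν.map ev).prod (ν.map ev) = (ν.prod ν).map (Prod.map ev ev) :=
    Measure.map_prod_map _ _ hevm hevm
  have hrotm : Measurable (ContinuousLinearMap.rotation θ : (I → ℝ) × (I → ℝ) →L[ℝ] _) :=
    (ContinuousLinearMap.continuous _).measurable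
  have e1 : (fun p : C(Set.Icc 0 T, ℝ) × C(Set.Icc 0 T, ℝ) => I.restrict fun t =>
      (((ContinuousLinearMap.rotation θ p).1 : C(Set.Icc 0 T, ℝ)) t,
        (ContinuousLinearMap.rotation θ p).2 t)) =
      zip ∘ (ContinuousLinearMap.rotation θ) ∘ Prod.map ev ev := by
    ext p i <;> simp [hzip, hev, ContinuousLinearMap.rotation_apply]
  have e2 : (fun p : C(Set.Icc 0 T, ℝ) × C(Set.Icc 0 T, ℝ) => I.restrict fun t =>
      (p.1 t, p.2 t)) = zip ∘ Prod.map ev ev := by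
    ext p i <;> simp [hzip, hev]
  rw [e1, e2, ← Measure.map_map hzipm (hrotm.comp (hevm.prodMap hevm)),
    ← Measure.map_map hrotm (hevm.prodMap hevm), ← hmap, hrotI, hmap,
    Measure.map_map hzipm (hevm.prodMap hevm)]

/-- The supremum of a Brownian motion on a bounded interval is integrable. -/
theorem integrable_norm_brownian_path {B : ℝ≥0 → Ω → ℝ} (hB : IsPreBrownianReal B P)
    {β : Ω → C(Set.Icc 0 T, ℝ)} (hβ : Measurable β)
    (hβB : ∀ᵐ ω ∂P, ∀ t, β ω t = B (t : ℝ).toNNReal ω) : Integrable (fun ω => ‖β ω‖) P := by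
  have := Measure.isProbabilityMeasure_map (μ := P) hβ.aemeasurable
  obtain ⟨C, hC, hi⟩ := exists_integrable_exp_sq_of_map_rotation_eq_self
    (map_rotation_path_eq_self hB hβ hβB (-(Real.pi / 4)))
  have h1 : Integrable (fun x : C(Set.Icc 0 T, ℝ) => ‖x‖) (P.map β) := by
    refine ((integrable_const 1).add (hi.const_mul (1 / C))).mono'
      continuous_norm.aestronglyMeasurable (Eventually.of_forall fun x => ?_)
    have h2 := Real.add_one_le_exp (C * ‖x‖ ^ 2)
    have h3 : ‖x‖ ≤ 1 + ‖x‖ ^ 2 := by nlinarith [sq_nonneg (‖x‖ - 1), norm_nonneg x]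
    have h4 : ‖x‖ ^ 2 ≤ 1 / C * Real.exp (C * ‖x‖ ^ 2) := by
      rw [one_div_mul_eq_div, le_div_iff₀ hC]; linarith
    simp only [norm_norm, Pi.add_apply]
    linarith
  exact h1.comp_measurable hβ

variable {d : ℕ}

theorem IsBrownianVec.ae_continuous {B : ℝ≥0 → Ω → Euc d} (hB : IsBrownianVec B P) :
    ∀ᵐ ω ∂P, Continuous fun t => B t ω := by
  filter_upwards [ae_all_iff.2 fun k => (hB.brownian k).cont] with ω hω
  exact (PiLp.continuous_toLp 2 _).comp (continuous_pi hω)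

theorem IsBrownianVec.map_eq {B B' : ℝ≥0 → Ω → Euc d} (hB : IsBrownianVec B P)
    (hB' : IsBrownianVec B' P) :
    P.map (fun ω (t : ℝ≥0) => B t ω) = P.map (fun ω (t : ℝ≥0) => B' t ω) := by
  set G : (Fin d → ℝ≥0 → ℝ) → ℝ≥0 → Euc d := fun c t => WithLp.toLp 2 fun k => c k t with hG
  have hGm : Measurable G := measurable_pi_lambda _ fun t =>
    (PiLp.continuous_toLp 2 _).measurable.comp (by fun_prop)
  have hcm : ∀ {B : ℝ≥0 → Ω → Euc d}, IsBrownianVec B P → ∀ k,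
      Measurable fun ω (t : ℝ≥0) => B t ω k := fun hB k => measurable_pi_lambda _ fun t =>
    (by fun_prop : Measurable fun x : Euc d => x k).comp (hB.measurable t)
  have key : ∀ {B : ℝ≥0 → Ω → Euc d}, IsBrownianVec B P → P.map (fun ω (t : ℝ≥0) => B t ω) =
      (Measure.pi fun k => P.map fun ω (t : ℝ≥0) => B t ω k).map G := by
    intro B hB
    rw [← (iIndepFun_iff_map_fun_eq_pi_map fun k => (hcm hB k).aemeasurable).1 hB.indep,
      Measure.map_map hGm (measurable_pi_lambda _ (hcm hB))]
    rfl
  rw [key hB, key hB']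
  congr 2
  ext1 k
  refine (map_eq_iff_forall_finset_map_restrict_eq (X := fun t ω => B t ω k)
    (Y := fun t ω => B' t ω k) (hcm hB k).aemeasurable (hcm hB' k).aemeasurable).2 fun I => ?_
  rw [((hB.brownian k).hasLaw I).map_eq, ((hB'.brownian k).hasLaw I).map_eq]

/-- `w` is the path `t ↦ ξ + √(2σ) B(t)` on `[0,T]`. -/
structure IsNoisePath (P : Measure Ω) (σ : ℝ) (ξ : Ω → Euc d) (B : ℝ≥0 → Ω → Euc d)
    (w : Ω → C(Set.Icc 0 T, Euc d)) : Prop where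
  measurable : Measurable w
  ae_eq : ∀ᵐ ω ∂P, ∀ t : Set.Icc 0 T, w ω t = ξ ω + √(2 * σ) • B (t : ℝ).toNNReal ω

variable {σ : ℝ} {μ₀ : Measure (Euc d)} {ξ ξ' : Ω → Euc d} {B B' : ℝ≥0 → Ω → Euc d}
  {w w' : Ω → C(Set.Icc 0 T, Euc d)}

theorem IsDriver.exists_isNoisePath (h : IsDriver P μ₀ ξ B) (σ T : ℝ) :
    ∃ w : Ω → C(Set.Icc 0 T, Euc d), IsNoisePath P σ ξ B w := by
  obtain ⟨w, hw, hwe⟩ := exists_path_version (P := P) (T := T)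
    (Z := fun t ω => ξ ω + √(2 * σ) • B (t : ℝ).toNNReal ω)
    (fun t => by
      have := h.measurable
      have := h.brownian.measurable (t : ℝ).toNNReal
      fun_prop) (by
      filter_upwards [h.brownian.ae_continuous] with ω hω
      have : Continuous fun t : Set.Icc 0 T => B (t : ℝ).toNNReal ω :=
        hω.comp (continuous_real_toNNReal.comp continuous_subtype_val)
      fun_prop)
  exact ⟨w, hw, hwe⟩

theorem measurable_noise_map : Measurable fun (z : Euc d × (ℝ≥0 → Euc d)) (t : Set.Icc 0 T) =>
    z.1 + √(2 * σ) • z.2 (t : ℝ).toNNReal := by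
  refine measurable_pi_lambda _ fun t => ?_
  fun_prop

theorem IsNoisePath.map_eq (hw : IsNoisePath P σ ξ B w) (hw' : IsNoisePath P σ ξ' B' w')
    (h : IsDriver P μ₀ ξ B) (h' : IsDriver P μ₀ ξ' B') : P.map w = P.map w' := by
  have hm : Measurable fun (x : C(Set.Icc 0 T, Euc d)) t => x t :=
    measurable_pi_lambda _ measurable_path_eval
  have key : ∀ {ξ : Ω → Euc d} {B : ℝ≥0 → Ω → Euc d} {w : Ω → C(Set.Icc 0 T, Euc d)},
      IsNoisePath P σ ξ B w → IsDriver P μ₀ ξ B → (P.map w).map (fun x t => x t) =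
        (μ₀.prod (P.map fun ω (t : ℝ≥0) => B t ω)).map
          fun z (t : Set.Icc 0 T) => z.1 + √(2 * σ) • z.2 (t : ℝ).toNNReal := by
    intro ξ B w hw h
    have hBm : Measurable fun ω (t : ℝ≥0) => B t ω := measurable_pi_lambda _ h.brownian.measurable
    rw [← h.law, ← (indepFun_iff_map_prod_eq_prod_map_map h.measurable.aemeasurable
      hBm.aemeasurable).1 h.indep, Measure.map_map measurable_noise_map (h.measurable.prodMk hBm),
      Measure.map_map hm hw.measurable]
    refine Measure.map_congr ?_
    filter_upwards [hw.ae_eq] with ω hω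
    ext1 t
    exact hω t
  refine path_measure_ext ?_
  rw [key hw h, key hw' h', h.brownian.map_eq h'.brownian]

theorem IsNoisePath.integrable (hw : IsNoisePath P σ ξ B w) (h : IsDriver P μ₀ ξ B)
    (hμ₀ : Integrable (fun x => ‖x‖) μ₀) : Integrable w P := by
  have hβ : ∀ k : Fin d, ∃ β : Ω → C(Set.Icc 0 T, ℝ), Measurable β ∧
      ∀ᵐ ω ∂P, ∀ t, β ω t = B (t : ℝ).toNNReal ω k := fun k =>
    exists_path_version (fun t => (by fun_prop : Measurable fun x : Euc d => x k).comp
      (h.brownian.measurable _)) (by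
        filter_upwards [(h.brownian.brownian k).cont] with ω hω
        exact hω.comp (continuous_real_toNNReal.comp continuous_subtype_val))
  choose β hβm hβe using hβ
  have hξ : Integrable (fun ω => ‖ξ ω‖) P := by
    rw [← h.law] at hμ₀
    exact hμ₀.comp_measurable h.measurable
  have hβi : ∀ k, Integrable (fun ω => ‖β k ω‖) P := fun k =>
    integrable_norm_brownian_path (h.brownian.brownian k).toIsPreBrownianReal (hβm k) (hβe k)
  refine (hξ.add ((integrable_finsetSum Finset.univ fun k _ => hβi k).const_mul √(2 * σ))).mono'
    hw.measurable.aestronglyMeasurable ?_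
  filter_upwards [hw.ae_eq, ae_all_iff.2 hβe] with ω hω hωβ
  simp only [Pi.add_apply]
  rw [ContinuousMap.norm_le _ (by positivity)]
  intro t
  rw [hω t]
  refine (norm_add_le _ _).trans ?_
  rw [norm_smul, Real.norm_of_nonneg (Real.sqrt_nonneg _)]
  gcongr
  have h1 : ‖B (t : ℝ).toNNReal ω‖ ≤ ∑ k, ‖B (t : ℝ).toNNReal ω k‖ := by
    rw [EuclideanSpace.norm_eq]
    refine Real.sqrt_le_iff.2 ⟨by positivity, ?_⟩
    exact Finset.sum_sq_le_sq_sum_of_nonneg fun _ _ => norm_nonneg _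
  refine h1.trans (Finset.sum_le_sum fun k _ => ?_)
  rw [← hωβ k t]
  exact (β k ω).norm_coe_le_norm t

theorem iIndepFun_noisePath {ξ : ℕ → Ω → Euc d} {B : ℕ → ℝ≥0 → Ω → Euc d}
    {w : ℕ → Ω → C(Set.Icc 0 T, Euc d)} (hw : ∀ n, IsNoisePath P σ (ξ n) (B n) (w n))
    (h : iIndepFun (fun n ω => (ξ n ω, fun t : ℝ≥0 => B n t ω)) P) : iIndepFun w P := by
  refine iIndepFun_path (iIndepFun.congr (fun n => ?_)
    (h.comp (fun _ z (t : Set.Icc 0 T) => z.1 + √(2 * σ) • z.2 (t : ℝ).toNNReal)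
      fun _ => measurable_noise_map))
  filter_upwards [(hw n).ae_eq] with ω hω
  ext1 t
  exact (hω t).symm

end Brownian

/-! ### Controls and costs along continuous curves -/

namespace Controls

variable {d ℓ m : ℕ} {T : ℝ} {U : Set (Mat d ℓ)} {M : ℝ} {L : ℝ≥0} (c : Controls m T U M L)

theorem measurable_h : Measurable c.h :=
  measurable_pi_lambda _ fun i => (Lp.stronglyMeasurable (c i).1.toLp).measurable

theorem ae_h_mem : ∀ᵐ t ∂(volume : Measure ℝ).restrict (Set.Icc 0 T), ∀ i, c.h t i ∈ U :=
  ae_all_iff.2 fun i => (c i).1.mem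

theorem ae_norm_h_le {R : ℝ} (hR : ∀ a ∈ U, ‖a‖ ≤ R) :
    ∀ᵐ t ∂(volume : Measure ℝ).restrict (Set.Icc 0 T), ∀ i, ‖c.h t i‖ ≤ R :=
  c.ae_h_mem.mono fun _ ht i => hR _ (ht i)

theorem norm_g_le (μ : W1 d) (i : Fin m) : ‖c.g μ i‖ ≤ M := (c i).2.2.1 μ

theorem norm_g_sub_le (μ ν : W1 d) (i : Fin m) : ‖c.g μ i - c.g ν i‖ ≤ L * dist μ ν := by
  rw [← dist_eq_norm]; exact (c i).2.2.2.dist_le_mul μ ν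

theorem continuous_g : Continuous c.g :=
  continuous_pi fun i => (c i).2.1.continuous

theorem aestronglyMeasurable_u {μ : ℝ → W1 d} (hμ : ContinuousOn μ (Set.Icc 0 T)) :
    AEStronglyMeasurable (fun s => c.u s (μ s)) (volume.restrict (Set.Icc 0 T)) := by
  have hg : AEStronglyMeasurable (fun s => c.g (μ s)) (volume.restrict (Set.Icc 0 T)) :=
    (c.continuous_g.comp_continuousOn hμ).aestronglyMeasurable measurableSet_Icc
  have hh : AEStronglyMeasurable c.h (volume.restrict (Set.Icc 0 T)) :=
    c.measurable_h.aestronglyMeasurable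
  have hcont : Continuous fun (z : (Fin m → Mat d ℓ) × (Fin m → Euc ℓ)) i => z.1 i (z.2 i) := by
    fun_prop
  exact hcont.comp_aestronglyMeasurable (hh.prodMk hg)

theorem norm_u_sub_le {R : ℝ} (hR0 : 0 ≤ R) {t : ℝ} (ht : ∀ i, ‖c.h t i‖ ≤ R) (μ ν : W1 d)
    (i : Fin m) : ‖c.u t μ i - c.u t ν i‖ ≤ R * L * dist μ ν := by
  rw [u, u, ← map_sub, mul_assoc]
  refine ((c.h t i).le_opNorm _).trans ?_
  exact mul_le_mul (ht i) (c.norm_g_sub_le μ ν i) (norm_nonneg _) hR0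

theorem norm_u_le {R : ℝ} (hR0 : 0 ≤ R) {t : ℝ} (ht : ∀ i, ‖c.h t i‖ ≤ R) (μ : W1 d)
    (i : Fin m) : ‖c.u t μ i‖ ≤ R * M := by
  refine ((c.h t i).le_opNorm _).trans ?_
  exact mul_le_mul (ht i) (c.norm_g_le μ i) (norm_nonneg _) hR0

end Controls

section Costs

variable {d ℓ m : ℕ} {T : ℝ} {U : Set (Mat d ℓ)} {M : ℝ} {L : ℝ≥0}
  {𝓛 : ℝ → (Fin m → Euc d) → W1 d → ℝ} {Ψ : (Fin m → Mat d ℓ) → (Fin m → Euc ℓ) → ℝ}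

theorem continuousOn_runningCost
    (h𝓛 : UniformContinuousOn (fun z : ℝ × (Fin m → Euc d) × W1 d => 𝓛 z.1 z.2.1 z.2.2)
      (Set.Icc 0 T ×ˢ Set.univ))
    {y : ℝ → Fin m → Euc d} (hy : ContinuousOn y (Set.Icc 0 T))
    {μ : ℝ → W1 d} (hμ : ContinuousOn μ (Set.Icc 0 T)) :
    ContinuousOn (fun t => 𝓛 t (y t) (μ t)) (Set.Icc 0 T) :=
  h𝓛.continuousOn.comp (f := fun t => (t, y t, μ t)) (continuousOn_id.prodMk (hy.prodMk hμ))
    fun _ ht => ⟨ht, trivial⟩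

theorem intervalIntegrable_runningCost (hT : 0 ≤ T)
    (h𝓛 : UniformContinuousOn (fun z : ℝ × (Fin m → Euc d) × W1 d => 𝓛 z.1 z.2.1 z.2.2)
      (Set.Icc 0 T ×ˢ Set.univ))
    {y : ℝ → Fin m → Euc d} (hy : ContinuousOn y (Set.Icc 0 T))
    {μ : ℝ → W1 d} (hμ : ContinuousOn μ (Set.Icc 0 T)) :
    IntervalIntegrable (fun t => 𝓛 t (y t) (μ t)) volume 0 T := by
  refine ContinuousOn.intervalIntegrable ?_
  rw [Set.uIcc_of_le hT]
  exact continuousOn_runningCost h𝓛 hy hμ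

theorem abs_integral_runningCost_sub_le (hT : 0 < T)
    (h𝓛 : UniformContinuousOn (fun z : ℝ × (Fin m → Euc d) × W1 d => 𝓛 z.1 z.2.1 z.2.2)
      (Set.Icc 0 T ×ˢ Set.univ)) {ε : ℝ} (hε : 0 < ε) :
    ∃ A : ℝ, 0 ≤ A ∧ ∀ (y y' : ℝ → Fin m → Euc d) (μ μ' : ℝ → W1 d),
      ContinuousOn y (Set.Icc 0 T) → ContinuousOn y' (Set.Icc 0 T) →
      ContinuousOn μ (Set.Icc 0 T) → ContinuousOn μ' (Set.Icc 0 T) → ∀ r : ℝ,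
      (∀ t ∈ Set.Icc 0 T, ‖y t - y' t‖ + dist (μ t) (μ' t) ≤ r) →
      |(∫ t in (0 : ℝ)..T, 𝓛 t (y t) (μ t)) - ∫ t in (0 : ℝ)..T, 𝓛 t (y' t) (μ' t)| ≤
        ε + A * r := by
  set η : ℝ := ε / (2 * T) with hη
  have hη0 : 0 < η := by positivity
  obtain ⟨δ, hδ, h⟩ := Metric.uniformContinuousOn_iff.1 h𝓛 η hη0
  refine ⟨η / δ * T, by positivity, fun y y' μ μ' hy hy' hμ hμ' r hr => ?_⟩
  rw [← intervalIntegral.integral_sub (intervalIntegrable_runningCost hT.le h𝓛 hy hμ)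
    (intervalIntegrable_runningCost hT.le h𝓛 hy' hμ'), ← Real.norm_eq_abs]
  refine (intervalIntegral.norm_integral_le_of_norm_le_const (C := 2 * η + η / δ * r)
    fun t ht => ?_).trans_eq ?_
  · rw [Set.uIoc_of_le hT.le] at ht
    have ht' : t ∈ Set.Icc 0 T := Set.Ioc_subset_Icc_self ht
    have := W1.abs_sub_le_of_uniform (G := 𝓛 t) hδ hη0.le (fun y y' μ μ' h1 h2 => by
      have := h (t, y, μ) ⟨ht', trivial⟩ (t, y', μ') ⟨ht', trivial⟩ (by
        rw [← dist_eq_norm] at h1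
        simp [Prod.dist_eq, h1, h2])
      exact this.le) (y t) (y' t) (μ t) (μ' t)
    rw [Real.norm_eq_abs]
    refine this.trans ?_
    have := hr t ht'
    gcongr
  · rw [sub_zero, abs_of_pos hT, hη]
    field_simp

theorem isCompact_controlValues (hU : IsCompact U) (M : ℝ) :
    IsCompact ({a : Fin m → Mat d ℓ | ∀ i, a i ∈ U} ×ˢ {b : Fin m → Euc ℓ | ∀ i, ‖b i‖ ≤ M}) := by
  have h1 : IsCompact {a : Fin m → Mat d ℓ | ∀ i, a i ∈ U} := by
    simpa [Set.pi] using isCompact_univ_pi (fun _ : Fin m => hU)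
  have h2 : IsCompact {b : Fin m → Euc ℓ | ∀ i, ‖b i‖ ≤ M} := by
    simpa [Set.pi] using isCompact_univ_pi
      (fun _ : Fin m => isCompact_closedBall (0 : Euc ℓ) M)
  exact h1.prod h2

theorem intervalIntegrable_controlCost (hT : 0 ≤ T) (hU : IsCompact U)
    (hΨ : Continuous fun z : (Fin m → Mat d ℓ) × (Fin m → Euc ℓ) => Ψ z.1 z.2)
    (c : Controls m T U M L) {b : ℝ → Fin m → Euc ℓ} (hb : ContinuousOn b (Set.Icc 0 T))
    (hbM : ∀ t ∈ Set.Icc 0 T, ∀ i, ‖b t i‖ ≤ M) :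
    IntervalIntegrable (fun t => Ψ (c.h t) (b t)) volume 0 T := by
  obtain ⟨Q, hQ⟩ := (isCompact_controlValues (m := m) hU M).exists_bound_of_continuousOn
    hΨ.continuousOn
  rw [intervalIntegrable_iff_integrableOn_Icc_of_le hT]
  refine (integrable_const Q).mono' (hΨ.comp_aestronglyMeasurable
    (c.measurable_h.aestronglyMeasurable.prodMk (hb.aestronglyMeasurable measurableSet_Icc))) ?_
  filter_upwards [c.ae_h_mem, self_mem_ae_restrict measurableSet_Icc] with t ht ht'
  exact hQ (c.h t, b t) ⟨ht, hbM t ht'⟩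

theorem abs_integral_controlCost_sub_le (hT : 0 < T) (hU : IsCompact U)
    (hΨ : Continuous fun z : (Fin m → Mat d ℓ) × (Fin m → Euc ℓ) => Ψ z.1 z.2) (M : ℝ) (L : ℝ≥0)
    {ε : ℝ} (hε : 0 < ε) :
    ∃ A : ℝ, 0 ≤ A ∧ ∀ (c : Controls m T U M L) (b b' : ℝ → Fin m → Euc ℓ),
      ContinuousOn b (Set.Icc 0 T) → ContinuousOn b' (Set.Icc 0 T) →
      (∀ t ∈ Set.Icc 0 T, ∀ i, ‖b t i‖ ≤ M) → (∀ t ∈ Set.Icc 0 T, ∀ i, ‖b' t i‖ ≤ M) → ∀ r : ℝ,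
      (∀ t ∈ Set.Icc 0 T, ‖b t - b' t‖ ≤ r) →
      |(∫ t in (0 : ℝ)..T, Ψ (c.h t) (b t)) - ∫ t in (0 : ℝ)..T, Ψ (c.h t) (b' t)| ≤
        ε + A * r := by
  have hK := isCompact_controlValues (m := m) hU M
  obtain ⟨Q, hQ⟩ := hK.exists_bound_of_continuousOn hΨ.continuousOn
  set η : ℝ := ε / T with hη
  have hη0 : 0 < η := by positivity
  obtain ⟨δ, hδ, h⟩ := Metric.uniformContinuousOn_iff.1
    (hK.uniformContinuousOn_of_continuous hΨ.continuousOn) η hη0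
  refine ⟨2 * |Q| / δ * T, by positivity, fun c b b' hb hb' hbM hbM' r hr => ?_⟩
  rw [← intervalIntegral.integral_sub (intervalIntegrable_controlCost hT.le hU hΨ c hb hbM)
    (intervalIntegrable_controlCost hT.le hU hΨ c hb' hbM'), ← Real.norm_eq_abs]
  refine (intervalIntegral.norm_integral_le_of_norm_le hT.le
    (g := fun _ => η + 2 * |Q| / δ * r) ?_ (by simp)).trans_eq ?_
  · have h1 := ae_restrict_uIoc_of_ae (t := T) ⟨hT.le, le_rfl⟩ c.ae_h_mem
    filter_upwards [h1] with t ht ht'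
    have htI : t ∈ Set.Icc 0 T := Set.Ioc_subset_Icc_self ht'
    have m1 : (c.h t, b t) ∈ ({a : Fin m → Mat d ℓ | ∀ i, a i ∈ U} ×ˢ
        {b : Fin m → Euc ℓ | ∀ i, ‖b i‖ ≤ M}) := ⟨ht ht', hbM t htI⟩
    have m2 : (c.h t, b' t) ∈ ({a : Fin m → Mat d ℓ | ∀ i, a i ∈ U} ×ˢ
        {b : Fin m → Euc ℓ | ∀ i, ‖b i‖ ≤ M}) := ⟨ht ht', hbM' t htI⟩
    have hrt := hr t htI
    have hr0 : 0 ≤ r := (norm_nonneg _).trans hrt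
    rcases lt_or_ge ‖b t - b' t‖ δ with hlt | hge
    · have h2 := h _ m1 _ m2 (by
        rw [← dist_eq_norm] at hlt
        simp [Prod.dist_eq, hlt])
      rw [dist_eq_norm] at h2
      have : 0 ≤ 2 * |Q| / δ * r := by positivity
      linarith
    · have h2 := (norm_sub_le (Ψ (c.h t) (b t)) (Ψ (c.h t) (b' t))).trans
        (add_le_add (hQ _ m1) (hQ _ m2))
      have h3 : 1 ≤ r / δ := (one_le_div hδ).2 (hge.trans hrt)
      have h4 : 2 * |Q| ≤ 2 * |Q| / δ * r := by
        rw [div_mul_eq_mul_div, mul_div_assoc]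
        exact le_mul_of_one_le_right (by positivity) h3
      have := le_abs_self Q
      linarith
  · rw [intervalIntegral.integral_const, sub_zero, smul_eq_mul, hη]
    field_simp

theorem pathCostConverges_of_continuousOn (hT : 0 ≤ T) (hU : IsCompact U)
    (h𝓛 : UniformContinuousOn (fun z : ℝ × (Fin m → Euc d) × W1 d => 𝓛 z.1 z.2.1 z.2.2)
      (Set.Icc 0 T ×ˢ Set.univ))
    (hΨ : Continuous fun z : (Fin m → Mat d ℓ) × (Fin m → Euc ℓ) => Ψ z.1 z.2)
    (c : Controls m T U M L) {y : ℝ → Fin m → Euc d} (hy : ContinuousOn y (Set.Icc 0 T))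
    {μ : ℝ → W1 d} (hμ : ContinuousOn μ (Set.Icc 0 T)) : PathCostConverges 𝓛 Ψ c y μ :=
  ⟨intervalIntegrable_runningCost hT h𝓛 hy hμ,
    intervalIntegrable_controlCost hT hU hΨ c (c.continuous_g.comp_continuousOn hμ)
      fun _ _ => c.norm_g_le _⟩

theorem abs_pathCost_sub_le (hT : 0 < T) (hU : IsCompact U)
    (h𝓛 : UniformContinuousOn (fun z : ℝ × (Fin m → Euc d) × W1 d => 𝓛 z.1 z.2.1 z.2.2)
      (Set.Icc 0 T ×ˢ Set.univ))
    (hΨ : Continuous fun z : (Fin m → Mat d ℓ) × (Fin m → Euc ℓ) => Ψ z.1 z.2) (M : ℝ) (L : ℝ≥0)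
    {ε : ℝ} (hε : 0 < ε) :
    ∃ A : ℝ, 0 ≤ A ∧ ∀ (c c' : Controls m T U M L) (y y' : ℝ → Fin m → Euc d) (μ μ' : ℝ → W1 d),
      ContinuousOn y (Set.Icc 0 T) → ContinuousOn y' (Set.Icc 0 T) →
      ContinuousOn μ (Set.Icc 0 T) → ContinuousOn μ' (Set.Icc 0 T) → ∀ r : ℝ,
      (∀ t ∈ Set.Icc 0 T, ‖y t - y' t‖ + dist (μ t) (μ' t) ≤ r) →
      (∀ ν i, ‖c.g ν i - c'.g ν i‖ ≤ r) →
      |pathCost 𝓛 Ψ c y μ - ((∫ t in (0 : ℝ)..T, 𝓛 t (y' t) (μ' t)) +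
        ∫ t in (0 : ℝ)..T, Ψ (c.h t) (c'.g (μ' t)))| ≤ ε + A * r := by
  obtain ⟨A₁, hA₁, h₁⟩ := abs_integral_runningCost_sub_le hT h𝓛 (half_pos hε)
  obtain ⟨A₂, hA₂, h₂⟩ := abs_integral_controlCost_sub_le hT hU hΨ M L (half_pos hε)
  refine ⟨A₁ + A₂ * (L + 1), by positivity, fun c c' y y' μ μ' hy hy' hμ hμ' r hr hg => ?_⟩
  have hr0 : 0 ≤ r := (by positivity : (0 : ℝ) ≤ ‖y 0 - y' 0‖ + dist (μ 0) (μ' 0)).trans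
    (hr 0 ⟨le_rfl, hT.le⟩)
  have e₁ := h₁ y y' μ μ' hy hy' hμ hμ' r hr
  have e₂ := h₂ c (fun t => c.g (μ t)) (fun t => c'.g (μ' t)) (c.continuous_g.comp_continuousOn hμ)
    (c'.continuous_g.comp_continuousOn hμ') (fun _ _ => c.norm_g_le _) (fun _ _ => c'.norm_g_le _)
    ((L + 1) * r) (fun t ht => by
      rw [pi_norm_le_iff_of_nonneg (by positivity)]
      intro i
      have h3 := c.norm_g_sub_le (μ t) (μ' t) i
      have h4 := hg (μ' t) i
      have h5 : (L : ℝ) * dist (μ t) (μ' t) ≤ L * r :=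
        mul_le_mul_of_nonneg_left (by linarith [hr t ht, norm_nonneg (y t - y' t)]) L.coe_nonneg
      have h6 := norm_sub_le_norm_sub_add_norm_sub (c.g (μ t) i) (c.g (μ' t) i) (c'.g (μ' t) i)
      simp only [Pi.sub_apply]
      linarith)
  rw [pathCost, add_sub_add_comm]
  refine (abs_add_le _ _).trans ((add_le_add e₁ e₂).trans_eq ?_)
  ring

end Costs

/-! ### The particle system -/

/-- The states of the system of `N` followers and `m` leaders. -/
abbrev ParticleState (d m N : ℕ) : Type := (Fin N → Euc d) × (Fin m → Euc d)

section ParticleField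

variable {d ℓ m : ℕ} {T : ℝ} {U : Set (Mat d ℓ)} {M : ℝ} {L : ℝ≥0} {N : ℕ}

theorem fst_integral_apply {b : ℝ → ParticleState d m N} {t : ℝ}
    (hb : IntervalIntegrable b volume 0 t) (n : Fin N) :
    (∫ s in (0 : ℝ)..t, b s).1 n = ∫ s in (0 : ℝ)..t, (b s).1 n :=
  ((((ContinuousLinearMap.proj n).comp
    (ContinuousLinearMap.fst ℝ (Fin N → Euc d) (Fin m → Euc d))) :
    ParticleState d m N →L[ℝ] Euc d).intervalIntegral_comp_comm hb).symm

theorem snd_integral_apply {b : ℝ → ParticleState d m N} {t : ℝ}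
    (hb : IntervalIntegrable b volume 0 t) (i : Fin m) :
    (∫ s in (0 : ℝ)..t, b s).2 i = ∫ s in (0 : ℝ)..t, (b s).2 i :=
  ((((ContinuousLinearMap.proj i).comp
    (ContinuousLinearMap.snd ℝ (Fin N → Euc d) (Fin m → Euc d))) :
    ParticleState d m N →L[ℝ] Euc d).intervalIntegral_comp_comm hb).symm

theorem intervalIntegrable_fst_apply {b : ℝ → ParticleState d m N} {t : ℝ}
    (hb : IntervalIntegrable b volume 0 t) (n : Fin N) :
    IntervalIntegrable (fun s => (b s).1 n) volume 0 t :=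
  ⟨ContinuousLinearMap.integrable_comp ((ContinuousLinearMap.proj n).comp
    (ContinuousLinearMap.fst ℝ (Fin N → Euc d) (Fin m → Euc d)) : ParticleState d m N →L[ℝ] Euc d)
    hb.1, ContinuousLinearMap.integrable_comp ((ContinuousLinearMap.proj n).comp
    (ContinuousLinearMap.fst ℝ (Fin N → Euc d) (Fin m → Euc d)) : ParticleState d m N →L[ℝ] Euc d)
    hb.2⟩

theorem intervalIntegrable_snd_apply {b : ℝ → ParticleState d m N} {t : ℝ}
    (hb : IntervalIntegrable b volume 0 t) (i : Fin m) :
    IntervalIntegrable (fun s => (b s).2 i) volume 0 t :=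
  ⟨ContinuousLinearMap.integrable_comp ((ContinuousLinearMap.proj i).comp
    (ContinuousLinearMap.snd ℝ (Fin N → Euc d) (Fin m → Euc d)) : ParticleState d m N →L[ℝ] Euc d)
    hb.1, ContinuousLinearMap.integrable_comp ((ContinuousLinearMap.proj i).comp
    (ContinuousLinearMap.snd ℝ (Fin N → Euc d) (Fin m → Euc d)) : ParticleState d m N →L[ℝ] Euc d)
    hb.2⟩

/-- The forcing term of the particle system. -/
def particleNoise (Y₀ : Fin m → Euc d) (v : Fin N → C(Set.Icc 0 T, Euc d)) :
    C(Set.Icc 0 T, ParticleState d m N) where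
  toFun t := (fun n => v n t, Y₀)

theorem norm_particleNoise_le (Y₀ : Fin m → Euc d) (v : Fin N → C(Set.Icc 0 T, Euc d)) :
    ‖particleNoise Y₀ v‖ ≤ ∑ n, ‖v n‖ + ‖Y₀‖ := by
  have h0 : 0 ≤ ∑ n, ‖v n‖ := Finset.sum_nonneg fun n _ => norm_nonneg _
  rw [ContinuousMap.norm_le _ (by positivity)]
  intro t
  rw [Prod.norm_def, max_le_iff]
  constructor
  · rw [pi_norm_le_iff_of_nonneg (by positivity)]
    intro n
    refine ((v n).norm_coe_le_norm t).trans ?_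
    have := Finset.single_le_sum (f := fun n => ‖v n‖) (fun n _ => norm_nonneg _)
      (Finset.mem_univ n)
    have := norm_nonneg Y₀
    linarith
  · change ‖Y₀‖ ≤ _
    linarith

variable [NeZero N]


/-- The velocity field of the particle system, controls excluded. -/
def freeParticleField (k : Kernels d) (z : ParticleState d m N) : ParticleState d m N :=
  (fun n => k.driftX (W1.empirical z.1) z.2 (z.1 n), fun i => k.driftY (W1.empirical z.1) z.2 i)

/-- The velocity field of the particle system. -/
def particleField (k : Kernels d) (c : Controls m T U M L) (s : ℝ) (z : ParticleState d m N) :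
    ParticleState d m N :=
  freeParticleField k z + (0, c.u s (W1.empirical z.1))

theorem norm_freeParticleField_sub_le {k : Kernels d} {C : ℝ≥0} (h1 : LipschitzWith C k.H₁)
    (h2 : LipschitzWith C k.H₂) (h3 : LipschitzWith C k.K₁) (h4 : LipschitzWith C k.K₂)
    (z z' : ParticleState d m N) :
    ‖freeParticleField k z - freeParticleField k z'‖ ≤ 9 * C * ‖z - z'‖ := by
  have hx : ‖z.1 - z'.1‖ ≤ ‖z - z'‖ := norm_fst_le (z - z')
  have hy : ‖z.2 - z'.2‖ ≤ ‖z - z'‖ := norm_snd_le (z - z')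
  have hd := (W1.dist_empirical_le_norm z.1 z'.1).trans hx
  rw [Prod.norm_def, max_le_iff]
  constructor <;> rw [pi_norm_le_iff_of_nonneg (by positivity)]
  · intro n
    have hn : ‖z.1 n - z'.1 n‖ ≤ ‖z - z'‖ := (norm_le_pi_norm (z.1 - z'.1) n).trans hx
    refine (k.norm_driftX_sub_le h1 h3 _ _ z.2 z'.2 (z.1 n) (z'.1 n)).trans ?_
    calc 3 * (C : ℝ) * (‖z.1 n - z'.1 n‖ + ‖z.2 - z'.2‖ +
          dist (W1.empirical z.1) (W1.empirical z'.1))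
        ≤ 3 * C * (‖z - z'‖ + ‖z - z'‖ + ‖z - z'‖) := by gcongr
      _ = 9 * C * ‖z - z'‖ := by ring
  · intro i
    refine (k.norm_driftY_sub_le h2 h4 _ _ z.2 z'.2 i).trans ?_
    have := mul_nonneg C.coe_nonneg (norm_nonneg (z - z'))
    calc 3 * (C : ℝ) * (‖z.2 - z'.2‖ + dist (W1.empirical z.1) (W1.empirical z'.1))
        ≤ 3 * C * (‖z - z'‖ + ‖z - z'‖) := by gcongr
      _ ≤ 9 * C * ‖z - z'‖ := by linarith

theorem isCaratheodoryField_particleField {k : Kernels d} (hk : k.IsLipschitz) (hU : IsCompact U)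
    (hM : 0 < M) (m N : ℕ) [NeZero N] (T : ℝ) (L : ℝ≥0) :
    ∃ C K : ℝ, 0 ≤ C ∧ ∀ c : Controls m T U M L,
      IsCaratheodoryField T C K (particleField (N := N) k c) := by
  obtain ⟨C, h1, h2, h3, h4⟩ := hk
  obtain ⟨R, hR⟩ := hU.isBounded.exists_norm_le
  have hR' : ∀ a ∈ U, ‖a‖ ≤ |R| := fun a ha => (hR a ha).trans (le_abs_self R)
  refine ⟨9 * C + |R| * L, ‖freeParticleField (m := m) (N := N) k 0‖ + |R| * M, by positivity,
    fun c => ⟨fun x hx => ?_, ?_, ?_⟩⟩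
  · have hF : Continuous (freeParticleField (m := m) (N := N) k) :=
      (LipschitzWith.of_dist_le_mul (K := 9 * C) fun z z' => by
        rw [dist_eq_norm, dist_eq_norm]
        exact norm_freeParticleField_sub_le h1 h2 h3 h4 z z').continuous
    refine (hF.comp hx).aestronglyMeasurable.add (aestronglyMeasurable_const.prodMk
      (c.aestronglyMeasurable_u (Continuous.continuousOn ?_)))
    exact W1.continuous_empirical.comp (continuous_fst.comp hx)
  · filter_upwards [c.ae_norm_h_le hR'] with s hs z z'
    rw [particleField, particleField, add_sub_add_comm]
    refine (norm_add_le _ _).trans ?_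
    rw [add_mul]
    refine add_le_add (norm_freeParticleField_sub_le h1 h2 h3 h4 z z') ?_
    rw [Prod.norm_def, max_le_iff]
    constructor
    · simp only [Prod.fst_sub, sub_self, norm_zero]; positivity
    rw [pi_norm_le_iff_of_nonneg (by positivity)]
    intro i
    refine (c.norm_u_sub_le (abs_nonneg R) hs _ _ i).trans ?_
    gcongr
    exact (W1.dist_empirical_le_norm z.1 z'.1).trans (norm_fst_le (z - z'))
  · filter_upwards [c.ae_norm_h_le hR'] with s hs
    rw [particleField]
    refine (norm_add_le _ _).trans (add_le_add le_rfl ?_)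
    rw [Prod.norm_def, max_le_iff]
    constructor
    · simp only [norm_zero]; positivity
    rw [pi_norm_le_iff_of_nonneg (by positivity)]
    exact fun i => c.norm_u_le (abs_nonneg R) hs _ i

/-- The systems of integral equations of the particles, for one realization of the noise. -/
theorem particleSystem_iff {k : Kernels d} {c : Controls m T U M L} {C K σ : ℝ} (hT : 0 ≤ T)
    (hf : IsCaratheodoryField T C K (particleField (N := N) k c)) {Y₀ : Fin m → Euc d}
    {v : Fin N → C(Set.Icc 0 T, Euc d)} {ξ : Fin N → Euc d} {B : Fin N → ℝ≥0 → Euc d}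
    (hv : ∀ n (t : Set.Icc 0 T), v n t = ξ n + √(2 * σ) • B n (t : ℝ).toNNReal)
    {x : Fin N → ℝ → Euc d} {y : Fin m → ℝ → Euc d} (hx : ∀ n, ContinuousOn (x n) (Set.Icc 0 T))
    (hy : ∀ i, ContinuousOn (y i) (Set.Icc 0 T)) :
    ((∀ n, SolvesIntegralEq T (ξ n)
        (fun s => k.particleDriftX (fun l => x l s) (fun j => y j s) n)
        (fun t => √(2 * σ) • B n t.toNNReal) (x n)) ∧
      ∀ i, SolvesIntegralEq T (Y₀ i)
        (fun s => k.particleDriftY (fun l => x l s) (fun j => y j s) i +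
          c.u s (W1.empirical fun l => x l s) i) 0 (y i)) ↔
    ∀ t ∈ Set.Icc 0 T, ((fun n => x n t, fun i => y i t) : ParticleState d m N) =
      extendPath hT (particleNoise Y₀ v) t +
        ∫ s in (0 : ℝ)..t, particleField k c s (fun n => x n s, fun i => y i s) := by
  have hz : ContinuousOn (fun t => ((fun n => x n t, fun i => y i t) : ParticleState d m N))
      (Set.Icc 0 T) := (continuousOn_pi.2 hx).prodMk (continuousOn_pi.2 hy)
  have hi := hf.intervalIntegrable hT hz
  have e1 : ∀ n s, (particleField k c s ((fun n => x n s, fun i => y i s) :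
      ParticleState d m N)).1 n = k.particleDriftX (fun l => x l s) (fun j => y j s) n := by
    intro n s
    rw [Kernels.particleDriftX_eq]
    simp [particleField, freeParticleField]
  have e2 : ∀ i s, (particleField k c s ((fun n => x n s, fun i => y i s) :
      ParticleState d m N)).2 i = k.particleDriftY (fun l => x l s) (fun j => y j s) i +
          c.u s (W1.empirical fun l => x l s) i := by
    intro i s
    rw [Kernels.particleDriftY_eq]
    simp [particleField, freeParticleField]
  constructor
  · rintro ⟨h1, h2⟩ t ht
    have hit := intervalIntegrable_zero_of_mem hi ht
    rw [extendPath_of_mem hT _ ht]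
    refine Prod.ext (funext fun n => ?_) (funext fun i => ?_)
    · rw [Prod.fst_add, Pi.add_apply, fst_integral_apply hit]
      refine ((h1 n).2 t ht).trans ?_
      simp only [particleNoise, ContinuousMap.coe_mk, hv, e1]
      abel
    · rw [Prod.snd_add, Pi.add_apply, snd_integral_apply hit]
      refine ((h2 i).2 t ht).trans ?_
      simp only [particleNoise, ContinuousMap.coe_mk, e2, Pi.zero_apply, add_zero]
  · intro h
    refine ⟨fun n => ⟨?_, fun t ht => ?_⟩, fun i => ⟨?_, fun t ht => ?_⟩⟩
    · simpa only [e1] using intervalIntegrable_fst_apply hi n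
    · have hit := intervalIntegrable_zero_of_mem hi ht
      have h3 := congr_fun (congr_arg Prod.fst (h t ht)) n
      rw [Prod.fst_add, Pi.add_apply, fst_integral_apply hit, extendPath_of_mem hT _ ht] at h3
      simp only [particleNoise, ContinuousMap.coe_mk, hv, e1] at h3
      rw [h3]
      abel
    · simpa only [e2] using intervalIntegrable_snd_apply hi i
    · have hit := intervalIntegrable_zero_of_mem hi ht
      have h3 := congr_fun (congr_arg Prod.snd (h t ht)) i
      rw [Prod.snd_add, Pi.add_apply, snd_integral_apply hit, extendPath_of_mem hT _ ht] at h3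
      simp only [particleNoise, ContinuousMap.coe_mk, e2] at h3
      rw [h3]
      simp

end ParticleField

section ParticleSystem

variable {Ω : Type*} [MeasurableSpace Ω] {P : Measure Ω} {d ℓ m : ℕ} {T σ : ℝ}
  {U : Set (Mat d ℓ)} {M : ℝ} {L : ℝ≥0} {N : ℕ} [NeZero N] {k : Kernels d}
  {c : Controls m T U M L} {C K : ℝ} {Y₀ : Fin m → Euc d} {ξ : Fin N → Ω → Euc d}
  {B : Fin N → ℝ≥0 → Ω → Euc d} {w : Fin N → Ω → C(Set.Icc 0 T, Euc d)}

theorem measurable_particleNoise (Y₀ : Fin m → Euc d) (hw : ∀ n, Measurable (w n)) :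
    Measurable fun ω => particleNoise Y₀ fun n => w n ω :=
  measurable_path fun t => (measurable_pi_lambda _ fun n =>
    (measurable_path_eval t).comp (hw n)).prodMk measurable_const

theorem isParticleSolution_solution (hT : 0 ≤ T) (hC : 0 ≤ C)
    (hf : IsCaratheodoryField T C K (particleField (N := N) k c))
    (hw : ∀ n, IsNoisePath P σ (ξ n) (B n) (w n)) (Y₀ : Fin m → Euc d) :
    IsParticleSolution P k σ Y₀ c ξ B
      (fun n t ω => (extendPath hT (hf.solution hT hC (particleNoise Y₀ fun n => w n ω)) t).1 n)
      (fun i t ω => (extendPath hT (hf.solution hT hC (particleNoise Y₀ fun n => w n ω)) t).2 i) := by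
  have hm : ∀ t, Measurable fun ω =>
      extendPath hT (hf.solution hT hC (particleNoise Y₀ fun n => w n ω)) t := fun t =>
    (measurable_path_eval _).comp ((hf.continuous_solution hT hC).measurable.comp
      (measurable_particleNoise Y₀ fun n => (hw n).measurable))
  have hcont : ∀ ω, Continuous
      (extendPath hT (hf.solution hT hC (particleNoise Y₀ fun n => w n ω))) := fun ω =>
    continuous_extendPath hT _
  have hc1 : ∀ ω n, Continuous fun t =>
      (extendPath hT (hf.solution hT hC (particleNoise Y₀ fun n => w n ω)) t).1 n := fun ω n =>
    (continuous_apply n).comp (continuous_fst.comp (hcont ω))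
  have hc2 : ∀ ω i, Continuous fun t =>
      (extendPath hT (hf.solution hT hC (particleNoise Y₀ fun n => w n ω)) t).2 i := fun ω i =>
    (continuous_apply i).comp (continuous_snd.comp (hcont ω))
  have key := (ae_all_iff.2 fun n => (hw n).ae_eq).mono fun ω hω =>
    (particleSystem_iff (Y₀ := Y₀) hT hf (ξ := fun n => ξ n ω) (B := fun n t => B n t ω) hω
      (fun n => (hc1 ω n).continuousOn) (fun i => (hc2 ω i).continuousOn)).2
      fun t ht => hf.solution_eq hT hC _ ht
  exact
    { measurable_X := fun n t _ => (measurable_pi_apply n).comp (measurable_fst.comp (hm t))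
      continuous_X := fun n ω => (hc1 ω n).continuousOn
      measurable_Y := fun i t _ => (measurable_pi_apply i).comp (measurable_snd.comp (hm t))
      continuous_Y := fun i ω => (hc2 ω i).continuousOn
      eq_X := key.mono fun ω h => h.1
      eq_Y := key.mono fun ω h => h.2 }

theorem IsParticleSolution.ae_eq_solution {X : Fin N → ℝ → Ω → Euc d} {Y : Fin m → ℝ → Ω → Euc d}
    (h : IsParticleSolution P k σ Y₀ c ξ B X Y) (hT : 0 ≤ T) (hC : 0 ≤ C)
    (hf : IsCaratheodoryField T C K (particleField (N := N) k c))
    (hw : ∀ n, IsNoisePath P σ (ξ n) (B n) (w n)) :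
    ∀ᵐ ω ∂P, ∀ t ∈ Set.Icc 0 T, ((fun n => X n t ω, fun i => Y i t ω) : ParticleState d m N) =
      extendPath hT (hf.solution hT hC (particleNoise Y₀ fun n => w n ω)) t := by
  filter_upwards [h.eq_X, h.eq_Y, ae_all_iff.2 fun n => (hw n).ae_eq] with ω h1 h2 hω
  have := (particleSystem_iff hT hf (ξ := fun n => ξ n ω) (B := fun n t => B n t ω) hω
    (fun n => h.continuous_X n ω) (fun i => h.continuous_Y i ω)).1 ⟨h1, h2⟩
  exact hf.eq_solution hT hC _ ((continuousOn_pi.2 fun n => h.continuous_X n ω).prodMk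
    (continuousOn_pi.2 fun i => h.continuous_Y i ω)) this

variable {𝓛 : ℝ → (Fin m → Euc d) → W1 d → ℝ} {Ψ : (Fin m → Mat d ℓ) → (Fin m → Euc ℓ) → ℝ}

/-- The cost of a path of the particle system. -/
def statePathCost (𝓛 : ℝ → (Fin m → Euc d) → W1 d → ℝ)
    (Ψ : (Fin m → Mat d ℓ) → (Fin m → Euc ℓ) → ℝ) (c : Controls m T U M L) (hT : 0 ≤ T)
    (z : C(Set.Icc 0 T, ParticleState d m N)) : ℝ :=
  pathCost 𝓛 Ψ c (fun t => (extendPath hT z t).2) fun t => W1.empirical (extendPath hT z t).1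

theorem pathCost_congr {y y' : ℝ → Fin m → Euc d} {μ μ' : ℝ → W1 d} (hT : 0 ≤ T)
    (hy : ∀ t ∈ Set.Icc 0 T, y t = y' t) (hμ : ∀ t ∈ Set.Icc 0 T, μ t = μ' t) :
    pathCost 𝓛 Ψ c y μ = pathCost 𝓛 Ψ c y' μ' := by
  rw [pathCost, pathCost]
  congr 1 <;> refine intervalIntegral.integral_congr fun t ht => ?_ <;>
    rw [Set.uIcc_of_le hT] at ht <;> simp only [hy t ht, hμ t ht]

theorem abs_statePathCost_sub_le (hT : 0 < T) (hU : IsCompact U)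
    (h𝓛 : UniformContinuousOn (fun z : ℝ × (Fin m → Euc d) × W1 d => 𝓛 z.1 z.2.1 z.2.2)
      (Set.Icc 0 T ×ˢ Set.univ))
    (hΨ : Continuous fun z : (Fin m → Mat d ℓ) × (Fin m → Euc ℓ) => Ψ z.1 z.2)
    (c : Controls m T U M L) {ε : ℝ} (hε : 0 < ε) :
    ∃ A : ℝ, 0 ≤ A ∧ ∀ z z' : C(Set.Icc 0 T, ParticleState d m N),
      |statePathCost 𝓛 Ψ c hT.le z - statePathCost 𝓛 Ψ c hT.le z'| ≤ ε + A * ‖z - z'‖ := by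
  obtain ⟨A, hA, h⟩ := abs_pathCost_sub_le hT hU h𝓛 hΨ M L hε
  refine ⟨A * 2, by positivity, fun z z' => ?_⟩
  have hy : ∀ z : C(Set.Icc 0 T, ParticleState d m N),
      Continuous fun t => (extendPath hT.le z t).2 := fun z =>
    continuous_snd.comp (continuous_extendPath hT.le z)
  have hμ : ∀ z : C(Set.Icc 0 T, ParticleState d m N),
      Continuous fun t => W1.empirical (extendPath hT.le z t).1 := fun z =>
    W1.continuous_empirical.comp (continuous_fst.comp (continuous_extendPath hT.le z))
  rw [mul_assoc]
  refine h c c _ _ _ _ (hy z).continuousOn (hy z').continuousOn (hμ z).continuousOn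
    (hμ z').continuousOn (2 * ‖z - z'‖) (fun t _ => ?_) fun ν i => by simp
  have h1 := norm_extendPath_sub_le hT.le z z' t
  have h2 := (norm_snd_le (extendPath hT.le z t - extendPath hT.le z' t)).trans h1
  have h3 := ((W1.dist_empirical_le_norm (extendPath hT.le z t).1 (extendPath hT.le z' t).1).trans
    (norm_fst_le (extendPath hT.le z t - extendPath hT.le z' t))).trans h1
  rw [Prod.snd_sub] at h2
  linarith

theorem continuous_statePathCost (hT : 0 < T) (hU : IsCompact U)
    (h𝓛 : UniformContinuousOn (fun z : ℝ × (Fin m → Euc d) × W1 d => 𝓛 z.1 z.2.1 z.2.2)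
      (Set.Icc 0 T ×ˢ Set.univ))
    (hΨ : Continuous fun z : (Fin m → Mat d ℓ) × (Fin m → Euc ℓ) => Ψ z.1 z.2)
    (c : Controls m T U M L) : Continuous (statePathCost (N := N) 𝓛 Ψ c hT.le) := by
  rw [Metric.continuous_iff]
  intro z ε hε
  obtain ⟨A, hA, h⟩ := abs_statePathCost_sub_le (N := N) hT hU h𝓛 hΨ c (half_pos hε)
  refine ⟨ε / (2 * (A + 1)), by positivity, fun z' hz' => ?_⟩
  rw [Real.dist_eq]
  refine (h z' z).trans_lt ?_
  rw [dist_eq_norm, lt_div_iff₀ (by positivity)] at hz'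
  nlinarith [norm_nonneg (z' - z)]

variable {X : Fin N → ℝ → Ω → Euc d} {Y : Fin m → ℝ → Ω → Euc d}

theorem IsParticleSolution.pathCostConverges (h : IsParticleSolution P k σ Y₀ c ξ B X Y)
    (hT : 0 ≤ T) (hU : IsCompact U)
    (h𝓛 : UniformContinuousOn (fun z : ℝ × (Fin m → Euc d) × W1 d => 𝓛 z.1 z.2.1 z.2.2)
      (Set.Icc 0 T ×ˢ Set.univ))
    (hΨ : Continuous fun z : (Fin m → Mat d ℓ) × (Fin m → Euc ℓ) => Ψ z.1 z.2) (ω : Ω) :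
    PathCostConverges 𝓛 Ψ c (fun t i => Y i t ω) (fun t => W1.empirical fun n => X n t ω) :=
  pathCostConverges_of_continuousOn hT hU h𝓛 hΨ c
    (continuousOn_pi.2 fun i => h.continuous_Y i ω)
    (W1.continuous_empirical.comp_continuousOn (continuousOn_pi.2 fun n => h.continuous_X n ω))

theorem IsParticleSolution.integrable_cost [IsProbabilityMeasure P]
    (h : IsParticleSolution P k σ Y₀ c ξ B X Y)
    (hT : 0 < T) (hC : 0 ≤ C) (hf : IsCaratheodoryField T C K (particleField (N := N) k c))
    (hw : ∀ n, IsNoisePath P σ (ξ n) (B n) (w n)) (hwi : ∀ n, Integrable (w n) P)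
    (hU : IsCompact U)
    (h𝓛 : UniformContinuousOn (fun z : ℝ × (Fin m → Euc d) × W1 d => 𝓛 z.1 z.2.1 z.2.2)
      (Set.Icc 0 T ×ˢ Set.univ))
    (hΨ : Continuous fun z : (Fin m → Mat d ℓ) × (Fin m → Euc ℓ) => Ψ z.1 z.2) :
    Integrable (particlePathCost 𝓛 Ψ c X Y) P := by
  have hcont := (continuous_statePathCost (N := N) hT hU h𝓛 hΨ c).comp
    (hf.continuous_solution hT.le hC)
  have hmeas := hcont.measurable.comp (measurable_particleNoise Y₀ fun n => (hw n).measurable)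
  have hint : Integrable (fun ω => statePathCost 𝓛 Ψ c hT.le
      (hf.solution hT.le hC (particleNoise Y₀ fun n => w n ω))) P := by
    obtain ⟨A, hA, hbd⟩ := abs_statePathCost_sub_le (N := N) hT hU h𝓛 hΨ c one_pos
    have hsum : Integrable (fun ω => ∑ n, ‖w n ω‖) P :=
      integrable_finsetSum Finset.univ fun n _ => (hwi n).norm
    refine ((integrable_const (|statePathCost 𝓛 Ψ c hT.le (0 : C(Set.Icc 0 T,
      ParticleState d m N))| + 1 + A * ((‖Y₀‖ + |K| * T) * Real.exp (C * T)))).add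
      (hsum.const_mul (A * Real.exp (C * T)))).mono' hmeas.aestronglyMeasurable
      (Eventually.of_forall fun ω => ?_)
    have h1 := hbd (hf.solution hT.le hC (particleNoise Y₀ fun n => w n ω)) 0
    have h2 := hf.norm_solution_le hT.le hC (particleNoise Y₀ fun n => w n ω)
    have h3 := norm_particleNoise_le Y₀ fun n => w n ω
    have h4 : ‖hf.solution hT.le hC (particleNoise Y₀ fun n => w n ω)‖ ≤
        (∑ n, ‖w n ω‖ + ‖Y₀‖ + |K| * T) * Real.exp (C * T) := by
      refine h2.trans ?_
      gcongr
    have h5 := mul_le_mul_of_nonneg_left h4 hA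
    rw [sub_zero] at h1
    have h6 := abs_sub_abs_le_abs_sub (statePathCost 𝓛 Ψ c hT.le
      (hf.solution hT.le hC (particleNoise Y₀ fun n => w n ω)))
      (statePathCost 𝓛 Ψ c hT.le (0 : C(Set.Icc 0 T, ParticleState d m N)))
    simp only [Pi.add_apply, Real.norm_eq_abs]
    linarith
  refine hint.congr ?_
  filter_upwards [h.ae_eq_solution hT.le hC hf hw] with ω hω
  refine pathCost_congr hT.le (fun t ht => ?_) fun t ht => ?_
  · rw [← hω t ht]
  · rw [← hω t ht]

theorem IsParticleSolution.ae_unique (h : IsParticleSolution P k σ Y₀ c ξ B X Y)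
    {X' : Fin N → ℝ → Ω → Euc d} {Y' : Fin m → ℝ → Ω → Euc d}
    (h' : IsParticleSolution P k σ Y₀ c ξ B X' Y') (hT : 0 ≤ T) (hC : 0 ≤ C)
    (hf : IsCaratheodoryField T C K (particleField (N := N) k c))
    (hw : ∀ n, IsNoisePath P σ (ξ n) (B n) (w n)) :
    ∀ᵐ ω ∂P, ∀ t ∈ Set.Icc 0 T, (∀ n, X n t ω = X' n t ω) ∧ ∀ i, Y i t ω = Y' i t ω := by
  filter_upwards [h.ae_eq_solution hT hC hf hw, h'.ae_eq_solution hT hC hf hw] with ω h1 h2 t ht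
  have := (h1 t ht).trans (h2 t ht).symm
  exact ⟨fun n => congr_fun (congr_arg Prod.fst this) n,
    fun i => congr_fun (congr_arg Prod.snd this) i⟩

end ParticleSystem

/-! ### Random paths and their time marginals -/

section RandomPath

variable {Ω : Type*} [MeasurableSpace Ω] {P : Measure Ω} {d : ℕ} {T : ℝ}

theorem integrable_extendPath {E : Type*} [NormedAddCommGroup E] (hT : 0 ≤ T)
    {V : Ω → C(Set.Icc 0 T, E)} (hV : Integrable V P) (t : ℝ) :
    Integrable (fun ω => extendPath hT (V ω) t) P :=
  hV.mono ((continuous_eval_const (Set.projIcc 0 T hT t)).comp_aestronglyMeasurable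
    hV.aestronglyMeasurable) (Eventually.of_forall fun ω => norm_extendPath_le hT (V ω) t)

/-- The expected distance of two random paths at a given time. -/
def meanDist (P : Measure Ω) (hT : 0 ≤ T) (V V' : Ω → C(Set.Icc 0 T, Euc d)) (s : ℝ) : ℝ :=
  ∫ ω, ‖extendPath hT (V ω) s - extendPath hT (V' ω) s‖ ∂P

variable {V V' : Ω → C(Set.Icc 0 T, Euc d)}

theorem integrable_uncurry_norm_sub [SFinite P] (hT : 0 ≤ T) (hV : Integrable V P)
    (hV' : Integrable V' P) (a b : ℝ) :
    Integrable (Function.uncurry fun s ω => ‖extendPath hT (V ω) s - extendPath hT (V' ω) s‖)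
      ((volume.restrict (Set.uIoc a b)).prod P) := by
  have hm : ∀ {V : Ω → C(Set.Icc 0 T, Euc d)}, Integrable V P →
      AEStronglyMeasurable (fun z : ℝ × Ω => extendPath hT (V z.2) z.1)
        ((volume.restrict (Set.uIoc a b)).prod P) := fun {V} hV => by
    have h1 : AEStronglyMeasurable (fun z : ℝ × Ω => Set.projIcc 0 T hT z.1)
        ((volume.restrict (Set.uIoc a b)).prod P) :=
      (continuous_projIcc.measurable.comp measurable_fst).aestronglyMeasurable
    exact (continuous_eval (F := C(Set.Icc 0 T, Euc d))).comp_aestronglyMeasurable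
      ((hV.aestronglyMeasurable.comp_snd).prodMk h1)
  have : IsFiniteMeasure (volume.restrict (Set.uIoc a b)) :=
    isFiniteMeasure_restrict.2 (by simp [Set.uIoc])
  refine ((hV.norm.add hV'.norm).comp_snd (volume.restrict (Set.uIoc a b))).mono'
    ((hm hV).sub (hm hV')).norm (Eventually.of_forall fun z => ?_)
  simp only [Function.uncurry, norm_norm, Pi.add_apply]
  exact (norm_sub_le _ _).trans (add_le_add (norm_extendPath_le hT _ _) (norm_extendPath_le hT _ _))

theorem continuous_norm_extendPath_sub (hT : 0 ≤ T) (x y : C(Set.Icc 0 T, Euc d)) :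
    Continuous fun s => ‖extendPath hT x s - extendPath hT y s‖ :=
  ((continuous_extendPath hT x).sub (continuous_extendPath hT y)).norm

theorem continuous_meanDist (hT : 0 ≤ T) (hV : Integrable V P) (hV' : Integrable V' P) :
    Continuous (meanDist P hT V V') := by
  refine continuous_of_dominated (bound := fun ω => ‖V ω‖ + ‖V' ω‖) (fun s => ?_) (fun s => ?_)
    (hV.norm.add hV'.norm) ?_
  · exact ((integrable_extendPath hT hV s).sub
      (integrable_extendPath hT hV' s)).norm.aestronglyMeasurable
  · refine Eventually.of_forall fun ω => ?_
    rw [norm_norm]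
    exact (norm_sub_le _ _).trans
      (add_le_add (norm_extendPath_le hT _ _) (norm_extendPath_le hT _ _))
  · exact Eventually.of_forall fun ω => continuous_norm_extendPath_sub hT _ _

theorem meanDist_le (hT : 0 ≤ T) (hV : Integrable V P) (hV' : Integrable V' P) (s : ℝ) :
    meanDist P hT V V' s ≤ ∫ ω, ‖V ω - V' ω‖ ∂P :=
  integral_mono ((integrable_extendPath hT hV s).sub (integrable_extendPath hT hV' s)).norm
    (hV.sub hV').norm fun ω => norm_extendPath_sub_le hT (V ω) (V' ω) s

theorem integral_integral_norm_sub [SFinite P] (hT : 0 ≤ T) (hV : Integrable V P)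
    (hV' : Integrable V' P) (t : ℝ) :
    ∫ ω, (∫ s in (0 : ℝ)..t, ‖extendPath hT (V ω) s - extendPath hT (V' ω) s‖) ∂P =
      ∫ s in (0 : ℝ)..t, meanDist P hT V V' s :=
  (intervalIntegral_integral_swap (integrable_uncurry_norm_sub hT hV hV' 0 t)).symm

theorem integrable_integral_norm_sub [SFinite P] (hT : 0 ≤ T) (hV : Integrable V P)
    (hV' : Integrable V' P) {t : ℝ} (ht : 0 ≤ t) : Integrable
      (fun ω => ∫ s in (0 : ℝ)..t, ‖extendPath hT (V ω) s - extendPath hT (V' ω) s‖) P := by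
  simp only [intervalIntegral.integral_of_le ht]
  have := (integrable_uncurry_norm_sub hT hV hV' 0 t).integral_prod_right
  rwa [Set.uIoc_of_le ht] at this

variable [IsProbabilityMeasure P]

/-- The curve of the time marginals of a random path. -/
def marginals (P : Measure Ω) [IsProbabilityMeasure P] (hT : 0 ≤ T)
    (V : Ω → C(Set.Icc 0 T, Euc d)) (hV : Integrable V P) (t : ℝ) : W1 d :=
  W1.law P (fun ω => extendPath hT (V ω) t) (integrable_extendPath hT hV t)

theorem dist_marginals_le (hT : 0 ≤ T) (hV : Integrable V P) (hV' : Integrable V' P) (t : ℝ) :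
    dist (marginals P hT V hV t) (marginals P hT V' hV' t) ≤ meanDist P hT V V' t :=
  W1.dist_law_le _ _

theorem marginals_congr (hT : 0 ≤ T) (hV : Integrable V P) (hV' : Integrable V' P)
    (h : V =ᵐ[P] V') : marginals P hT V hV = marginals P hT V' hV' := by
  ext1 t
  refine W1.ext_val (Measure.map_congr ?_)
  filter_upwards [h] with ω hω
  rw [hω]

theorem continuous_marginals (hT : 0 ≤ T) (hV : Integrable V P) :
    Continuous (marginals P hT V hV) := by
  rw [continuous_iff_continuousAt]
  intro s
  rw [ContinuousAt, tendsto_iff_dist_tendsto_zero]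
  have hc : Continuous fun t => ∫ ω, ‖extendPath hT (V ω) t - extendPath hT (V ω) s‖ ∂P := by
    refine continuous_of_dominated (bound := fun ω => ‖V ω‖ + ‖V ω‖) (fun t => ?_) (fun t => ?_)
      (hV.norm.add hV.norm) ?_
    · exact ((integrable_extendPath hT hV t).sub
        (integrable_extendPath hT hV s)).norm.aestronglyMeasurable
    · refine Eventually.of_forall fun ω => ?_
      rw [norm_norm]
      exact (norm_sub_le _ _).trans
        (add_le_add (norm_extendPath_le hT _ _) (norm_extendPath_le hT _ _))
    · exact Eventually.of_forall fun ω =>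
        ((continuous_extendPath hT (V ω)).sub continuous_const).norm
  have h0 := hc.tendsto s
  simp only [sub_self, norm_zero, integral_zero] at h0
  exact squeeze_zero (fun _ => dist_nonneg) (fun t => W1.dist_law_le _ _) h0

end RandomPath

/-! ### The McKean-Vlasov system -/

section MeanField

theorem Kernels.continuous_driftX {d m : ℕ} {k : Kernels d} (hk : k.IsLipschitz) :
    Continuous fun z : W1 d × (Fin m → Euc d) × Euc d => k.driftX z.1 z.2.1 z.2.2 := by
  obtain ⟨C, h1, h2, h3, h4⟩ := hk
  refine (LipschitzWith.of_dist_le_mul (K := 9 * C) fun z z' => ?_).continuous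
  rw [dist_eq_norm]
  refine (k.norm_driftX_sub_le h1 h3 _ _ _ _ _ _).trans ?_
  have e1 : dist z.1 z'.1 ≤ dist z z' := le_max_left _ _
  have e2 : dist z.2.1 z'.2.1 ≤ dist z z' := (le_max_left _ _).trans (le_max_right _ _)
  have e3 : dist z.2.2 z'.2.2 ≤ dist z z' := (le_max_right _ _).trans (le_max_right _ _)
  rw [dist_eq_norm] at e2 e3
  calc 3 * (C : ℝ) * (‖z.2.2 - z'.2.2‖ + ‖z.2.1 - z'.2.1‖ + dist z.1 z'.1)
      ≤ 3 * C * (dist z z' + dist z z' + dist z z') := by gcongr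
    _ = _ := by push_cast; ring

theorem Kernels.continuous_driftY {d m : ℕ} {k : Kernels d} (hk : k.IsLipschitz) :
    Continuous fun z : W1 d × (Fin m → Euc d) => k.driftY z.1 z.2 := by
  obtain ⟨C, h1, h2, h3, h4⟩ := hk
  refine continuous_pi fun i => (LipschitzWith.of_dist_le_mul (K := 6 * C) fun z z' => ?_).continuous
  rw [dist_eq_norm]
  refine (k.norm_driftY_sub_le h2 h4 _ _ _ _ _).trans ?_
  have e1 : dist z.1 z'.1 ≤ dist z z' := le_max_left _ _
  have e2 : dist z.2 z'.2 ≤ dist z z' := le_max_right _ _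
  rw [dist_eq_norm] at e2
  calc 3 * (C : ℝ) * (‖z.2 - z'.2‖ + dist z.1 z'.1)
      ≤ 3 * C * (dist z z' + dist z z') := by gcongr
    _ = _ := by push_cast; ring

/-- The velocity field of a follower in a given environment. -/
theorem isCaratheodoryField_driftX {d m : ℕ} {k : Kernels d} {C : ℝ≥0}
    (h1 : LipschitzWith C k.H₁) (h2 : LipschitzWith C k.H₂) (h3 : LipschitzWith C k.K₁)
    (h4 : LipschitzWith C k.K₂) {T : ℝ} {μ : ℝ → W1 d} {y : ℝ → Fin m → Euc d}
    (hμ : ContinuousOn μ (Set.Icc 0 T)) (hy : ContinuousOn y (Set.Icc 0 T)) :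
    ∃ K : ℝ, IsCaratheodoryField T (3 * C) K fun s x => k.driftX (μ s) (y s) x := by
  have hc := Kernels.continuous_driftX (m := m) ⟨C, h1, h2, h3, h4⟩
  have hc' : ∀ {x : ℝ → Euc d}, Continuous x →
      ContinuousOn (fun s => k.driftX (μ s) (y s) (x s)) (Set.Icc 0 T) := fun hx =>
    hc.comp_continuousOn (hμ.prodMk (hy.prodMk hx.continuousOn))
  obtain ⟨K, hK⟩ := isCompact_Icc.exists_bound_of_continuousOn
    (hc' (continuous_const : Continuous fun _ : ℝ => (0 : Euc d)))
  refine ⟨K, fun x hx => (hc' hx).aestronglyMeasurable measurableSet_Icc, ?_, ?_⟩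
  · refine Eventually.of_forall fun s x x' => ?_
    simpa using k.norm_driftX_sub_le h1 h3 (μ s) (μ s) (y s) (y s) x x'
  · filter_upwards [self_mem_ae_restrict measurableSet_Icc] with s hs using hK s hs

variable {Ω : Type*} [MeasurableSpace Ω] {P : Measure Ω} [IsProbabilityMeasure P] {d ℓ m : ℕ}
  {T σ : ℝ} {U : Set (Mat d ℓ)} {M : ℝ} {L : ℝ≥0} {k : Kernels d}
  {c : Controls m T U M L} {Y₀ : Fin m → Euc d} {w : Ω → C(Set.Icc 0 T, Euc d)}

/-- The velocity of the leaders in a given environment. -/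
def leaderVelocity (k : Kernels d) (c : Controls m T U M L) (μ : ℝ → W1 d)
    (y : ℝ → Fin m → Euc d) (s : ℝ) : Fin m → Euc d := k.driftY (μ s) (y s) + c.u s (μ s)

theorem intervalIntegrable_leaderVelocity (hT : 0 ≤ T) (hk : k.IsLipschitz) (hU : IsCompact U)
    (hM : 0 < M) (c : Controls m T U M L) {μ : ℝ → W1 d} {y : ℝ → Fin m → Euc d}
    (hμ : ContinuousOn μ (Set.Icc 0 T)) (hy : ContinuousOn y (Set.Icc 0 T)) :
    IntervalIntegrable (leaderVelocity k c μ y) volume 0 T := by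
  obtain ⟨R, hR⟩ := hU.isBounded.exists_norm_le
  have hR' : ∀ a ∈ U, ‖a‖ ≤ |R| := fun a ha => (hR a ha).trans (le_abs_self R)
  refine IntervalIntegrable.add ?_ ?_
  · refine ContinuousOn.intervalIntegrable ?_
    rw [Set.uIcc_of_le hT]
    exact (Kernels.continuous_driftY hk).comp_continuousOn (hμ.prodMk hy)
  · rw [intervalIntegrable_iff_integrableOn_Icc_of_le hT]
    refine (integrable_const (|R| * M)).mono' (c.aestronglyMeasurable_u hμ) ?_
    filter_upwards [c.ae_norm_h_le hR'] with s hs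
    rw [pi_norm_le_iff_of_nonneg (by positivity)]
    exact fun i => c.norm_u_le (abs_nonneg R) hs _ i

theorem norm_integral_leaderVelocity_sub_le (hT : 0 ≤ T) {C : ℝ≥0} (h1 : LipschitzWith C k.H₁)
    (h2 : LipschitzWith C k.H₂) (h3 : LipschitzWith C k.K₁) (h4 : LipschitzWith C k.K₂)
    (hU : IsCompact U) {R : ℝ} (hR0 : 0 ≤ R) (hR : ∀ a ∈ U, ‖a‖ ≤ R)
    (hM : 0 < M) (c : Controls m T U M L) {μ μ' : ℝ → W1 d} {y y' : ℝ → Fin m → Euc d}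
    (hμ : ContinuousOn μ (Set.Icc 0 T)) (hy : ContinuousOn y (Set.Icc 0 T))
    (hμ' : ContinuousOn μ' (Set.Icc 0 T)) (hy' : ContinuousOn y' (Set.Icc 0 T))
    {b : ℝ → ℝ} (hb : IntervalIntegrable b volume 0 T)
    (hμb : ∀ s ∈ Set.Icc 0 T, dist (μ s) (μ' s) ≤ b s)
    (hyb : ∀ s ∈ Set.Icc 0 T, ‖y s - y' s‖ ≤ b s) {t : ℝ} (ht : t ∈ Set.Icc 0 T) :
    ‖(∫ s in (0 : ℝ)..t, leaderVelocity k c μ y s) -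
      ∫ s in (0 : ℝ)..t, leaderVelocity k c μ' y' s‖ ≤
      (6 * C + R * L) * ∫ s in (0 : ℝ)..t, b s := by
  have hk : k.IsLipschitz := ⟨C, h1, h2, h3, h4⟩
  rw [← intervalIntegral.integral_sub
    (intervalIntegrable_zero_of_mem (intervalIntegrable_leaderVelocity hT hk hU hM c hμ hy) ht)
    (intervalIntegrable_zero_of_mem (intervalIntegrable_leaderVelocity hT hk hU hM c hμ' hy') ht),
    ← intervalIntegral.integral_const_mul]
  refine intervalIntegral.norm_integral_le_of_norm_le ht.1 ?_
    ((intervalIntegrable_zero_of_mem hb ht).const_mul _)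
  filter_upwards [ae_restrict_uIoc_of_ae ht (c.ae_norm_h_le hR)] with s hs hs'
  have hsI : s ∈ Set.Icc 0 T := ⟨hs'.1.le, hs'.2.trans ht.2⟩
  have hb0 : 0 ≤ b s := dist_nonneg.trans (hμb s hsI)
  rw [leaderVelocity, leaderVelocity, add_sub_add_comm, pi_norm_le_iff_of_nonneg (by positivity)]
  intro i
  have e1 := k.norm_driftY_sub_le h2 h4 (μ s) (μ' s) (y s) (y' s) i
  have e2 := c.norm_u_sub_le hR0 (hs hs') (μ s) (μ' s) i
  have e3 : 3 * (C : ℝ) * (‖y s - y' s‖ + dist (μ s) (μ' s)) ≤ 3 * C * (b s + b s) := by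
    have := hμb s hsI
    have := hyb s hsI
    gcongr
  have e4 : R * L * dist (μ s) (μ' s) ≤ R * L * b s := by
    have := hμb s hsI
    gcongr
  simp only [Pi.add_apply, Pi.sub_apply]
  refine (norm_add_le _ _).trans ?_
  linarith

/-- `(V, y)` is a solution of the McKean-Vlasov system with forcing `w`, as a random path and a
path. -/
def IsMeanFieldPath (P : Measure Ω) [IsProbabilityMeasure P] (k : Kernels d) (Y₀ : Fin m → Euc d)
    (c : Controls m T U M L) (hT : 0 ≤ T) (w : Ω → C(Set.Icc 0 T, Euc d))
    (V : Ω → C(Set.Icc 0 T, Euc d)) (hV : Integrable V P) (y : C(Set.Icc 0 T, Fin m → Euc d)) :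
    Prop :=
  (∀ᵐ ω ∂P, ∀ t ∈ Set.Icc 0 T, extendPath hT (V ω) t = extendPath hT (w ω) t +
    ∫ s in (0 : ℝ)..t, k.driftX (marginals P hT V hV s) (extendPath hT y s)
      (extendPath hT (V ω) s)) ∧
  ∀ t ∈ Set.Icc 0 T, extendPath hT y t = Y₀ +
    ∫ s in (0 : ℝ)..t, leaderVelocity k c (marginals P hT V hV) (extendPath hT y) s

theorem existsUnique_isMeanFieldPath (hT : 0 ≤ T) (hk : k.IsLipschitz) (hU : IsCompact U)
    (hM : 0 < M) (c : Controls m T U M L) (Y₀ : Fin m → Euc d) (hw : Integrable w P) :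
    ∃! z : Lp C(Set.Icc 0 T, Euc d) 1 P × C(Set.Icc 0 T, Fin m → Euc d),
      IsMeanFieldPath P k Y₀ c hT w z.1 (L1.integrable_coeFn z.1) z.2 := by
  have hk' := hk
  obtain ⟨C, h1, h2, h3, h4⟩ := hk'
  obtain ⟨R, hR⟩ := hU.isBounded.exists_norm_le
  have hR' : ∀ a ∈ U, ‖a‖ ≤ |R| := fun a ha => (hR a ha).trans (le_abs_self R)
  set μ : Lp C(Set.Icc 0 T, Euc d) 1 P → ℝ → W1 d := fun V =>
    marginals P hT V (L1.integrable_coeFn V) with hμ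
  have hμc : ∀ V, Continuous (μ V) := fun V => continuous_marginals hT _
  have hyc : ∀ y : C(Set.Icc 0 T, Fin m → Euc d), Continuous (extendPath hT y) := fun y =>
    continuous_extendPath hT y
  have hVc : ∀ x : C(Set.Icc 0 T, Euc d), Continuous (extendPath hT x) := fun x =>
    continuous_extendPath hT x
  set f : Lp C(Set.Icc 0 T, Euc d) 1 P × C(Set.Icc 0 T, Fin m → Euc d) → ℝ → Euc d → Euc d :=
    fun z s x => k.driftX (μ z.1 s) (extendPath hT z.2 s) x with hf
  have hfield : ∀ z, ∃ K, IsCaratheodoryField T (3 * C) K (f z) := fun z =>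
    isCaratheodoryField_driftX h1 h2 h3 h4 (hμc z.1).continuousOn (hyc z.2).continuousOn
  have hfi : ∀ z (x : C(Set.Icc 0 T, Euc d)),
      IntervalIntegrable (fun s => f z s (extendPath hT x s)) volume 0 T := fun z x =>
    (hfield z).choose_spec.intervalIntegrable hT (hVc x).continuousOn
  set G : Lp C(Set.Icc 0 T, Euc d) 1 P × C(Set.Icc 0 T, Fin m → Euc d) →
    C(Set.Icc 0 T, Euc d) → C(Set.Icc 0 T, Euc d) := fun z x => primitivePath _ (hfi z x) hT with hG
  have hGsub : ∀ z x x', ‖G z x - G z x'‖ ≤ 3 * C * T * ‖x - x'‖ := by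
    intro z x x'
    rw [ContinuousMap.norm_le _ (by positivity)]
    intro t
    refine ((hfield z).choose_spec.norm_integral_sub_le (hVc x).continuousOn
      (hVc x').continuousOn t.2).trans ?_
    have : ∫ s in (0 : ℝ)..t, ‖extendPath hT x s - extendPath hT x' s‖ ≤ T * ‖x - x'‖ := by
      refine (intervalIntegral.integral_mono_on t.2.1
        ((continuous_norm_extendPath_sub hT x x').intervalIntegrable _ _)
        (by simp : IntervalIntegrable (fun _ => ‖x - x'‖) volume 0 (t : ℝ))
        fun s _ => norm_extendPath_sub_le hT x x' s).trans ?_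
      simp only [intervalIntegral.integral_const, sub_zero, smul_eq_mul]
      exact mul_le_mul_of_nonneg_right t.2.2 (norm_nonneg _)
    calc 3 * (C : ℝ) * ∫ s in (0 : ℝ)..t, ‖extendPath hT x s - extendPath hT x' s‖
        ≤ 3 * C * (T * ‖x - x'‖) := by gcongr
      _ = _ := by ring
  have hGc : ∀ z, Continuous (G z) := fun z =>
    (LipschitzWith.of_dist_le_mul (K := 3 * C * ⟨T, hT⟩) fun x x' => by
      rw [dist_eq_norm, dist_eq_norm]; exact hGsub z x x').continuous
  have hGi : ∀ z, Integrable (fun ω => w ω + G z (z.1 ω)) P := fun z => by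
    have hi := L1.integrable_coeFn z.1
    refine ((hw.norm.add (integrable_const ‖G z 0‖)).add (hi.norm.const_mul (3 * C * T))).mono'
      (hw.aestronglyMeasurable.add ((hGc z).comp_aestronglyMeasurable hi.aestronglyMeasurable))
      (Eventually.of_forall fun ω => ?_)
    have h7 := norm_add_le (w ω) (G z (z.1 ω))
    have h5 := hGsub z (z.1 ω) 0
    have h6 := norm_add_le (G z 0) (G z (z.1 ω) - G z 0)
    rw [add_sub_cancel] at h6
    rw [sub_zero] at h5
    simp only [Pi.add_apply]
    linarith
  have hYi : ∀ z : Lp C(Set.Icc 0 T, Euc d) 1 P × C(Set.Icc 0 T, Fin m → Euc d),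
      IntervalIntegrable (leaderVelocity k c (μ z.1) (extendPath hT z.2)) volume 0 T := fun z =>
    intervalIntegrable_leaderVelocity hT hk hU hM c (hμc z.1).continuousOn (hyc z.2).continuousOn
  set Φ : Lp C(Set.Icc 0 T, Euc d) 1 P × C(Set.Icc 0 T, Fin m → Euc d) →
      Lp C(Set.Icc 0 T, Euc d) 1 P × C(Set.Icc 0 T, Fin m → Euc d) := fun z =>
    ((hGi z).toL1, ContinuousMap.const _ Y₀ + primitivePath _ (hYi z) hT) with hΦ
  set e : ℝ → Lp C(Set.Icc 0 T, Euc d) 1 P × C(Set.Icc 0 T, Fin m → Euc d) →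
      Lp C(Set.Icc 0 T, Euc d) 1 P × C(Set.Icc 0 T, Fin m → Euc d) → ℝ := fun s z z' =>
    max (meanDist P hT z.1 z'.1 s) ‖extendPath hT z.2 s - extendPath hT z'.2 s‖ with he
  have hec : ∀ z z', Continuous fun s => e s z z' := fun z z' =>
    (continuous_meanDist hT (L1.integrable_coeFn _) (L1.integrable_coeFn _)).max
      (((hyc z.2).sub (hyc z'.2)).norm)
  have hei : ∀ z z' (t : ℝ), IntervalIntegrable (fun s => e s z z') volume 0 t := fun z z' t =>
    (hec z z').intervalIntegrable _ _
  have he0 : ∀ z z' (t : ℝ), 0 ≤ t → 0 ≤ ∫ s in (0 : ℝ)..t, e s z z' := fun z z' t ht =>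
    intervalIntegral.integral_nonneg ht fun s _ => (norm_nonneg _).trans (le_max_right _ _)
  have hμe : ∀ z z' s, dist (μ z.1 s) (μ z'.1 s) ≤ e s z z' := fun z z' s =>
    (dist_marginals_le hT _ _ s).trans (le_max_left _ _)
  set D : ℝ := 9 * C + |R| * L with hD
  have hD0 : 0 ≤ D := by positivity
  -- the second component
  have hY : ∀ z z' (t : Set.Icc 0 T), ‖(Φ z).2 t - (Φ z').2 t‖ ≤
      D * ∫ s in (0 : ℝ)..t, e s z z' := by
    intro z z' t
    have h5 := norm_integral_leaderVelocity_sub_le hT h1 h2 h3 h4 hU (abs_nonneg R) hR' hM c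
      (hμc z.1).continuousOn (hyc z.2).continuousOn (hμc z'.1).continuousOn
      (hyc z'.2).continuousOn (hei z z' T) (fun s _ => hμe z z' s) (fun s _ => le_max_right _ _) t.2
    have h6 := he0 z z' t t.2.1
    have h7 := mul_nonneg C.coe_nonneg h6
    have h8 : (Φ z).2 t - (Φ z').2 t = (∫ s in (0 : ℝ)..t, leaderVelocity k c (μ z.1)
        (extendPath hT z.2) s) - ∫ s in (0 : ℝ)..t, leaderVelocity k c (μ z'.1)
        (extendPath hT z'.2) s := by
      simp only [hΦ, primitivePath_apply, ContinuousMap.add_apply, ContinuousMap.const_apply,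
        add_sub_add_left_eq_sub]
    rw [h8]
    refine h5.trans ?_
    rw [hD]
    linarith
  -- the first component, pathwise
  have hX : ∀ z z' (t : ℝ), t ∈ Set.Icc 0 T → ∀ ω, ∀ r ∈ Set.Icc 0 t,
      ‖extendPath hT (w ω + G z (z.1 ω)) r - extendPath hT (w ω + G z' (z'.1 ω)) r‖ ≤
      3 * C * ((∫ s in (0 : ℝ)..t, ‖extendPath hT (z.1 ω) s - extendPath hT (z'.1 ω) s‖) +
        2 * ∫ s in (0 : ℝ)..t, e s z z') := by
    intro z z' t ht ω r hr
    have hrT : r ∈ Set.Icc 0 T := ⟨hr.1, hr.2.trans ht.2⟩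
    rw [extendPath_of_mem hT _ hrT, extendPath_of_mem hT _ hrT]
    simp only [hG, primitivePath_apply, ContinuousMap.add_apply, add_sub_add_left_eq_sub]
    rw [← intervalIntegral.integral_sub (intervalIntegrable_zero_of_mem (hfi z _) hrT)
      (intervalIntegrable_zero_of_mem (hfi z' _) hrT)]
    have hint : ∀ t : ℝ, IntervalIntegrable (fun s => 3 * (C : ℝ) * (‖extendPath hT (z.1 ω) s -
        extendPath hT (z'.1 ω) s‖ + 2 * e s z z')) volume 0 t := fun t =>
      (((continuous_norm_extendPath_sub hT _ _).add ((hec z z').const_mul 2)).const_mul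
        _).intervalIntegrable _ _
    refine (intervalIntegral.norm_integral_le_of_norm_le hr.1 (Eventually.of_forall fun s _ => ?_)
      (hint r)).trans ?_
    · refine (k.norm_driftX_sub_le h1 h3 _ _ _ _ _ _).trans ?_
      refine mul_le_mul_of_nonneg_left ?_ (by positivity)
      have h5 := hμe z z' s
      have h6 : ‖extendPath hT z.2 s - extendPath hT z'.2 s‖ ≤ e s z z' := le_max_right _ _
      linarith
    · refine (intervalIntegral.integral_mono_interval le_rfl hr.1 hr.2
        (Eventually.of_forall fun s => ?_) (hint t)).trans_eq ?_
      · have : 0 ≤ e s z z' := (norm_nonneg _).trans (le_max_right _ _)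
        simp only [Pi.zero_apply]
        positivity
      · rw [intervalIntegral.integral_const_mul, intervalIntegral.integral_add
          ((continuous_norm_extendPath_sub hT _ _).intervalIntegrable _ _)
          (((hec z z').const_mul 2).intervalIntegrable _ _), intervalIntegral.integral_const_mul]
  have hXi : ∀ z z' (t : ℝ), t ∈ Set.Icc 0 T → Integrable (fun ω => 3 * (C : ℝ) *
      ((∫ s in (0 : ℝ)..t, ‖extendPath hT (z.1 ω) s - extendPath hT (z'.1 ω) s‖) +
        2 * ∫ s in (0 : ℝ)..t, e s z z')) P := fun z z' t ht =>
    ((integrable_integral_norm_sub hT (L1.integrable_coeFn z.1) (L1.integrable_coeFn z'.1)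
      ht.1).add (integrable_const _)).const_mul _
  have hXint : ∀ z z' (t : ℝ), t ∈ Set.Icc 0 T → ∫ ω, 3 * (C : ℝ) *
      ((∫ s in (0 : ℝ)..t, ‖extendPath hT (z.1 ω) s - extendPath hT (z'.1 ω) s‖) +
        2 * ∫ s in (0 : ℝ)..t, e s z z') ∂P ≤ D * ∫ s in (0 : ℝ)..t, e s z z' := by
    intro z z' t ht
    rw [integral_const_mul, integral_add (integrable_integral_norm_sub hT
      (L1.integrable_coeFn z.1) (L1.integrable_coeFn z'.1) ht.1) (integrable_const _),
      integral_integral_norm_sub hT (L1.integrable_coeFn z.1) (L1.integrable_coeFn z'.1)]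
    simp only [integral_const, probReal_univ, one_smul]
    have h5 : ∫ s in (0 : ℝ)..t, meanDist P hT z.1 z'.1 s ≤ ∫ s in (0 : ℝ)..t, e s z z' :=
      intervalIntegral.integral_mono_on ht.1 ((continuous_meanDist hT (L1.integrable_coeFn _)
        (L1.integrable_coeFn _)).intervalIntegrable _ _) (hei z z' t) fun s _ => le_max_left _ _
    have h6 := he0 z z' t ht.1
    have h7 : 0 ≤ |R| * L * ∫ s in (0 : ℝ)..t, e s z z' := by positivity
    have h8 := mul_le_mul_of_nonneg_left h5 C.coe_nonneg
    rw [hD]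
    linarith
  have hcoe : ∀ z, ((Φ z).1 : Ω → C(Set.Icc 0 T, Euc d)) =ᵐ[P] fun ω => w ω + G z (z.1 ω) :=
    fun z => (hGi z).coeFn_toL1
  obtain ⟨z, hz, hzu⟩ := existsUnique_fixedPoint_of_volterra hT hD0 Φ e (fun z z' => hei z z' T)
    (fun s hs z z' => by
      rw [Prod.dist_eq]
      refine max_le_max ?_ ?_
      · rw [L1.dist_eq_integral_dist]
        simp only [dist_eq_norm]
        exact meanDist_le hT (L1.integrable_coeFn _) (L1.integrable_coeFn _) s
      · rw [dist_eq_norm]; exact norm_extendPath_sub_le hT _ _ s)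
    (fun t ht z z' => by
      refine max_le ?_ ?_
      · refine le_trans ?_ (hXint z z' t ht)
        refine integral_mono_ae ((integrable_extendPath hT (L1.integrable_coeFn _) t).sub
          (integrable_extendPath hT (L1.integrable_coeFn _) t)).norm (hXi z z' t ht) ?_
        filter_upwards [hcoe z, hcoe z'] with ω hω hω'
        rw [hω, hω']
        exact hX z z' t ht ω t ⟨ht.1, le_rfl⟩
      · rw [extendPath_of_mem hT _ ht, extendPath_of_mem hT _ ht]
        exact hY z z' ⟨t, ht⟩)
    (fun z z' => by
      have hTT : T ∈ Set.Icc 0 T := ⟨hT, le_rfl⟩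
      rw [Prod.dist_eq]
      refine max_le ?_ ?_
      · rw [L1.dist_eq_integral_dist]
        simp only [dist_eq_norm]
        refine le_trans ?_ (hXint z z' T hTT)
        refine integral_mono_ae ((L1.integrable_coeFn _).sub (L1.integrable_coeFn _)).norm
          (hXi z z' T hTT) ?_
        filter_upwards [hcoe z, hcoe z'] with ω hω hω'
        rw [hω, hω']
        have := he0 z z' T hT
        have h0 : 0 ≤ ∫ s in (0 : ℝ)..T, ‖extendPath hT (z.1 ω) s - extendPath hT (z'.1 ω) s‖ :=
          intervalIntegral.integral_nonneg hT fun _ _ => norm_nonneg _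
        rw [ContinuousMap.norm_le _ (by positivity)]
        intro r
        have := hX z z' T hTT ω r r.2
        rwa [extendPath_of_mem hT _ r.2, extendPath_of_mem hT _ r.2] at this
      · rw [dist_eq_norm, ContinuousMap.norm_le _ (mul_nonneg hD0 (he0 z z' T hT))]
        intro t
        refine (hY z z' t).trans (mul_le_mul_of_nonneg_left ?_ hD0)
        exact intervalIntegral.integral_mono_interval le_rfl t.2.1 t.2.2
          (Eventually.of_forall fun s => (norm_nonneg _).trans (le_max_right _ _)) (hei z z' T))
  have hiff : ∀ z, Φ z = z ↔
      IsMeanFieldPath P k Y₀ c hT w z.1 (L1.integrable_coeFn z.1) z.2 := by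
    intro z
    rw [Prod.ext_iff, IsMeanFieldPath]
    refine and_congr ?_ ?_
    · rw [Lp.ext_iff]
      constructor
      · intro h
        filter_upwards [h, hcoe z] with ω h5 h6 t ht
        have h7 := congr_arg (fun x : C(Set.Icc 0 T, Euc d) => x ⟨t, ht⟩) (h5.symm.trans h6)
        rw [extendPath_of_mem hT _ ht, extendPath_of_mem hT _ ht]
        exact h7
      · intro h
        filter_upwards [h, hcoe z] with ω h5 h6
        rw [h6]
        ext1 t
        have h7 := h5 t t.2
        rw [extendPath_of_mem hT _ t.2, extendPath_of_mem hT _ t.2] at h7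
        exact h7.symm
    · rw [ContinuousMap.ext_iff]
      constructor
      · intro h t ht
        rw [extendPath_of_mem hT _ ht]
        exact (h ⟨t, ht⟩).symm
      · intro h t
        have h7 := h t t.2
        rw [extendPath_of_mem hT _ t.2] at h7
        exact h7.symm
  exact ⟨z, (hiff z).1 hz, fun z' hz' => hzu z' ((hiff z').2 hz')⟩

theorem IsMeanFieldPath.congr (hT : 0 ≤ T) {V V' : Ω → C(Set.Icc 0 T, Euc d)}
    {hV : Integrable V P} {y : C(Set.Icc 0 T, Fin m → Euc d)}
    (h : IsMeanFieldPath P k Y₀ c hT w V hV y) (hV' : Integrable V' P) (hVV' : V =ᵐ[P] V') :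
    IsMeanFieldPath P k Y₀ c hT w V' hV' y := by
  have hm := marginals_congr hT hV hV' hVV'
  rw [IsMeanFieldPath, ← hm]
  refine ⟨?_, h.2⟩
  filter_upwards [h.1, hVV'] with ω h1 h2
  rw [← h2]
  exact h1

end MeanField

section MeanFieldSolution

variable {Ω : Type*} [MeasurableSpace Ω] {P : Measure Ω} [IsProbabilityMeasure P] {d ℓ m : ℕ}
  {T σ : ℝ} {U : Set (Mat d ℓ)} {M : ℝ} {L : ℝ≥0} {k : Kernels d}
  {c : Controls m T U M L} {Y₀ : Fin m → Euc d} {w : Ω → C(Set.Icc 0 T, Euc d)}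
  {ξ : Ω → Euc d} {B : ℝ≥0 → Ω → Euc d}

theorem intervalIntegral_apply {ι E : Type*} [Fintype ι] [NormedAddCommGroup E] [NormedSpace ℝ E]
    [CompleteSpace E] {b : ℝ → ι → E} {t : ℝ} (hb : IntervalIntegrable b volume 0 t) (i : ι) :
    (∫ s in (0 : ℝ)..t, b s) i = ∫ s in (0 : ℝ)..t, b s i :=
  ((ContinuousLinearMap.proj i : (ι → E) →L[ℝ] E).intervalIntegral_comp_comm hb).symm

theorem IsMeanFieldPath.isMeanFieldSolution (hT : 0 ≤ T) (hk : k.IsLipschitz) (hU : IsCompact U)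
    (hM : 0 < M) {V : Ω → C(Set.Icc 0 T, Euc d)} {hV : Integrable V P} (hVm : Measurable V)
    {y : C(Set.Icc 0 T, Fin m → Euc d)} (h : IsMeanFieldPath P k Y₀ c hT w V hV y)
    (hw : IsNoisePath P σ ξ B w) :
    IsMeanFieldSolution P k σ Y₀ c ξ B (fun t ω => extendPath hT (V ω) t)
      (fun i t => extendPath hT y t i) (marginals P hT V hV) := by
  have hμ := (continuous_marginals hT hV).continuousOn (s := Set.Icc 0 T)
  have hy := (continuous_extendPath hT y).continuousOn (s := Set.Icc 0 T)
  have hYi := intervalIntegrable_leaderVelocity hT hk hU hM c hμ hy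
  refine
    { measurable_X := fun t _ => (measurable_path_eval _).comp hVm
      continuous_X := fun ω => (continuous_extendPath hT _).continuousOn
      moment := ?_
      law := fun t _ => rfl
      continuous_Y := fun i => ((continuous_apply i).comp (continuous_extendPath hT y)).continuousOn
      eq_X := ?_
      eq_Y := fun i => ⟨?_, fun t ht => ?_⟩ }
  · refine (lintegral_mono fun ω => ?_).trans_lt hV.hasFiniteIntegral
    exact iSup₂_le fun t _ => by
      rw [← ofReal_norm, ← ofReal_norm]
      exact ENNReal.ofReal_le_ofReal (norm_extendPath_le hT (V ω) t)
  · have hk' := hk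
    obtain ⟨C, h1, h2, h3, h4⟩ := hk'
    obtain ⟨K, hf⟩ := isCaratheodoryField_driftX h1 h2 h3 h4 hμ hy
    filter_upwards [h.1, hw.ae_eq] with ω hω hω'
    refine ⟨hf.intervalIntegrable hT (continuous_extendPath hT (V ω)).continuousOn, fun t ht => ?_⟩
    refine (hω t ht).trans ?_
    rw [extendPath_of_mem hT _ ht, hω' ⟨t, ht⟩]
    abel
  · exact ⟨hYi.1.eval i, hYi.2.eval i⟩
  · have hit := intervalIntegrable_zero_of_mem hYi ht
    refine (congr_fun (h.2 t ht) i).trans ?_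
    rw [Pi.add_apply, intervalIntegral_apply hit, Pi.zero_apply, add_zero]
    rfl

theorem IsMeanFieldSolution.exists_isMeanFieldPath {X : ℝ → Ω → Euc d} {Y : Fin m → ℝ → Euc d}
    {μ : ℝ → W1 d} (h : IsMeanFieldSolution P k σ Y₀ c ξ B X Y μ)
    (hT : 0 ≤ T) (hk : k.IsLipschitz) (hU : IsCompact U) (hM : 0 < M)
    (hw : IsNoisePath P σ ξ B w) :
    ∃ (V : Ω → C(Set.Icc 0 T, Euc d)) (hV : Integrable V P) (y : C(Set.Icc 0 T, Fin m → Euc d)),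
      Measurable V ∧ IsMeanFieldPath P k Y₀ c hT w V hV y ∧
      (∀ ω, ∀ t ∈ Set.Icc 0 T, extendPath hT (V ω) t = X t ω) ∧
      (∀ t ∈ Set.Icc 0 T, extendPath hT y t = fun i => Y i t) ∧
      ∀ t ∈ Set.Icc 0 T, marginals P hT V hV t = μ t := by
  set V : Ω → C(Set.Icc 0 T, Euc d) := fun ω => ⟨fun t => X t ω, (h.continuous_X ω).domRestrict⟩
    with hVdef
  have hVm : Measurable V := measurable_path fun t => h.measurable_X t t.2
  have hVX : ∀ ω, ∀ t ∈ Set.Icc 0 T, extendPath hT (V ω) t = X t ω := fun ω t ht => by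
    rw [extendPath_of_mem hT _ ht]; rfl
  have hV : Integrable V P := by
    refine ⟨hVm.aestronglyMeasurable, (lintegral_mono fun ω => ?_).trans_lt h.moment⟩
    rcases eq_or_ne (⨆ t ∈ Set.Icc 0 T, ‖X t ω‖ₑ) ∞ with htop | htop
    · rw [htop]; exact le_top
    · rw [← ENNReal.ofReal_toReal htop, ← ofReal_norm]
      refine ENNReal.ofReal_le_ofReal ((ContinuousMap.norm_le _ ENNReal.toReal_nonneg).2
        fun t => ?_)
      have h1 : ‖X t ω‖ₑ ≤ ⨆ t ∈ Set.Icc 0 T, ‖X t ω‖ₑ := le_iSup₂ (f := fun t _ => ‖X t ω‖ₑ) _ t.2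
      have h2 := ENNReal.toReal_mono htop h1
      rwa [toReal_enorm] at h2
  set y : C(Set.Icc 0 T, Fin m → Euc d) :=
    ⟨fun t i => Y i t, continuous_pi fun i => (h.continuous_Y i).domRestrict⟩ with hydef
  have hyY : ∀ t ∈ Set.Icc 0 T, extendPath hT y t = fun i => Y i t := fun t ht => by
    rw [extendPath_of_mem hT _ ht]; rfl
  have hμ : ∀ t ∈ Set.Icc 0 T, marginals P hT V hV t = μ t := fun t ht => by
    refine W1.ext_val ?_
    rw [← h.law t ht]
    exact congr_arg (Measure.map · P) (funext fun ω => hVX ω t ht)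
  refine ⟨V, hV, y, hVm, ⟨?_, fun t ht => ?_⟩, hVX, hyY, hμ⟩
  · filter_upwards [h.eq_X, hw.ae_eq] with ω hω hω' t ht
    rw [hVX ω t ht, extendPath_of_mem hT _ ht, hω' ⟨t, ht⟩]
    refine (hω.2 t ht).trans ?_
    have : ∫ s in (0 : ℝ)..t, k.driftX (marginals P hT V hV s) (extendPath hT y s)
        (extendPath hT (V ω) s) = ∫ s in (0 : ℝ)..t, k.driftX (μ s) (fun j => Y j s) (X s ω) := by
      refine intervalIntegral.integral_congr fun s hs => ?_
      rw [Set.uIcc_of_le ht.1] at hs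
      have hs' : s ∈ Set.Icc 0 T := ⟨hs.1, hs.2.trans ht.2⟩
      simp only [hμ s hs', hyY s hs', hVX ω s hs']
    rw [this]
    abel
  · have hit := intervalIntegrable_zero_of_mem (intervalIntegrable_leaderVelocity hT hk hU hM c
      (continuous_marginals hT hV).continuousOn (continuous_extendPath hT y).continuousOn) ht
    rw [hyY t ht]
    ext1 i
    rw [Pi.add_apply, intervalIntegral_apply hit]
    refine ((h.eq_Y i).2 t ht).trans ?_
    rw [Pi.zero_apply, add_zero]
    congr 1
    refine intervalIntegral.integral_congr fun s hs => ?_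
    rw [Set.uIcc_of_le ht.1] at hs
    have hs' : s ∈ Set.Icc 0 T := ⟨hs.1, hs.2.trans ht.2⟩
    simp only [leaderVelocity, Pi.add_apply, hμ s hs', hyY s hs']

theorem exists_isMeanFieldSolution (hT : 0 ≤ T) (hk : k.IsLipschitz) (hU : IsCompact U)
    (hM : 0 < M) (c : Controls m T U M L) (Y₀ : Fin m → Euc d) (hw : IsNoisePath P σ ξ B w)
    (hwi : Integrable w P) :
    ∃ (X : ℝ → Ω → Euc d) (Y : Fin m → ℝ → Euc d) (μ : ℝ → W1 d),
      IsMeanFieldSolution P k σ Y₀ c ξ B X Y μ := by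
  obtain ⟨z, hz, -⟩ := existsUnique_isMeanFieldPath hT hk hU hM c Y₀ hwi
  exact ⟨_, _, _, hz.isMeanFieldSolution hT hk hU hM (Lp.stronglyMeasurable z.1).measurable hw⟩

theorem IsMeanFieldSolution.ae_unique {X X' : ℝ → Ω → Euc d} {Y Y' : Fin m → ℝ → Euc d}
    {μ μ' : ℝ → W1 d} (h : IsMeanFieldSolution P k σ Y₀ c ξ B X Y μ)
    (h' : IsMeanFieldSolution P k σ Y₀ c ξ B X' Y' μ') (hT : 0 ≤ T) (hk : k.IsLipschitz)
    (hU : IsCompact U) (hM : 0 < M) (hw : IsNoisePath P σ ξ B w) (hwi : Integrable w P) :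
    (∀ᵐ ω ∂P, ∀ t ∈ Set.Icc 0 T, X t ω = X' t ω) ∧ ∀ i, ∀ t ∈ Set.Icc 0 T, Y i t = Y' i t := by
  obtain ⟨V, hV, y, -, hVy, hVX, hyY, -⟩ := h.exists_isMeanFieldPath hT hk hU hM hw
  obtain ⟨V', hV', y', -, hVy', hVX', hyY', -⟩ := h'.exists_isMeanFieldPath hT hk hU hM hw
  have h1 := hVy.congr hT (L1.integrable_coeFn hV.toL1) hV.coeFn_toL1.symm
  have h2 := hVy'.congr hT (L1.integrable_coeFn hV'.toL1) hV'.coeFn_toL1.symm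
  have heq := (existsUnique_isMeanFieldPath hT hk hU hM c Y₀ hwi).unique
    (y₁ := (hV.toL1, y)) (y₂ := (hV'.toL1, y')) h1 h2
  rw [Prod.mk.injEq, Integrable.toL1_eq_toL1_iff] at heq
  refine ⟨?_, fun i t ht => ?_⟩
  · filter_upwards [heq.1] with ω hω t ht
    rw [← hVX ω t ht, ← hVX' ω t ht, hω]
  · have e1 := hyY t ht
    rw [heq.2, hyY' t ht] at e1
    exact (congr_fun e1 i).symm

theorem IsMeanFieldSolution.continuousOn_law {X : ℝ → Ω → Euc d} {Y : Fin m → ℝ → Euc d}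
    {μ : ℝ → W1 d} (h : IsMeanFieldSolution P k σ Y₀ c ξ B X Y μ) (hT : 0 ≤ T)
    (hk : k.IsLipschitz) (hU : IsCompact U) (hM : 0 < M) (hw : IsNoisePath P σ ξ B w) :
    ContinuousOn μ (Set.Icc 0 T) := by
  obtain ⟨V, hV, y, -, -, -, -, hμ⟩ := h.exists_isMeanFieldPath hT hk hU hM hw
  exact (continuous_marginals hT hV).continuousOn.congr fun t ht => (hμ t ht).symm

end MeanFieldSolution

/-! ### The law of large numbers on the path space -/

section LawOfLargeNumbers

theorem map_comp_simpleFunc {α E F : Type*} [MeasurableSpace α] [MeasurableSpace F]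
    {μ : Measure α} (φ : SimpleFunc α E) (f : E → F) :
    μ.map (fun x => f (φ x)) = ∑ i : φ.range, μ (φ ⁻¹' {i.1}) • Measure.dirac (f i) := by
  classical
  have hm : Measurable fun x => f (φ x) := (φ.map f).measurable
  ext S hS
  rw [Measure.map_apply hm hS, Measure.finsetSum_apply,
    Finset.sum_coe_sort φ.range fun i => (μ (φ ⁻¹' {i}) • Measure.dirac (f i)) S]
  have h : (fun x => f (φ x)) ⁻¹' S = φ ⁻¹' ↑(φ.range.filter fun i => f i ∈ S) := by
    ext x
    simp
  rw [h, ← φ.sum_measure_preimage_singleton, Finset.sum_filter]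
  refine Finset.sum_congr rfl fun i _ => ?_
  by_cases hi : f i ∈ S <;> simp [Measure.dirac_apply' _ hS, hi]

theorem W1.empirical_val_simpleFunc {α E : Type*} [MeasurableSpace α] {d N : ℕ} [NeZero N]
    (φ : SimpleFunc α E) (f : E → Euc d) (x : Fin N → α) :
    (W1.empirical fun n => f (φ (x n))).val = ∑ i : φ.range,
      ENNReal.ofReal ((N : ℝ)⁻¹ * ∑ n, (φ ⁻¹' {i.1}).indicator 1 (x n)) •
        Measure.dirac (f i) := by
  classical
  have hN : (0 : ℝ) < N := Nat.cast_pos.2 (NeZero.pos N)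
  have h (i : E) : ENNReal.ofReal ((N : ℝ)⁻¹ * ∑ n, (φ ⁻¹' {i}).indicator 1 (x n)) =
      (N : ℝ≥0∞)⁻¹ * ∑ n, if φ (x n) = i then 1 else 0 := by
    rw [ENNReal.ofReal_mul (inv_nonneg.2 hN.le), ENNReal.ofReal_inv_of_pos hN,
      ENNReal.ofReal_natCast, ENNReal.ofReal_sum_of_nonneg (f := fun n => (φ ⁻¹' {i}).indicator (1 : α → ℝ) (x n))
        fun n _ => Set.indicator_nonneg (fun _ _ => zero_le_one) _]
    congr 1
    refine Finset.sum_congr rfl fun n _ => ?_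
    by_cases hi : φ (x n) = i <;> simp [hi]
  simp_rw [h, mul_smul, ← Finset.smul_sum, Finset.sum_smul]
  rw [Finset.sum_comm]
  simp only [W1.empirical]
  congr 1
  refine Finset.sum_congr rfl fun n _ => ?_
  rw [Finset.sum_coe_sort φ.range fun i =>
    (if φ (x n) = i then (1 : ℝ≥0∞) else 0) • Measure.dirac (f i)]
  simp [ite_smul]

variable {Ω : Type*} [MeasurableSpace Ω] {P : Measure Ω} [IsProbabilityMeasure P] {d : ℕ} {T : ℝ}

theorem tendsto_integral_abs_frequency_sub {α : Type*} [MeasurableSpace α] {X : ℕ → Ω → α}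
    {V : Ω → α} (hX : ∀ n, IdentDistrib (X n) V P P) (hind : iIndepFun X P) {A : Set α}
    (hA : MeasurableSet A) :
    Tendsto (fun N : ℕ => ∫ ω, |((N + 1 : ℕ) : ℝ)⁻¹ * ∑ n : Fin (N + 1), A.indicator 1 (X n ω) -
      (P.map V).real A| ∂P) atTop (𝓝 0) := by
  have hf : Measurable (A.indicator (1 : α → ℝ)) := measurable_one.indicator hA
  have hid (n : ℕ) : IdentDistrib (fun ω => A.indicator (1 : α → ℝ) (X n ω))
      (fun ω => A.indicator (1 : α → ℝ) (V ω)) P P := (hX n).comp hf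
  have hm (n : ℕ) : MemLp (fun ω => A.indicator (1 : α → ℝ) (X n ω)) 1 P := by
    refine MemLp.of_bound (hid n).aemeasurable_fst.aestronglyMeasurable 1
      (Eventually.of_forall fun ω => ?_)
    by_cases h : X n ω ∈ A <;> simp [h]
  have h0 : ∫ ω, A.indicator (1 : α → ℝ) (X 0 ω) ∂P = (P.map V).real A := by
    rw [(hid 0).integral_eq, ← integral_map (hX 0).aemeasurable_snd hf.aestronglyMeasurable,
      integral_indicator_one hA]
  have := strong_law_Lp le_rfl ENNReal.one_ne_top (fun n ω => A.indicator (1 : α → ℝ) (X n ω))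
    (hm 0) (fun i j hij => (hind.indepFun hij).comp hf hf) fun n => (hid n).trans (hid 0).symm
  rw [h0] at this
  have h2 := ((ENNReal.tendsto_toReal ENNReal.zero_ne_top).comp this).comp (tendsto_add_atTop_nat 1)
  refine h2.congr fun N => ?_
  have hms : AEStronglyMeasurable (fun ω => ((N + 1 : ℕ) : ℝ)⁻¹ •
      (∑ i ∈ Finset.range (N + 1), A.indicator (1 : α → ℝ) (X i ω)) - (P.map V).real A) P :=
    ((Finset.aestronglyMeasurable_fun_sum (Finset.range (N + 1)) fun n _ =>
      (hm n).aestronglyMeasurable).fun_const_smul ((N + 1 : ℕ) : ℝ)⁻¹).sub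
        aestronglyMeasurable_const
  simp only [Function.comp_apply]
  rw [eLpNorm_one_eq_lintegral_enorm, ← integral_norm_eq_lintegral_enorm hms]
  simp only [Real.norm_eq_abs, smul_eq_mul, Finset.sum_range]

/-- Law of large numbers: the empirical measures of independent copies of an integrable random
path converge in mean, uniformly in time, to its marginals. -/
theorem eventually_dist_empirical_marginals_le (hT : 0 ≤ T)
    {X : ℕ → Ω → C(Set.Icc 0 T, Euc d)} {V : Ω → C(Set.Icc 0 T, Euc d)}
    (hX : ∀ n, IdentDistrib (X n) V P P) (hind : iIndepFun X P) (hVm : Measurable V)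
    (hV : Integrable V P) {ε : ℝ} (hε : 0 < ε) :
    ∀ᶠ N : ℕ in atTop, ∃ R : Ω → ℝ, Integrable R P ∧ (∀ ω, 0 ≤ R ω) ∧ ∫ ω, R ω ∂P ≤ ε ∧
      ∀ ω s, dist (W1.empirical fun n : Fin (N + 1) => extendPath hT (X n ω) s)
        (marginals P hT V hV s) ≤ R ω := by
  classical
  have : IsProbabilityMeasure (P.map V) := Measure.isProbabilityMeasure_map hVm.aemeasurable
  have hid : MemLp (id : C(Set.Icc 0 T, Euc d) → _) 1 (P.map V) :=
    memLp_one_iff_integrable.2 ((integrable_map_measure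
      measurable_id.aestronglyMeasurable hVm.aemeasurable).2 hV)
  obtain ⟨π, hπ, hπm⟩ := hid.exists_simpleFunc_eLpNorm_sub_lt ENNReal.one_ne_top
    (ε := ENNReal.ofReal (ε / 3)) (by simpa using hε)
  obtain ⟨D, hD⟩ := π.exists_forall_norm_le
  have hD0 : 0 ≤ D := (norm_nonneg _).trans (hD 0)
  set g : C(Set.Icc 0 T, Euc d) → ℝ := fun x => ‖x - π x‖ with hg
  have hgm : Measurable g := (measurable_id.sub π.measurable).norm
  have hgi : Integrable (fun ω => g (V ω)) P := by
    have := (memLp_one_iff_integrable.1 (hid.sub hπm)).norm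
    exact (integrable_map_measure hgm.aestronglyMeasurable hVm.aemeasurable).1 this
  have hge : ∫ ω, g (V ω) ∂P ≤ ε / 3 := by
    rw [← integral_map hVm.aemeasurable hgm.aestronglyMeasurable]
    rw [eLpNorm_one_eq_lintegral_enorm] at hπ
    have h1 := integral_norm_eq_lintegral_enorm (hid.sub hπm).aestronglyMeasurable
    refine h1.trans_le ?_
    exact ENNReal.toReal_le_of_le_ofReal (by positivity) hπ.le
  have hgX (n : ℕ) : IdentDistrib (fun ω => g (X n ω)) (fun ω => g (V ω)) P P := (hX n).comp hgm
  have hgXi (n : ℕ) : Integrable (fun ω => g (X n ω)) P := (hgX n).integrable_iff.2 hgi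
  set q : ℕ → π.range → Ω → ℝ := fun N i ω => |((N + 1 : ℕ) : ℝ)⁻¹ *
    ∑ n : Fin (N + 1), (π ⁻¹' {i.1}).indicator 1 (X n ω) - (P.map V).real (π ⁻¹' {i.1})| with hq
  have hqi (N : ℕ) (i : π.range) : Integrable (q N i) P := by
    refine (((integrable_finsetSum _ fun n _ => ?_).const_mul _).sub (integrable_const _)).abs
    refine (memLp_one_iff_integrable.1 (MemLp.of_bound
      (((measurable_one.indicator (π.measurableSet_fiber i.1)).comp_aemeasurable
        (hX n).aemeasurable_fst).aestronglyMeasurable) 1 (Eventually.of_forall fun ω => ?_)))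
    by_cases h : X n ω ∈ π ⁻¹' {i.1}
    · simp only [Set.indicator_of_mem h]; simp
    · simp only [Set.indicator_of_notMem h]; simp
  have hlim : Tendsto (fun N => 2 * D * ∑ i, ∫ ω, q N i ω ∂P) atTop (𝓝 0) := by
    have := (tendsto_finsetSum Finset.univ fun (i : π.range) _ =>
      tendsto_integral_abs_frequency_sub hX hind (π.measurableSet_fiber i.1)).const_mul (2 * D)
    simpa only [mul_zero, Finset.sum_const_zero] using this
  filter_upwards [hlim.eventually (gt_mem_nhds (by positivity : (0 : ℝ) < ε / 3))] with N hN
  have i1 : Integrable (fun ω => ((N + 1 : ℕ) : ℝ)⁻¹ * ∑ n : Fin (N + 1), g (X n ω)) P :=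
    (integrable_finsetSum Finset.univ fun (n : Fin (N + 1)) _ => hgXi n).const_mul _
  have i2 : Integrable (fun ω => 2 * D * ∑ i, q N i ω) P :=
    Integrable.const_mul (integrable_finsetSum _ fun i _ => hqi N i) _
  refine ⟨fun ω => ((N + 1 : ℕ) : ℝ)⁻¹ * ∑ n : Fin (N + 1), g (X n ω) + 2 * D * ∑ i, q N i ω +
    ∫ ω, g (V ω) ∂P, ?_, fun ω => ?_, ?_, fun ω s => ?_⟩
  · exact (i1.add i2).add (integrable_const _)
  · have h1 : 0 ≤ ∫ ω, g (V ω) ∂P := integral_nonneg fun _ => norm_nonneg _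
    have h2 : 0 ≤ ∑ i, q N i ω := Finset.sum_nonneg fun _ _ => abs_nonneg _
    have h3 : 0 ≤ ∑ n : Fin (N + 1), g (X n ω) := Finset.sum_nonneg fun _ _ => norm_nonneg _
    positivity
  · refine (integral_add (i1.add i2) (integrable_const _)).trans_le ?_
    rw [integral_add' i1 i2, integral_const_mul,
      integral_const_mul, integral_finsetSum _ fun (n : Fin (N + 1)) _ => hgXi n,
      integral_finsetSum _ fun i _ => hqi N i]
    simp_rw [fun n : ℕ => (hgX n).integral_eq]
    simp only [Finset.sum_const, Finset.card_univ, Fintype.card_fin, nsmul_eq_mul, integral_const,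
      probReal_univ, smul_eq_mul, one_mul]
    rw [inv_mul_cancel_left₀ (by positivity)]
    linarith
  · have hπV : Integrable (fun ω => π (V ω)) P :=
      (integrable_map_measure π.aestronglyMeasurable hVm.aemeasurable).1
        (memLp_one_iff_integrable.1 hπm)
    have e1 : dist (W1.empirical fun n : Fin (N + 1) => extendPath hT (X n ω) s)
        (W1.empirical fun n : Fin (N + 1) => extendPath hT (π (X n ω)) s) ≤
        ((N + 1 : ℕ) : ℝ)⁻¹ * ∑ n : Fin (N + 1), g (X n ω) := by
      refine (W1.dist_empirical_le _ _).trans ?_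
      gcongr with n
      exact norm_extendPath_sub_le hT _ _ s
    have e2 : dist (marginals P hT (fun ω => π (V ω)) hπV s) (marginals P hT V hV s) ≤
        ∫ ω, g (V ω) ∂P := by
      rw [dist_comm]
      exact (dist_marginals_le hT hV hπV s).trans (meanDist_le hT hV hπV s)
    have e3 : dist (W1.empirical fun n : Fin (N + 1) => extendPath hT (π (X n ω)) s)
        (marginals P hT (fun ω => π (V ω)) hπV s) ≤ 2 * D * ∑ i, q N i ω := by
      refine W1.dist_le_of_discrete (fun i => ?_) (fun i => ?_) ?_ (by positivity)
        (v := fun i : π.range => extendPath hT i.1 s) (fun i j => ?_)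
        (W1.empirical_val_simpleFunc π (fun x => extendPath hT x s) fun n : Fin (N + 1) => X n ω) ?_
      · exact mul_nonneg (by positivity) (Finset.sum_nonneg fun n _ =>
          Set.indicator_nonneg (fun _ _ => zero_le_one) _)
      · exact measureReal_nonneg
      · rw [← Finset.mul_sum, Finset.sum_comm]
        have h1 (x : C(Set.Icc 0 T, Euc d)) :
            ∑ i : π.range, (π ⁻¹' {i.1}).indicator (1 : C(Set.Icc 0 T, Euc d) → ℝ) x = 1 := by
          rw [Finset.sum_coe_sort π.range fun i => (π ⁻¹' {i}).indicator (1 : C(Set.Icc 0 T, Euc d) → ℝ) x]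
          simp [Set.indicator_apply]
        have h2 := congrArg ENNReal.toReal (π.sum_range_measure_preimage_singleton (P.map V))
        rw [measure_univ, ENNReal.toReal_sum fun i _ => measure_ne_top _ _,
          ← Finset.sum_coe_sort π.range fun i => ((P.map V) (π ⁻¹' {i})).toReal] at h2
        simp only [h1, Measure.real]
        rw [h2]
        simp only [Finset.sum_const, Finset.card_univ, Fintype.card_fin, nsmul_eq_mul, mul_one,
          ENNReal.toReal_one]
        exact inv_mul_cancel₀ (by positivity)
      · have h1 (i : π.range) : ‖extendPath hT i.1 s‖ ≤ D := by
          obtain ⟨x, hx⟩ := SimpleFunc.mem_range.1 i.2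
          rw [← hx]
          exact (norm_extendPath_le hT _ s).trans (hD x)
        linarith [norm_sub_le (extendPath hT i.1 s) (extendPath hT j.1 s), h1 i, h1 j]
      · have h1 := map_comp_simpleFunc (μ := P.map V) π fun x => extendPath hT x s
        have h2 : Measurable fun x => extendPath hT (π x) s :=
          (π.map fun x => extendPath hT x s).measurable
        rw [Measure.map_map h2 hVm] at h1
        refine h1.trans (Finset.sum_congr rfl fun i _ => ?_)
        rw [Measure.real, ENNReal.ofReal_toReal (measure_ne_top _ _)]
    calc _ ≤ _ := (dist_triangle _ _ _).trans (add_le_add e1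
        ((dist_triangle _ _ _).trans (add_le_add e3 e2)))
      _ = _ := (add_assoc _ _ _).symm

end LawOfLargeNumbers

/-! ### Comparison of the particle system with independent copies of the limit -/

section Comparison

variable {d ℓ m : ℕ} {T : ℝ} {U : Set (Mat d ℓ)} {M : ℝ} {L : ℝ≥0} {k : Kernels d}

theorem average_norm_sub_le {N : ℕ} [NeZero N] {C : ℝ≥0} (h1 : LipschitzWith C k.H₁)
    (h2 : LipschitzWith C k.H₂) (h3 : LipschitzWith C k.K₁) (h4 : LipschitzWith C k.K₂)
    {v : Fin N → ℝ → Euc d} {x x' : ℝ → Fin N → Euc d} {y y' : ℝ → Fin m → Euc d}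
    {μ μ' : ℝ → W1 d} (hxc : ContinuousOn x (Set.Icc 0 T)) (hxc' : ContinuousOn x' (Set.Icc 0 T))
    (hyc : ContinuousOn y (Set.Icc 0 T)) (hyc' : ContinuousOn y' (Set.Icc 0 T))
    (hμc : ContinuousOn μ (Set.Icc 0 T)) (hμc' : ContinuousOn μ' (Set.Icc 0 T))
    (hx : ∀ t ∈ Set.Icc 0 T, ∀ n,
      x t n = v n t + ∫ s in (0 : ℝ)..t, k.driftX (μ s) (y s) (x s n))
    (hx' : ∀ t ∈ Set.Icc 0 T, ∀ n,
      x' t n = v n t + ∫ s in (0 : ℝ)..t, k.driftX (μ' s) (y' s) (x' s n))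
    {b : ℝ → ℝ} (hb : IntervalIntegrable b volume 0 T)
    (hxb : ∀ s ∈ Set.Icc 0 T, (N : ℝ)⁻¹ * ∑ n, ‖x s n - x' s n‖ ≤ b s)
    (hyb : ∀ s ∈ Set.Icc 0 T, ‖y s - y' s‖ ≤ b s)
    (hμb : ∀ s ∈ Set.Icc 0 T, dist (μ s) (μ' s) ≤ b s) {t : ℝ} (ht : t ∈ Set.Icc 0 T) :
    (N : ℝ)⁻¹ * ∑ n, ‖x t n - x' t n‖ ≤ 9 * C * ∫ s in (0 : ℝ)..t, b s := by
  have hN : (0 : ℝ) < N := Nat.cast_pos.2 (NeZero.pos N)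
  have hc := Kernels.continuous_driftX (m := m) (k := k) ⟨C, h1, h2, h3, h4⟩
  have hsub : Set.Icc 0 t ⊆ Set.Icc 0 T := Set.Icc_subset_Icc_right ht.2
  have hint {f : ℝ → ℝ} (hf : ContinuousOn f (Set.Icc 0 T)) :
      IntervalIntegrable f volume 0 t := by
    refine (hf.mono ?_).intervalIntegrable
    rwa [Set.uIcc_of_le ht.1]
  have hbt := intervalIntegrable_zero_of_mem hb ht
  have hdc {x : ℝ → Fin N → Euc d} {y : ℝ → Fin m → Euc d} {μ : ℝ → W1 d}
      (hx : ContinuousOn x (Set.Icc 0 T)) (hy : ContinuousOn y (Set.Icc 0 T))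
      (hμ : ContinuousOn μ (Set.Icc 0 T)) (n : Fin N) :
      ContinuousOn (fun s => k.driftX (μ s) (y s) (x s n)) (Set.Icc 0 T) :=
    hc.comp_continuousOn (hμ.prodMk (hy.prodMk ((continuous_apply n).comp_continuousOn hx)))
  have hdi {x : ℝ → Fin N → Euc d} {y : ℝ → Fin m → Euc d} {μ : ℝ → W1 d}
      (hx : ContinuousOn x (Set.Icc 0 T)) (hy : ContinuousOn y (Set.Icc 0 T))
      (hμ : ContinuousOn μ (Set.Icc 0 T)) (n : Fin N) :
      IntervalIntegrable (fun s => k.driftX (μ s) (y s) (x s n)) volume 0 t := by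
    refine ((hdc hx hy hμ n).mono ?_).intervalIntegrable
    rwa [Set.uIcc_of_le ht.1]
  have hxi (n : Fin N) : IntervalIntegrable (fun s => ‖x s n - x' s n‖) volume 0 t :=
    hint (((continuous_apply n).comp_continuousOn hxc).sub
      ((continuous_apply n).comp_continuousOn hxc')).norm
  have hfi (n : Fin N) : IntervalIntegrable (fun s => 3 * C * (‖x s n - x' s n‖ + 2 * b s))
      volume 0 t := ((hxi n).add (hbt.const_mul 2)).const_mul _
  have hn (n : Fin N) : ‖x t n - x' t n‖ ≤
      ∫ s in (0 : ℝ)..t, 3 * C * (‖x s n - x' s n‖ + 2 * b s) := by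
    rw [hx t ht n, hx' t ht n, add_sub_add_left_eq_sub, ← intervalIntegral.integral_sub
      (hdi hxc hyc hμc n) (hdi hxc' hyc' hμc' n)]
    refine intervalIntegral.norm_integral_le_of_norm_le ht.1 (Eventually.of_forall fun s hs => ?_)
      (hfi n)
    have hsT := hsub (Set.Ioc_subset_Icc_self hs)
    refine (k.norm_driftX_sub_le h1 h3 _ _ _ _ _ _).trans ?_
    have := hyb s hsT
    have := hμb s hsT
    refine mul_le_mul_of_nonneg_left ?_ (by positivity)
    linarith
  calc (N : ℝ)⁻¹ * ∑ n, ‖x t n - x' t n‖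
      ≤ (N : ℝ)⁻¹ * ∑ n : Fin N, ∫ s in (0 : ℝ)..t, 3 * C * (‖x s n - x' s n‖ + 2 * b s) := by
        gcongr with n
        exact hn n
    _ = ∫ s in (0 : ℝ)..t, (N : ℝ)⁻¹ * ∑ n : Fin N, 3 * C * (‖x s n - x' s n‖ + 2 * b s) := by
        rw [intervalIntegral.integral_const_mul, intervalIntegral.integral_finsetSum fun n _ =>
          hfi n]
    _ ≤ ∫ s in (0 : ℝ)..t, 9 * C * b s := by
        refine intervalIntegral.integral_mono_on ht.1 ?_ (hbt.const_mul _) fun s hs => ?_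
        · have := (IntervalIntegrable.sum Finset.univ fun n _ => hfi n).const_mul (N : ℝ)⁻¹
          simpa only [Finset.sum_apply] using this
        · have h5 := hxb s (hsub hs)
          have h6 : (N : ℝ)⁻¹ * ∑ n : Fin N, 3 * C * (‖x s n - x' s n‖ + 2 * b s) =
              3 * C * ((N : ℝ)⁻¹ * ∑ n, ‖x s n - x' s n‖ + 2 * b s) := by
            rw [← Finset.mul_sum, Finset.sum_add_distrib, Finset.sum_const, Finset.card_univ,
              Fintype.card_fin, nsmul_eq_mul]
            field_simp
          rw [h6]
          have h7 : (N : ℝ)⁻¹ * ∑ n, ‖x s n - x' s n‖ + 2 * b s ≤ 3 * b s := by linarith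
          calc 3 * (C : ℝ) * ((N : ℝ)⁻¹ * ∑ n, ‖x s n - x' s n‖ + 2 * b s)
              ≤ 3 * C * (3 * b s) := by gcongr
            _ = 9 * C * b s := by ring
    _ = 9 * C * ∫ s in (0 : ℝ)..t, b s := intervalIntegral.integral_const_mul _ _

/-- Stability of the particle system, relative to copies of the limit system with the same noise. -/
theorem exists_forall_norm_sub_add_dist_empirical_le (hT : 0 ≤ T) (hk : k.IsLipschitz)
    (hU : IsCompact U) (hM : 0 < M) (L : ℝ≥0) (Y₀ : Fin m → Euc d) :
    ∃ A : ℝ, 0 ≤ A ∧ ∀ (N : ℕ) [NeZero N] (c c' : Controls m T U M L) (v : Fin N → ℝ → Euc d)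
      (x x' : ℝ → Fin N → Euc d) (y y' : ℝ → Fin m → Euc d) (μ : ℝ → W1 d) (r δ : ℝ),
      0 ≤ r → 0 ≤ δ →
      ContinuousOn x (Set.Icc 0 T) → ContinuousOn x' (Set.Icc 0 T) →
      ContinuousOn y (Set.Icc 0 T) → ContinuousOn y' (Set.Icc 0 T) → ContinuousOn μ (Set.Icc 0 T) →
      (∀ t ∈ Set.Icc 0 T, ∀ n, x t n = v n t +
        ∫ s in (0 : ℝ)..t, k.driftX (W1.empirical (x s)) (y s) (x s n)) →
      (∀ t ∈ Set.Icc 0 T, ∀ n, x' t n = v n t +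
        ∫ s in (0 : ℝ)..t, k.driftX (μ s) (y' s) (x' s n)) →
      (∀ t ∈ Set.Icc 0 T, y t = Y₀ +
        ∫ s in (0 : ℝ)..t, leaderVelocity k c (fun s => W1.empirical (x s)) y s) →
      (∀ t ∈ Set.Icc 0 T, y' t = Y₀ + ∫ s in (0 : ℝ)..t, leaderVelocity k c' μ y' s) →
      (∀ t ∈ Set.Icc 0 T, dist (W1.empirical (x' t)) (μ t) ≤ r) →
      (∀ t ∈ Set.Icc 0 T, ‖(∫ s in (0 : ℝ)..t, c.u s (μ s)) - ∫ s in (0 : ℝ)..t, c'.u s (μ s)‖ ≤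
        δ) →
      ∀ t ∈ Set.Icc 0 T, ‖y t - y' t‖ + dist (W1.empirical (x t)) (μ t) ≤ A * (r + δ) := by
  have hk' := hk
  obtain ⟨C, h1, h2, h3, h4⟩ := hk'
  obtain ⟨R, hR⟩ := hU.isBounded.exists_norm_le
  have hR' : ∀ a ∈ U, ‖a‖ ≤ |R| := fun a ha => (hR a ha).trans (le_abs_self R)
  set Q : ℝ := 9 * C + (6 * C + |R| * L) with hQ
  have hQ0 : 0 ≤ Q := by positivity
  refine ⟨(Q * T + 1) * Real.exp (Q * T) + 1, by positivity, fun N _ c c' v x x' y y' μ r δ hr hδ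
    hxc hxc' hyc hyc' hμc hx hx' hy hy' hμr hcδ => ?_⟩
  have hN : (0 : ℝ) < N := Nat.cast_pos.2 (NeZero.pos N)
  have hμc' : ContinuousOn (fun s => W1.empirical (x s)) (Set.Icc 0 T) :=
    W1.continuous_empirical.comp_continuousOn hxc
  set e : ℝ → ℝ := fun s => (N : ℝ)⁻¹ * ∑ n, ‖x s n - x' s n‖ + ‖y s - y' s‖ with he
  have hec : ContinuousOn e (Set.Icc 0 T) :=
    (continuousOn_const.mul (continuousOn_finsetSum _ fun n _ =>
      (((continuous_apply n).comp_continuousOn hxc).sub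
        ((continuous_apply n).comp_continuousOn hxc')).norm)).add (hyc.sub hyc').norm
  have hei : IntervalIntegrable e volume 0 T := by
    refine ContinuousOn.intervalIntegrable ?_
    rwa [Set.uIcc_of_le hT]
  have hbi : IntervalIntegrable (fun s => e s + r) volume 0 T :=
    hei.add intervalIntegrable_const
  have ha0 (s : ℝ) : 0 ≤ (N : ℝ)⁻¹ * ∑ n, ‖x s n - x' s n‖ :=
    mul_nonneg (by positivity) (Finset.sum_nonneg fun n _ => norm_nonneg _)
  have hxb : ∀ s ∈ Set.Icc 0 T, (N : ℝ)⁻¹ * ∑ n, ‖x s n - x' s n‖ ≤ e s + r := fun s _ => by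
    have := norm_nonneg (y s - y' s)
    simp only [he]; linarith
  have hyb : ∀ s ∈ Set.Icc 0 T, ‖y s - y' s‖ ≤ e s + r := fun s _ => by
    have := ha0 s
    simp only [he]; linarith
  have hμb' : ∀ s ∈ Set.Icc 0 T, dist (W1.empirical (x s)) (μ s) ≤
      (N : ℝ)⁻¹ * ∑ n, ‖x s n - x' s n‖ + r := fun s hs =>
    (dist_triangle _ _ _).trans (add_le_add (W1.dist_empirical_le _ _) (hμr s hs))
  have hμb : ∀ s ∈ Set.Icc 0 T, dist (W1.empirical (x s)) (μ s) ≤ e s + r := fun s hs => by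
    have := norm_nonneg (y s - y' s)
    have := hμb' s hs
    simp only [he]; linarith
  have hu {c : Controls m T U M L} : IntervalIntegrable (fun s => c.u s (μ s)) volume 0 T := by
    have h := (intervalIntegrable_leaderVelocity hT hk hU hM c hμc hyc')
    have h' : IntervalIntegrable (fun s => k.driftY (μ s) (y' s)) volume 0 T := by
      refine ContinuousOn.intervalIntegrable ?_
      rw [Set.uIcc_of_le hT]
      exact (Kernels.continuous_driftY hk).comp_continuousOn (hμc.prodMk hyc')
    refine (h.sub h').congr fun s _ => ?_
    simp [leaderVelocity]
  have hmain : ∀ t ∈ Set.Icc 0 T, e t ≤ (Q * T * r + δ) + Q * ∫ s in (0 : ℝ)..t, e s := by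
    intro t ht
    have hX := average_norm_sub_le h1 h2 h3 h4 hxc hxc' hyc hyc' hμc' hμc hx hx' hbi hxb hyb hμb
      ht
    have hY := norm_integral_leaderVelocity_sub_le hT h1 h2 h3 h4 hU (abs_nonneg R) hR' hM c hμc'
      hyc hμc hyc' hbi hμb hyb ht
    have hlv : (∫ s in (0 : ℝ)..t, leaderVelocity k c μ y' s) -
        (∫ s in (0 : ℝ)..t, leaderVelocity k c' μ y' s) =
        (∫ s in (0 : ℝ)..t, c.u s (μ s)) - ∫ s in (0 : ℝ)..t, c'.u s (μ s) := by
      have hi (c : Controls m T U M L) := intervalIntegrable_zero_of_mem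
        (intervalIntegrable_leaderVelocity hT hk hU hM c hμc hyc') ht
      rw [← intervalIntegral.integral_sub (hi c) (hi c'), ← intervalIntegral.integral_sub
        (intervalIntegrable_zero_of_mem hu ht) (intervalIntegrable_zero_of_mem hu ht)]
      simp [leaderVelocity]
    have hy2 : ‖y t - y' t‖ ≤ (6 * C + |R| * L) * (∫ s in (0 : ℝ)..t, (e s + r)) + δ := by
      rw [hy t ht, hy' t ht, add_sub_add_left_eq_sub,
        ← sub_add_sub_cancel _ (∫ s in (0 : ℝ)..t, leaderVelocity k c μ y' s), hlv]
      exact (norm_add_le _ _).trans (add_le_add hY (hcδ t ht))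
    have hint : ∫ s in (0 : ℝ)..t, (e s + r) = (∫ s in (0 : ℝ)..t, e s) + t * r := by
      rw [intervalIntegral.integral_add (intervalIntegrable_zero_of_mem hei ht)
        intervalIntegrable_const]
      simp
    have htr : Q * (t * r) ≤ Q * (T * r) := by
      have := ht.2
      gcongr
    calc e t ≤ 9 * C * (∫ s in (0 : ℝ)..t, (e s + r)) +
          ((6 * C + |R| * L) * (∫ s in (0 : ℝ)..t, (e s + r)) + δ) := add_le_add hX hy2
      _ = Q * ((∫ s in (0 : ℝ)..t, e s) + t * r) + δ := by rw [hint, hQ]; ring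
      _ ≤ _ := by linarith
  intro t ht
  have h5 := gronwall_integral hQ0 hec hmain t ht
  have h6 : (Q * T * r + δ) * Real.exp (Q * t) ≤ ((Q * T + 1) * (r + δ)) * Real.exp (Q * T) := by
    have := ht.2
    have h7 : Q * T * r + δ ≤ (Q * T + 1) * (r + δ) := by
      have : 0 ≤ Q * T * δ := by positivity
      linarith
    gcongr
  have h8 := hμb' t ht
  have h9 : e t = (N : ℝ)⁻¹ * ∑ n, ‖x t n - x' t n‖ + ‖y t - y' t‖ := rfl
  calc ‖y t - y' t‖ + dist (W1.empirical (x t)) (μ t) ≤ e t + r := by linarith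
    _ ≤ (Q * T + 1) * (r + δ) * Real.exp (Q * T) + (r + δ) := by linarith
    _ = _ := by ring

end Comparison

/-! ### Weak lower semicontinuity of convex integral functionals -/

section Convex

variable {α E : Type*} [MeasurableSpace α] {ν : Measure α} [NormedAddCommGroup E] {m : ℕ} {Φ : α → (Fin m → E) → ℝ} {R Q : ℝ}

/-- The `R`-bounded integrable functions with a value at most `a` of the integral of `Φ`. -/
def boundedSublevel (ν : Measure α) (Φ : α → (Fin m → E) → ℝ) (R a : ℝ) :
    Set (Fin m → Lp E 1 ν) :=
  {v | (∀ᵐ t ∂ν, ‖fun i => v i t‖ ≤ R) ∧ ∫ t, Φ t (fun i => v i t) ∂ν ≤ a}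

theorem aestronglyMeasurable_pi_Lp (v : Fin m → Lp E 1 ν) :
    AEStronglyMeasurable (fun t i => v i t) ν := by
  have h : (fun t i => v i t) = fun t => ∑ i, Pi.single i (v i t) :=
    funext fun t => (Finset.univ_sum_single _).symm
  rw [h]
  exact Finset.aestronglyMeasurable_fun_sum _ fun i _ =>
    (continuous_single i).comp_aestronglyMeasurable (Lp.stronglyMeasurable (v i)).aestronglyMeasurable

theorem exists_subseq_tendsto_ae {v : ℕ → Fin m → Lp E 1 ν} {w : Fin m → Lp E 1 ν}
    (h : Tendsto v atTop (𝓝 w)) : ∃ ns : ℕ → ℕ, StrictMono ns ∧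
      ∀ᵐ t ∂ν, Tendsto (fun n => fun i => v (ns n) i t) atTop (𝓝 fun i => w i t) := by
  refine (tendstoInMeasure_of_tendsto_eLpNorm one_ne_zero
    (fun n => aestronglyMeasurable_pi_Lp (v n)) (aestronglyMeasurable_pi_Lp w)
    ?_).exists_seq_tendsto_ae
  have h1 : Tendsto (fun n => ∑ i, eLpNorm (⇑(v n i) - ⇑(w i)) 1 ν) atTop (𝓝 0) := by
    have h2 (i : Fin m) := (Lp.tendsto_Lp_iff_tendsto_eLpNorm' (fun n => v n i) (w i)).1
      (tendsto_pi_nhds.1 h i)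
    simpa using tendsto_finsetSum Finset.univ fun i _ => h2 i
  refine tendsto_of_tendsto_of_tendsto_of_le_of_le tendsto_const_nhds h1 (fun _ => zero_le)
    fun n => ?_
  simp only [eLpNorm_one_eq_lintegral_enorm]
  rw [← lintegral_finsetSum' _ fun i _ =>
    ((Lp.stronglyMeasurable (v n i)).sub (Lp.stronglyMeasurable (w i))).enorm.aemeasurable]
  refine lintegral_mono fun t => ?_
  simp only [Pi.sub_apply, enorm_eq_nnnorm]
  rw [← ENNReal.ofNNReal_finsetSum, ENNReal.coe_le_coe, pi_nnnorm_le_iff]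
  exact fun i => Finset.single_le_sum (f := fun i => ‖v n i t - w i t‖₊) (fun _ _ => zero_le)
    (Finset.mem_univ i)

variable [IsFiniteMeasure ν]

theorem integrable_comp_of_bounded
    (hm : ∀ f, AEStronglyMeasurable f ν → AEStronglyMeasurable (fun t => Φ t (f t)) ν)
    (hQ : ∀ᵐ t ∂ν, ∀ a, ‖a‖ ≤ R → |Φ t a| ≤ Q) {f : α → Fin m → E}
    (hf : AEStronglyMeasurable f ν) (hR : ∀ᵐ t ∂ν, ‖f t‖ ≤ R) :
    Integrable (fun t => Φ t (f t)) ν := by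
  refine Integrable.of_bound (hm f hf) Q ?_
  filter_upwards [hQ, hR] with t h1 h2
  exact h1 _ h2

theorem isClosed_boundedSublevel
    (hm : ∀ f, AEStronglyMeasurable f ν → AEStronglyMeasurable (fun t => Φ t (f t)) ν)
    (hc : ∀ t, Continuous (Φ t)) (hQ : ∀ᵐ t ∂ν, ∀ a, ‖a‖ ≤ R → |Φ t a| ≤ Q) (a : ℝ) :
    IsClosed (boundedSublevel ν Φ R a) := by
  refine IsSeqClosed.isClosed fun v w hv hvw => ?_
  obtain ⟨ns, -, hns⟩ := exists_subseq_tendsto_ae hvw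
  have hvR : ∀ᵐ t ∂ν, ∀ n, ‖fun i => v n i t‖ ≤ R := ae_all_iff.2 fun n => (hv n).1
  refine ⟨?_, ?_⟩
  · filter_upwards [hns, hvR] with t h1 h2
    exact le_of_tendsto' h1.norm fun n => h2 (ns n)
  · refine le_of_tendsto' (tendsto_integral_of_dominated_convergence (fun _ => Q)
      (fun n => hm _ (aestronglyMeasurable_pi_Lp (v (ns n)))) (integrable_const Q)
      (fun n => ?_) ?_) fun n => (hv (ns n)).2
    · filter_upwards [hQ, hvR] with t h1 h2
      exact h1 _ (h2 (ns n))
    · filter_upwards [hns] with t ht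
      exact ((hc t).tendsto _).comp ht

variable [NormedSpace ℝ E]

theorem convex_boundedSublevel
    (hm : ∀ f, AEStronglyMeasurable f ν → AEStronglyMeasurable (fun t => Φ t (f t)) ν)
    (hconv : ∀ t, ConvexOn ℝ Set.univ (Φ t))
    (hQ : ∀ᵐ t ∂ν, ∀ a, ‖a‖ ≤ R → |Φ t a| ≤ Q) (a : ℝ) : Convex ℝ (boundedSublevel ν Φ R a) := by
  intro v hv w hw p q hp hq hpq
  have hadd : ∀ᵐ t ∂ν, (fun i => (p • v + q • w) i t) =
      p • (fun i => v i t) + q • fun i => w i t := by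
    have : ∀ᵐ t ∂ν, ∀ i, (p • v + q • w) i t = p • v i t + q • w i t := by
      refine ae_all_iff.2 fun i => ?_
      filter_upwards [Lp.coeFn_add (p • v i) (q • w i), Lp.coeFn_smul p (v i),
        Lp.coeFn_smul q (w i)] with t h1 h2 h3
      rw [Pi.add_apply, Pi.smul_apply, Pi.smul_apply, h1, Pi.add_apply, h2, h3, Pi.smul_apply,
        Pi.smul_apply]
    exact this.mono fun t ht => funext ht
  have hR : ∀ᵐ t ∂ν, ‖fun i => (p • v + q • w) i t‖ ≤ R := by
    filter_upwards [hadd, hv.1, hw.1] with t h1 h2 h3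
    rw [h1]
    refine (norm_add_le _ _).trans ?_
    rw [norm_smul, norm_smul, Real.norm_of_nonneg hp, Real.norm_of_nonneg hq]
    calc p * ‖fun i => v i t‖ + q * ‖fun i => w i t‖ ≤ p * R + q * R := by gcongr
      _ = R := by rw [← add_mul, hpq, one_mul]
  refine ⟨hR, ?_⟩
  have hi {v : Fin m → Lp E 1 ν} (h : ∀ᵐ t ∂ν, ‖fun i => v i t‖ ≤ R) :=
    integrable_comp_of_bounded hm hQ (aestronglyMeasurable_pi_Lp v) h
  calc ∫ t, Φ t (fun i => (p • v + q • w) i t) ∂ν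
      ≤ ∫ t, (p * Φ t (fun i => v i t) + q * Φ t fun i => w i t) ∂ν := by
        refine integral_mono_ae (hi hR) (((hi hv.1).const_mul p).add ((hi hw.1).const_mul q)) ?_
        filter_upwards [hadd] with t ht
        simp only [ht]
        exact (hconv t).2 (Set.mem_univ _) (Set.mem_univ _) hp hq hpq
    _ = p * (∫ t, Φ t (fun i => v i t) ∂ν) + q * ∫ t, Φ t (fun i => w i t) ∂ν := by
        rw [integral_add ((hi hv.1).const_mul p) ((hi hw.1).const_mul q), integral_const_mul,
          integral_const_mul]
    _ ≤ p * a + q * a := by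
        have := hv.2
        have := hw.2
        gcongr
    _ = a := by rw [← add_mul, hpq, one_mul]

/-- Lower semicontinuity along bounded weakly convergent families. -/
theorem eventually_lt_integral_of_weak_tendsto
    (hm : ∀ f, AEStronglyMeasurable f ν → AEStronglyMeasurable (fun t => Φ t (f t)) ν)
    (hc : ∀ t, Continuous (Φ t)) (hconv : ∀ t, ConvexOn ℝ Set.univ (Φ t))
    (hQ : ∀ᵐ t ∂ν, ∀ a, ‖a‖ ≤ R → |Φ t a| ≤ Q) {ι : Type*} {l : Filter ι}
    {v : ι → Fin m → Lp E 1 ν} {w : Fin m → Lp E 1 ν}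
    (hv : ∀ n, ∀ᵐ t ∂ν, ‖fun i => v n i t‖ ≤ R)
    (h : ∀ (i : Fin m) (φ : StrongDual ℝ (Lp E 1 ν)),
      Tendsto (fun n => φ (v n i)) l (𝓝 (φ (w i)))) {a : ℝ}
    (ha : a < ∫ t, Φ t (fun i => w i t) ∂ν) :
    ∀ᶠ n in l, a < ∫ t, Φ t (fun i => v n i t) ∂ν := by
  obtain ⟨φ, u, hφ, hu⟩ := geometric_hahn_banach_closed_point
    (convex_boundedSublevel hm hconv hQ a) (isClosed_boundedSublevel hm hc hQ a)
    (x := w) fun hw => absurd hw.2 ha.not_ge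
  have hsum (v : Fin m → Lp E 1 ν) : φ v =
      ∑ i, (φ.comp (ContinuousLinearMap.single ℝ (fun _ : Fin m => Lp E 1 ν) i)) (v i) := by
    conv_lhs => rw [← Finset.univ_sum_single v, map_sum]
    rfl
  have ht : Tendsto (fun n => φ (v n)) l (𝓝 (φ w)) := by
    simp_rw [hsum]
    exact tendsto_finsetSum _ fun i _ => h i _
  filter_upwards [ht.eventually (lt_mem_nhds hu)] with n hn
  by_contra! hle
  exact (hφ _ ⟨hv n, hle⟩).not_gt hn

end Convex

/-! ### Convergence of controls -/

section ConvergenceOfControls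

variable {d ℓ m : ℕ} {T : ℝ} {U : Set (Mat d ℓ)} {M : ℝ} {L : ℝ≥0} {ι : Type*} {l : Filter ι}
  {c : ι → Controls m T U M L} {c₀ : Controls m T U M L}

theorem Controls.tendsto_dual_apply (h : Tendsto c l (𝓝 c₀)) (i : Fin m)
    (φ : StrongDual ℝ (Lp (Mat d ℓ) 1 ((volume : Measure ℝ).restrict (Set.Icc 0 T)))) :
    Tendsto (fun n => φ (c n i).1.toLp) l (𝓝 (φ (c₀ i).1.toLp)) := by
  have h1 : Tendsto (fun n => (c n i).1) l (𝓝 (c₀ i).1) :=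
    (continuous_fst.tendsto _).comp (tendsto_pi_nhds.1 h i)
  have h2 : Continuous fun a : TimeControl T U => toWeakSpace ℝ _ a.toLp := continuous_induced_dom
  exact ((WeakBilin.eval_continuous (topDualPairing ℝ _).flip φ).comp h2).continuousAt.tendsto.comp
    h1

theorem Controls.eventually_norm_g_sub_le (h : Tendsto c l (𝓝 c₀)) {δ : ℝ} (hδ : 0 < δ) :
    ∀ᶠ n in l, ∀ μ i, ‖(c n).g μ i - c₀.g μ i‖ ≤ δ := by
  have h1 (i : Fin m) : ∀ᶠ n in l, dist (c n i).2.1 (c₀ i).2.1 < δ := by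
    have : Tendsto (fun n => (c n i).2.1) l (𝓝 (c₀ i).2.1) :=
      (continuous_subtype_val.tendsto _).comp
        ((continuous_snd.tendsto _).comp (tendsto_pi_nhds.1 h i))
    exact this.eventually (Metric.ball_mem_nhds _ hδ)
  filter_upwards [eventually_all.2 h1] with n hn μ i
  rw [← dist_eq_norm]
  exact (BoundedContinuousFunction.dist_coe_le_dist μ).trans (hn i).le

theorem exists_continuousLinearMap_integral_apply {b : ℝ → Euc ℓ}
    (hb : ContinuousOn b (Set.Icc 0 T)) (hbM : ∀ t ∈ Set.Icc 0 T, ‖b t‖ ≤ M) {t : ℝ}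
    (ht : t ∈ Set.Icc 0 T) :
    ∃ φ : Lp (Mat d ℓ) 1 ((volume : Measure ℝ).restrict (Set.Icc 0 T)) →L[ℝ] Euc d,
      ∀ f, φ f = ∫ s in (0 : ℝ)..t, f s (b s) := by
  have hbm : AEStronglyMeasurable b (volume.restrict (Set.Icc 0 T)) :=
    hb.aestronglyMeasurable measurableSet_Icc
  have hle (f : Lp (Mat d ℓ) 1 ((volume : Measure ℝ).restrict (Set.Icc 0 T))) :
      ∀ᵐ s ∂(volume : Measure ℝ).restrict (Set.Icc 0 T), ‖f s (b s)‖ ≤ M * ‖f s‖ := by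
    filter_upwards [ae_restrict_mem measurableSet_Icc] with s hs
    rw [mul_comm]
    exact (f s).le_opNorm_of_le (hbM s hs)
  have hi (f : Lp (Mat d ℓ) 1 ((volume : Measure ℝ).restrict (Set.Icc 0 T))) :
      IntegrableOn (fun s => f s (b s)) (Set.Icc 0 T) := by
    refine Integrable.mono' ((L1.integrable_coeFn f).norm.const_mul M) ?_ (hle f)
    exact isBoundedBilinearMap_apply.continuous.comp_aestronglyMeasurable
      ((Lp.stronglyMeasurable f).aestronglyMeasurable.prodMk hbm)
  have hsub : Set.Ioc 0 t ⊆ Set.Icc 0 T :=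
    Set.Ioc_subset_Icc_self.trans (Set.Icc_subset_Icc_right ht.2)
  have hit (f : Lp (Mat d ℓ) 1 ((volume : Measure ℝ).restrict (Set.Icc 0 T))) :
      IntegrableOn (fun s => f s (b s)) (Set.Ioc 0 t) := (hi f).mono_set hsub
  have hae {p : ℝ → Prop} (h : ∀ᵐ s ∂(volume : Measure ℝ).restrict (Set.Icc 0 T), p s) :
      ∀ᵐ s ∂(volume : Measure ℝ).restrict (Set.Ioc 0 t), p s :=
    ae_restrict_of_ae_restrict_of_subset hsub h
  refine ⟨LinearMap.mkContinuous
    { toFun := fun f => ∫ s in (0 : ℝ)..t, f s (b s)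
      map_add' := fun f g => ?_
      map_smul' := fun a f => ?_ } M fun f => ?_, fun f => rfl⟩
  · simp only [intervalIntegral.integral_of_le ht.1]
    rw [← integral_add (hit f) (hit g)]
    refine integral_congr_ae ?_
    filter_upwards [hae (Lp.coeFn_add f g)] with s hs
    exact congrArg (fun A : Mat d ℓ => A (b s)) hs
  · simp only [intervalIntegral.integral_of_le ht.1, RingHom.id_apply]
    rw [← integral_smul]
    refine integral_congr_ae ?_
    filter_upwards [hae (Lp.coeFn_smul a f)] with s hs
    exact congrArg (fun A : Mat d ℓ => A (b s)) hs
  · simp only [LinearMap.coe_mk, AddHom.coe_mk, intervalIntegral.integral_of_le ht.1]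
    calc ‖∫ s in Set.Ioc 0 t, f s (b s)‖ ≤ ∫ s in Set.Ioc 0 t, ‖f s (b s)‖ :=
          norm_integral_le_integral_norm _
      _ ≤ ∫ s in Set.Icc 0 T, ‖f s (b s)‖ := setIntegral_mono_set (hi f).norm
          (Eventually.of_forall fun _ => norm_nonneg _) hsub.eventuallyLE
      _ ≤ ∫ s in Set.Icc 0 T, M * ‖f s‖ :=
          integral_mono_ae (hi f).norm ((L1.integrable_coeFn f).norm.const_mul M) (hle f)
      _ = M * ‖f‖ := by rw [integral_const_mul, L1.norm_eq_integral_norm]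

theorem Controls.tendsto_integral_h_apply (h : Tendsto c l (𝓝 c₀)) {i : Fin m}
    {b : ℝ → Euc ℓ} (hb : ContinuousOn b (Set.Icc 0 T)) (hbM : ∀ t ∈ Set.Icc 0 T, ‖b t‖ ≤ M)
    {t : ℝ} (ht : t ∈ Set.Icc 0 T) :
    Tendsto (fun n => ∫ s in (0 : ℝ)..t, (c n).h s i (b s)) l
      (𝓝 (∫ s in (0 : ℝ)..t, c₀.h s i (b s))) := by
  obtain ⟨φ, hφ⟩ := exists_continuousLinearMap_integral_apply (d := d) hb hbM ht
  simp only [Controls.h, ← hφ]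
  rw [(EuclideanSpace.equiv (Fin d) ℝ).toHomeomorph.isInducing.tendsto_nhds_iff, tendsto_pi_nhds]
  exact fun j => Controls.tendsto_dual_apply h i ((EuclideanSpace.proj j).comp φ)

theorem aestronglyMeasurable_h_apply (c : Controls m T U M L) {b : ℝ → Fin m → Euc ℓ}
    (hb : ContinuousOn b (Set.Icc 0 T)) :
    AEStronglyMeasurable (fun s i => c.h s i (b s i)) (volume.restrict (Set.Icc 0 T)) := by
  have hcont : Continuous fun (z : (Fin m → Mat d ℓ) × (Fin m → Euc ℓ)) i => z.1 i (z.2 i) := by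
    fun_prop
  exact hcont.comp_aestronglyMeasurable
    (c.measurable_h.aestronglyMeasurable.prodMk (hb.aestronglyMeasurable measurableSet_Icc))

theorem ae_norm_h_apply_le {R K : ℝ} (hR0 : 0 ≤ R) (hR : ∀ a ∈ U, ‖a‖ ≤ R) (hK : 0 ≤ K)
    (c : Controls m T U M L) {b : ℝ → Fin m → Euc ℓ} (hbK : ∀ t ∈ Set.Icc 0 T, ∀ i, ‖b t i‖ ≤ K) :
    ∀ᵐ s ∂(volume : Measure ℝ).restrict (Set.Icc 0 T), ‖fun i => c.h s i (b s i)‖ ≤ R * K := by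
  filter_upwards [c.ae_norm_h_le hR, ae_restrict_mem measurableSet_Icc] with s hs hsT
  rw [pi_norm_le_iff_of_nonneg (by positivity)]
  exact fun i => ((c.h s i).le_opNorm _).trans (mul_le_mul (hs i) (hbK s hsT i) (norm_nonneg _) hR0)

theorem intervalIntegrable_h_apply (hT : 0 ≤ T) {R K : ℝ} (hR0 : 0 ≤ R) (hR : ∀ a ∈ U, ‖a‖ ≤ R)
    (hK : 0 ≤ K) (c : Controls m T U M L) {b : ℝ → Fin m → Euc ℓ}
    (hb : ContinuousOn b (Set.Icc 0 T)) (hbK : ∀ t ∈ Set.Icc 0 T, ∀ i, ‖b t i‖ ≤ K) :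
    IntervalIntegrable (fun s i => c.h s i (b s i)) volume 0 T := by
  rw [intervalIntegrable_iff_integrableOn_Icc_of_le hT]
  exact (integrable_const (R * K)).mono' (aestronglyMeasurable_h_apply c hb)
    (ae_norm_h_apply_le hR0 hR hK c hbK)

theorem norm_integral_h_apply_le {R K : ℝ} (hR0 : 0 ≤ R) (hR : ∀ a ∈ U, ‖a‖ ≤ R)
    (hK : 0 ≤ K) (c : Controls m T U M L) {b : ℝ → Fin m → Euc ℓ}
    (hbK : ∀ t ∈ Set.Icc 0 T, ∀ i, ‖b t i‖ ≤ K) {s t : ℝ} (hs : s ∈ Set.Icc 0 T)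
    (ht : t ∈ Set.Icc 0 T) :
    ‖∫ r in s..t, fun i => c.h r i (b r i)‖ ≤ R * K * |t - s| := by
  refine intervalIntegral.norm_integral_le_of_norm_le_const_ae ?_
  have h := (ae_restrict_iff' measurableSet_Icc).1 (ae_norm_h_apply_le hR0 hR hK c hbK)
  filter_upwards [h] with r hr hrm
  exact hr (Set.uIcc_subset_Icc hs ht (Set.uIoc_subset_uIcc hrm))

/-- Weak convergence of the time-dependent factors gives uniform convergence of the primitives of
the controls. -/
theorem Controls.eventually_norm_integral_h_apply_sub_le (hT : 0 ≤ T) (hU : IsCompact U)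
    (hM : 0 < M) (h : Tendsto c l (𝓝 c₀)) {b : ℝ → Fin m → Euc ℓ}
    (hb : ContinuousOn b (Set.Icc 0 T)) (hbM : ∀ t ∈ Set.Icc 0 T, ∀ i, ‖b t i‖ ≤ M) {δ : ℝ}
    (hδ : 0 < δ) :
    ∀ᶠ n in l, ∀ t ∈ Set.Icc 0 T, ‖(∫ s in (0 : ℝ)..t, fun i => (c n).h s i (b s i)) -
      ∫ s in (0 : ℝ)..t, fun i => c₀.h s i (b s i)‖ ≤ δ := by
  obtain ⟨R, hR⟩ := hU.isBounded.exists_norm_le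
  have hR' : ∀ a ∈ U, ‖a‖ ≤ |R| := fun a ha => (hR a ha).trans (le_abs_self R)
  have h0 : (0 : ℝ) ∈ Set.Icc 0 T := ⟨le_rfl, hT⟩
  have hi (c : Controls m T U M L) :=
    intervalIntegrable_h_apply hT (abs_nonneg R) hR' hM.le c hb hbM
  set F : Controls m T U M L → Set.Icc 0 T → Fin m → Euc d :=
    fun c t => ∫ s in (0 : ℝ)..t, fun i => c.h s i (b s i) with hF
  have hlip (c : Controls m T U M L) : LipschitzWith (|R| * M).toNNReal (F c) := by
    refine LipschitzWith.of_dist_le_mul fun s t => ?_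
    rw [Real.coe_toNNReal _ (by positivity), dist_comm s, dist_comm, dist_eq_norm, hF,
      intervalIntegral.integral_interval_sub_left (intervalIntegrable_zero_of_mem (hi c) t.2)
        (intervalIntegrable_zero_of_mem (hi c) s.2), Subtype.dist_eq, Real.dist_eq]
    exact norm_integral_h_apply_le (abs_nonneg R) hR' hM.le c hbM s.2 t.2
  have hpt : Tendsto (fun n => F (c n)) l (𝓝 (F c₀)) := by
    refine tendsto_pi_nhds.2 fun t => tendsto_pi_nhds.2 fun i => ?_
    have := Controls.tendsto_integral_h_apply h (i := i) ((continuous_apply i).comp_continuousOn hb)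
      (fun s hs => hbM s hs i) t.2
    simp only [hF]
    simpa only [intervalIntegral_apply (intervalIntegrable_zero_of_mem (hi _) t.2) i,
      Function.comp_apply] using this
  have hun := ((LipschitzWith.uniformEquicontinuous (fun n => F (c n)) _ fun n =>
    hlip (c n)).equicontinuous.tendsto_uniformFun_iff_pi l (F c₀)).2 hpt
  rw [UniformFun.tendsto_iff_tendstoUniformly, Metric.tendstoUniformly_iff] at hun
  filter_upwards [hun δ hδ] with n hn t ht
  have := (hn ⟨t, ht⟩).le
  rw [dist_comm, dist_eq_norm] at this
  exact this

theorem Controls.eventually_norm_integral_u_sub_le (hT : 0 ≤ T) (hU : IsCompact U)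
    (hM : 0 < M) (h : Tendsto c l (𝓝 c₀)) {μ : ℝ → W1 d} (hμ : ContinuousOn μ (Set.Icc 0 T))
    {δ : ℝ} (hδ : 0 < δ) :
    ∀ᶠ n in l, ∀ t ∈ Set.Icc 0 T, ‖(∫ s in (0 : ℝ)..t, (c n).u s (μ s)) -
      ∫ s in (0 : ℝ)..t, c₀.u s (μ s)‖ ≤ δ := by
  obtain ⟨R, hR⟩ := hU.isBounded.exists_norm_le
  have hR' : ∀ a ∈ U, ‖a‖ ≤ |R| := fun a ha => (hR a ha).trans (le_abs_self R)
  have hgc (c : Controls m T U M L) : ContinuousOn (fun s => c.g (μ s)) (Set.Icc 0 T) :=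
    c.continuous_g.comp_continuousOn hμ
  set η : ℝ := δ / (2 * (|R| * T + 1)) with hη
  have hη0 : 0 < η := by positivity
  filter_upwards [Controls.eventually_norm_g_sub_le h hη0,
    Controls.eventually_norm_integral_h_apply_sub_le hT hU hM h (hgc c₀)
      (fun s _ i => c₀.norm_g_le _ i) (half_pos hδ)] with n hn hn' t ht
  have e1 : (∫ s in (0 : ℝ)..t, (c n).u s (μ s)) -
      (∫ s in (0 : ℝ)..t, fun i => (c n).h s i (c₀.g (μ s) i)) =
      ∫ s in (0 : ℝ)..t, fun i => (c n).h s i (((c n).g (μ s) - c₀.g (μ s)) i) := by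
    have hi : IntervalIntegrable (fun s => (c n).u s (μ s)) volume 0 t :=
      intervalIntegrable_zero_of_mem (intervalIntegrable_h_apply hT (abs_nonneg R) hR' hM.le (c n)
        (hgc (c n)) fun s _ i => (c n).norm_g_le _ i) ht
    rw [← intervalIntegral.integral_sub hi
      (intervalIntegrable_zero_of_mem (intervalIntegrable_h_apply hT (abs_nonneg R) hR' hM.le (c n)
        (hgc c₀) fun s _ i => c₀.norm_g_le _ i) ht)]
    refine intervalIntegral.integral_congr fun s _ => funext fun i => ?_
    simp [Controls.u, map_sub]
  have e2 := norm_integral_h_apply_le (abs_nonneg R) hR' hη0.le (c n)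
    (b := fun s => (c n).g (μ s) - c₀.g (μ s)) (fun s _ i => hn (μ s) i) ⟨le_rfl, hT⟩ ht
  rw [← e1, sub_zero, abs_of_nonneg ht.1] at e2
  have e3 : |R| * η * t ≤ δ / 2 := by
    have h1 : |R| * η * t ≤ |R| * η * T := by
      have := ht.2
      gcongr
    have h2 : (|R| * T + 1) * η = δ / 2 := by
      rw [hη]; field_simp
    linarith
  have e4 : ‖(∫ s in (0 : ℝ)..t, fun i => (c n).h s i (c₀.g (μ s) i)) -
      ∫ s in (0 : ℝ)..t, c₀.u s (μ s)‖ ≤ δ / 2 := hn' t ht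
  rw [← sub_add_sub_cancel _ (∫ s in (0 : ℝ)..t, fun i => (c n).h s i (c₀.g (μ s) i))]
  exact (norm_add_le _ _).trans (by linarith)

variable {Ψ : (Fin m → Mat d ℓ) → (Fin m → Euc ℓ) → ℝ}

/-- Lower semicontinuity of the cost of the controls with respect to the time-dependent factors. -/
theorem Controls.eventually_lt_integral_controlCost (hT : 0 ≤ T) (hU : IsCompact U)
    (hΨ : Continuous fun z : (Fin m → Mat d ℓ) × (Fin m → Euc ℓ) => Ψ z.1 z.2)
    (hΨconv : ∀ b, ConvexOn ℝ Set.univ fun a => Ψ a b) (h : Tendsto c l (𝓝 c₀))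
    {b : ℝ → Fin m → Euc ℓ} (hb : ContinuousOn b (Set.Icc 0 T))
    (hbM : ∀ t ∈ Set.Icc 0 T, ∀ i, ‖b t i‖ ≤ M) {a : ℝ}
    (ha : a < ∫ t in (0 : ℝ)..T, Ψ (c₀.h t) (b t)) :
    ∀ᶠ n in l, a < ∫ t in (0 : ℝ)..T, Ψ ((c n).h t) (b t) := by
  obtain ⟨R, hR⟩ := hU.isBounded.exists_norm_le
  have hR' : ∀ a ∈ U, ‖a‖ ≤ |R| := fun a ha => (hR a ha).trans (le_abs_self R)
  obtain ⟨Q, hQ⟩ := (isCompact_controlValues (m := m)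
    (isCompact_closedBall (0 : Mat d ℓ) |R|) M).exists_bound_of_continuousOn hΨ.continuousOn
  simp only [intervalIntegral.integral_of_le hT, ← integral_Icc_eq_integral_Ioc] at ha ⊢
  refine eventually_lt_integral_of_weak_tendsto (Φ := fun t a => Ψ a (b t)) (R := |R|) (Q := Q)
    (v := fun n i => (c n i).1.toLp) (w := fun i => (c₀ i).1.toLp) (fun f hf => ?_) (fun t => ?_)
    (fun t => hΨconv (b t)) ?_ (fun n => ?_) (fun i φ => Controls.tendsto_dual_apply h i φ) ha
  · exact hΨ.comp_aestronglyMeasurable (hf.prodMk (hb.aestronglyMeasurable measurableSet_Icc))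
  · exact hΨ.comp (continuous_id.prodMk continuous_const)
  · filter_upwards [ae_restrict_mem measurableSet_Icc] with t ht a ha
    refine hQ (a, b t) ⟨fun i => ?_, hbM t ht⟩
    rw [mem_closedBall_zero_iff]
    exact (norm_le_pi_norm a i).trans ha
  · filter_upwards [(c n).ae_norm_h_le hR'] with t ht
    rw [pi_norm_le_iff_of_nonneg (abs_nonneg R)]
    exact ht

end ConvergenceOfControls

theorem gammaConverges_of_eventually_lt {𝓧 : Type*} [TopologicalSpace 𝓧] {F : ℕ → 𝓧 → ℝ}
    {F' : 𝓧 → ℝ} (h : ∀ x (x' : ℕ → 𝓧), Tendsto x' atTop (𝓝 x) → ∀ a < F' x,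
      ∀ᶠ n in atTop, a < F n (x' n))
    (h' : ∀ x, Tendsto (fun n => F n x) atTop (𝓝 (F' x))) : GammaConverges F F' := by
  refine fun x => ⟨fun x' hx' => ?_, fun _ => x, tendsto_const_nhds, ?_⟩
  · refine EReal.ge_of_forall_gt_iff_ge.1 fun a ha => ?_
    refine le_liminf_of_le (by isBoundedDefault) ?_
    filter_upwards [h x x' hx' a (EReal.coe_lt_coe_iff.1 ha)] with n hn
    exact EReal.coe_le_coe_iff.2 hn.le
  · exact ((continuous_coe_real_ereal.tendsto _).comp (h' x)).limsup_eq.le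

/-! ### Convergence of the costs -/

section CostConvergence

variable {Ω : Type*} [MeasurableSpace Ω] {P : Measure Ω} [IsProbabilityMeasure P] {d ℓ m : ℕ}
  {T σ : ℝ} {U : Set (Mat d ℓ)} {M : ℝ} {L : ℝ≥0} {k : Kernels d} {Y₀ : Fin m → Euc d}

/-- A random path that solves the McKean-Vlasov equation is, together with the copies driven by
other noises of the same law, a measurable function of the noise. -/
theorem IsMeanFieldPath.exists_copies {c : Controls m T U M L} {w' : Ω → C(Set.Icc 0 T, Euc d)}
    (hT : 0 ≤ T) (hk : k.IsLipschitz) {V : Ω → C(Set.Icc 0 T, Euc d)} {hV : Integrable V P}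
    {y : C(Set.Icc 0 T, Fin m → Euc d)} (h : IsMeanFieldPath P k Y₀ c hT w' V hV y)
    (hw' : Measurable w') {w : ℕ → Ω → C(Set.Icc 0 T, Euc d)} (hw : ∀ n, Measurable (w n))
    (hmap : ∀ n, P.map (w n) = P.map w') (hind : iIndepFun w P) :
    ∃ X : ℕ → Ω → C(Set.Icc 0 T, Euc d), (∀ n, IdentDistrib (X n) V P P) ∧ iIndepFun X P ∧
      ∀ n ω, ∀ t ∈ Set.Icc 0 T, extendPath hT (X n ω) t = extendPath hT (w n ω) t +
        ∫ s in (0 : ℝ)..t, k.driftX (marginals P hT V hV s) (extendPath hT y s)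
          (extendPath hT (X n ω) s) := by
  obtain ⟨C, h1, h2, h3, h4⟩ := hk
  obtain ⟨K, hf⟩ := isCaratheodoryField_driftX h1 h2 h3 h4
    ((continuous_marginals hT hV).continuousOn (s := Set.Icc 0 T))
    ((continuous_extendPath hT y).continuousOn (s := Set.Icc 0 T))
  have hC : (0 : ℝ) ≤ 3 * C := by positivity
  have hSm : Measurable (hf.solution hT hC) := (hf.continuous_solution hT hC).measurable
  have hVw : (fun ω => hf.solution hT hC (w' ω)) =ᵐ[P] V := by
    filter_upwards [h.1] with ω hω
    ext1 t
    have := hf.eq_solution hT hC (w' ω) (continuous_extendPath hT (V ω)).continuousOn hω t t.2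
    rw [extendPath_of_mem hT _ t.2, extendPath_of_mem hT _ t.2] at this
    exact this.symm
  refine ⟨fun n ω => hf.solution hT hC (w n ω), fun n => ?_, hind.comp _ fun _ => hSm,
    fun n ω t ht => hf.solution_eq hT hC (w n ω) ht⟩
  have hid : IdentDistrib (w n) w' P P := ⟨(hw n).aemeasurable, hw'.aemeasurable, hmap n⟩
  exact (hid.comp hSm).trans (IdentDistrib.of_ae_eq (hSm.comp hw').aemeasurable hVw)

variable {𝓛 : ℝ → (Fin m → Euc d) → W1 d → ℝ} {Ψ : (Fin m → Mat d ℓ) → (Fin m → Euc ℓ) → ℝ}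
  {ξ : ℕ → Ω → Euc d} {B : ℕ → ℝ≥0 → Ω → Euc d} {w : ℕ → Ω → C(Set.Icc 0 T, Euc d)}
  {ξ' : Ω → Euc d} {B' : ℝ≥0 → Ω → Euc d} {w' : Ω → C(Set.Icc 0 T, Euc d)}

/-- The integral equations of the particle system, in terms of the empirical measure. -/
theorem IsParticleSolution.ae_integral_eq {N : ℕ} [NeZero N] {c : Controls m T U M L}
    {ξ : Fin N → Ω → Euc d} {B : Fin N → ℝ≥0 → Ω → Euc d} {w : Fin N → Ω → C(Set.Icc 0 T, Euc d)}
    {X : Fin N → ℝ → Ω → Euc d} {Y : Fin m → ℝ → Ω → Euc d}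
    (h : IsParticleSolution P k σ Y₀ c ξ B X Y) (hT : 0 ≤ T) (hk : k.IsLipschitz)
    (hU : IsCompact U) (hM : 0 < M) (hw : ∀ n, IsNoisePath P σ (ξ n) (B n) (w n)) :
    ∀ᵐ ω ∂P, ∀ t ∈ Set.Icc 0 T,
      (∀ n, X n t ω = extendPath hT (w n ω) t + ∫ s in (0 : ℝ)..t,
        k.driftX (W1.empirical fun l => X l s ω) (fun i => Y i s ω) (X n s ω)) ∧
      (fun i => Y i t ω) = Y₀ + ∫ s in (0 : ℝ)..t, leaderVelocity k c
        (fun s => W1.empirical fun l => X l s ω) (fun s i => Y i s ω) s := by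
  filter_upwards [h.eq_X, h.eq_Y, ae_all_iff.2 fun n => (hw n).ae_eq] with ω h1 h2 h3 t ht
  have hi := intervalIntegrable_zero_of_mem (intervalIntegrable_leaderVelocity hT hk hU hM c
    (W1.continuous_empirical.comp_continuousOn (continuousOn_pi.2 fun n => h.continuous_X n ω))
    (continuousOn_pi.2 fun i => h.continuous_Y i ω)) ht
  refine ⟨fun n => ?_, funext fun i => ?_⟩
  · refine ((h1 n).2 t ht).trans ?_
    rw [extendPath_of_mem hT _ ht, h3 n ⟨t, ht⟩]
    simp only [Kernels.particleDriftX_eq]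
    abel
  · refine ((h2 i).2 t ht).trans ?_
    rw [Pi.zero_apply, add_zero, Pi.add_apply]
    simp only [Kernels.particleDriftY_eq]
    congr 1
    exact (intervalIntegral_apply hi i).symm

/-- Along convergent controls, the expected costs of the particle systems are close to those of the
limit dynamics. -/
theorem IsMeanFieldSolution.eventually_abs_integral_particlePathCost_sub_le
    {c₀ : Controls m T U M L} {X : ℝ → Ω → Euc d} {Y : Fin m → ℝ → Euc d} {μ : ℝ → W1 d}
    (h : IsMeanFieldSolution P k σ Y₀ c₀ ξ' B' X Y μ) (hT : 0 < T) (hk : k.IsLipschitz)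
    (hU : IsCompact U) (hM : 0 < M)
    (h𝓛 : UniformContinuousOn (fun z : ℝ × (Fin m → Euc d) × W1 d => 𝓛 z.1 z.2.1 z.2.2)
      (Set.Icc 0 T ×ˢ Set.univ))
    (hΨ : Continuous fun z : (Fin m → Mat d ℓ) × (Fin m → Euc ℓ) => Ψ z.1 z.2)
    (hw : ∀ n, IsNoisePath P σ (ξ n) (B n) (w n)) (hw' : IsNoisePath P σ ξ' B' w')
    (hwi : ∀ n, Integrable (w n) P) (hmap : ∀ n, P.map (w n) = P.map w') (hind : iIndepFun w P)
    {c : ℕ → Controls m T U M L} (hc : Tendsto c atTop (𝓝 c₀))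
    {x : ∀ N : ℕ, Fin (N + 1) → ℝ → Ω → Euc d} {y : ℕ → Fin m → ℝ → Ω → Euc d}
    (hxy : ∀ N, IsParticleSolution P k σ Y₀ (c N) (fun n : Fin (N + 1) => ξ n) (fun n => B n)
      (x N) (y N)) {ε : ℝ} (hε : 0 < ε) :
    ∀ᶠ N in atTop, |∫ ω, particlePathCost 𝓛 Ψ (c N) (x N) (y N) ω ∂P -
      ((∫ t in (0 : ℝ)..T, 𝓛 t (fun i => Y i t) (μ t)) +
        ∫ t in (0 : ℝ)..T, Ψ ((c N).h t) (c₀.g (μ t)))| ≤ ε := by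
  obtain ⟨V, hV, z, hVm, hVz, -, hzY, hVμ⟩ := h.exists_isMeanFieldPath hT.le hk hU hM hw'
  obtain ⟨X', hX', hX'ind, hX'eq⟩ := hVz.exists_copies hT.le hk hw'.measurable
    (fun n => (hw n).measurable) hmap hind
  obtain ⟨A₁, hA₁, hstab⟩ := exists_forall_norm_sub_add_dist_empirical_le hT.le hk hU hM L Y₀
  obtain ⟨A₂, hA₂, hcost⟩ := abs_pathCost_sub_le hT hU h𝓛 hΨ M L (half_pos hε)
  have hμc := (continuous_marginals hT.le hV).continuousOn (s := Set.Icc 0 T)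
  have hzc := (continuous_extendPath hT.le z).continuousOn (s := Set.Icc 0 T)
  have hYc : ContinuousOn (fun t i => Y i t) (Set.Icc 0 T) :=
    continuousOn_pi.2 h.continuous_Y
  have hμc' : ContinuousOn μ (Set.Icc 0 T) := h.continuousOn_law hT.le hk hU hM hw'
  set η : ℝ := ε / (2 * (A₂ * (2 * A₁ + 1) + 1)) with hη
  have hη0 : 0 < η := by positivity
  filter_upwards [eventually_dist_empirical_marginals_le hT.le hX' hX'ind hVm hV hη0,
    Controls.eventually_norm_g_sub_le hc hη0,
    Controls.eventually_norm_integral_u_sub_le hT.le hU hM hc hμc hη0] with N hR hg hu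
  obtain ⟨R, hRi, hR0, hRη, hRd⟩ := hR
  obtain ⟨C, K, hC, hf⟩ := isCaratheodoryField_particleField hk hU hM m (N + 1) T L
  have hint : Integrable (particlePathCost 𝓛 Ψ (c N) (x N) (y N)) P :=
    (hxy N).integrable_cost hT hC (hf (c N)) (fun n => hw n) (fun n => hwi n) hU h𝓛 hΨ
  set J : ℝ := (∫ t in (0 : ℝ)..T, 𝓛 t (fun i => Y i t) (μ t)) +
    ∫ t in (0 : ℝ)..T, Ψ ((c N).h t) (c₀.g (μ t)) with hJ
  have hbound : ∀ᵐ ω ∂P, ‖particlePathCost 𝓛 Ψ (c N) (x N) (y N) ω - J‖ ≤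
      ε / 2 + A₂ * (A₁ * (R ω + η) + η) := by
    filter_upwards [(hxy N).ae_integral_eq hT.le hk hU hM fun n => hw n] with ω hω
    have hxc : ContinuousOn (fun t n => x N n t ω) (Set.Icc 0 T) :=
      continuousOn_pi.2 fun n => (hxy N).continuous_X n ω
    have hyc : ContinuousOn (fun t i => y N i t ω) (Set.Icc 0 T) :=
      continuousOn_pi.2 fun i => (hxy N).continuous_Y i ω
    have hd := hstab (N + 1) (c N) c₀ (fun n t => extendPath hT.le (w n ω) t)
      (fun t n => x N n t ω) (fun t n => extendPath hT.le (X' n ω) t) (fun t i => y N i t ω)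
      (extendPath hT.le z) (marginals P hT.le V hV) (R ω) η (hR0 ω) hη0.le hxc
      (continuousOn_pi.2 fun n => (continuous_extendPath hT.le _).continuousOn) hyc hzc hμc
      (fun t ht => (hω t ht).1) (fun t ht n => hX'eq n ω t ht) (fun t ht => (hω t ht).2) hVz.2
      (fun t _ => hRd ω t) hu
    have hAR : 0 ≤ A₁ * (R ω + η) := mul_nonneg hA₁ (add_nonneg (hR0 ω) hη0.le)
    refine hcost (c N) c₀ _ _ _ _ hyc hYc (W1.continuous_empirical.comp_continuousOn hxc) hμc' _
      (fun t ht => ?_) fun ν i => (hg ν i).trans (by linarith)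
    rw [← hVμ t ht, ← hzY t ht]
    exact (hd t ht).trans (by linarith)
  have hRi' : Integrable (fun ω => ε / 2 + A₂ * (A₁ * (R ω + η) + η)) P :=
    (integrable_const _).add ((((hRi.add (integrable_const η)).const_mul A₁).add
      (integrable_const η)).const_mul A₂)
  have hlin : ∫ ω, (ε / 2 + A₂ * (A₁ * (R ω + η) + η)) ∂P =
      ε / 2 + A₂ * (A₁ * ((∫ ω, R ω ∂P) + η) + η) := by
    have h1 : (fun ω => ε / 2 + A₂ * (A₁ * (R ω + η) + η)) =
        fun ω => (ε / 2 + A₂ * (A₁ * η + η)) + (A₂ * A₁) * R ω := by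
      ext ω; ring
    rw [h1, integral_add (integrable_const _) (hRi.const_mul _), integral_const_mul]
    simp only [integral_const, probReal_univ, smul_eq_mul, one_mul]
    ring
  have hsub : ∫ ω, particlePathCost 𝓛 Ψ (c N) (x N) (y N) ω ∂P - J =
      ∫ ω, (particlePathCost 𝓛 Ψ (c N) (x N) (y N) ω - J) ∂P := by
    rw [integral_sub hint (integrable_const _)]
    simp
  rw [hsub, ← Real.norm_eq_abs]
  refine (norm_integral_le_of_norm_le hRi' hbound).trans ?_
  rw [hlin]
  have h1 : A₂ * (A₁ * ((∫ ω, R ω ∂P) + η) + η) ≤ A₂ * (A₁ * (η + η) + η) := by gcongr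
  have h2 : (A₂ * (2 * A₁ + 1) + 1) * η = ε / 2 := by
    rw [hη]; field_simp
  linarith

theorem exists_particleCost_eq {N : ℕ} [NeZero N] {c : Controls m T U M L}
    {ξ : Fin N → Ω → Euc d} {B : Fin N → ℝ≥0 → Ω → Euc d} {X : Fin N → ℝ → Ω → Euc d}
    {Y : Fin m → ℝ → Ω → Euc d} (h : IsParticleSolution P k σ Y₀ c ξ B X Y)
    (𝓛 : ℝ → (Fin m → Euc d) → W1 d → ℝ) (Ψ : (Fin m → Mat d ℓ) → (Fin m → Euc ℓ) → ℝ) :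
    ∃ (X' : Fin N → ℝ → Ω → Euc d) (Y' : Fin m → ℝ → Ω → Euc d),
      IsParticleSolution P k σ Y₀ c ξ B X' Y' ∧
      particleCost P k σ Y₀ 𝓛 Ψ ξ B c = ∫ ω, particlePathCost 𝓛 Ψ c X' Y' ω ∂P :=
  ⟨_, _, Classical.epsilon_spec (p := fun S : (Fin N → ℝ → Ω → Euc d) × (Fin m → ℝ → Ω → Euc d) =>
    IsParticleSolution P k σ Y₀ c ξ B S.1 S.2) ⟨(X, Y), h⟩, rfl⟩

theorem exists_meanFieldCost_eq {c : Controls m T U M L} {X : ℝ → Ω → Euc d}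
    {Y : Fin m → ℝ → Euc d} {μ : ℝ → W1 d} (h : IsMeanFieldSolution P k σ Y₀ c ξ' B' X Y μ)
    (𝓛 : ℝ → (Fin m → Euc d) → W1 d → ℝ) (Ψ : (Fin m → Mat d ℓ) → (Fin m → Euc ℓ) → ℝ) :
    ∃ (X' : ℝ → Ω → Euc d) (Y' : Fin m → ℝ → Euc d) (μ' : ℝ → W1 d),
      IsMeanFieldSolution P k σ Y₀ c ξ' B' X' Y' μ' ∧
      meanFieldCost P k σ Y₀ 𝓛 Ψ ξ' B' c = pathCost 𝓛 Ψ c (fun t i => Y' i t) μ' :=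
  ⟨_, _, _, Classical.epsilon_spec
    (p := fun S : (ℝ → Ω → Euc d) × (Fin m → ℝ → Euc d) × (ℝ → W1 d) =>
      IsMeanFieldSolution P k σ Y₀ c ξ' B' S.1 S.2.1 S.2.2) ⟨(X, Y, μ), h⟩, rfl⟩

end CostConvergence

theorem integrable_norm_of_integrable_norm_rpow {E : Type*} [NormedAddCommGroup E]
    [MeasurableSpace E] [OpensMeasurableSpace E] {μ : Measure E} [IsFiniteMeasure μ] {p : ℝ}
    (hp : 1 ≤ p) (h : Integrable (fun x => ‖x‖ ^ p) μ) : Integrable (fun x : E => ‖x‖) μ := by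
  refine ((integrable_const (1 : ℝ)).add h).mono' measurable_norm.aestronglyMeasurable
    (Eventually.of_forall fun x => ?_)
  rw [norm_norm, Pi.add_apply]
  have h0 : 0 ≤ ‖x‖ ^ p := by positivity
  rcases le_total ‖x‖ 1 with hx | hx
  · linarith
  · linarith [Real.self_le_rpow_of_one_le hx hp]

end

theorem mainTheorem1 {d ℓ m : ℕ} (hd : 1 ≤ d) (hℓ : 1 ≤ ℓ) (hm : 1 ≤ m)
    {T σ : ℝ} (hT : 0 < T) (hσ : 0 < σ)
    (k : Kernels d) (hk : k.IsLipschitz)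
    (U : Set (Mat d ℓ)) (hU : IsCompact U)
    (M : ℝ) (L : ℝ≥0) (hM : 0 < M) (hL : 0 < L)
    (𝓛 : ℝ → (Fin m → Euc d) → W1 d → ℝ)
    (h𝓛 : UniformContinuousOn (fun z : ℝ × (Fin m → Euc d) × W1 d => 𝓛 z.1 z.2.1 z.2.2)
      (Set.Icc 0 T ×ˢ Set.univ))
    (Ψ : (Fin m → Mat d ℓ) → (Fin m → Euc ℓ) → ℝ)
    (hΨ : Continuous fun z : (Fin m → Mat d ℓ) × (Fin m → Euc ℓ) => Ψ z.1 z.2)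
    (hΨconv : ∀ b, ConvexOn ℝ Set.univ fun a => Ψ a b)
    (Y₀ : Fin m → Euc d)
    (p : ℝ) (hp : 1 < p) (μ₀ : Measure (Euc d)) [IsProbabilityMeasure μ₀]
    (hμ₀ : Integrable (fun x => ‖x‖ ^ p) μ₀)
    {Ω : Type*} [MeasurableSpace Ω] (P : Measure Ω) [IsProbabilityMeasure P]
    -- the i.i.d. initial positions and the independent Brownian motions of the followers
    (ξ : ℕ → Ω → Euc d) (B : ℕ → ℝ≥0 → Ω → Euc d)
    (hdriver : ∀ n, IsDriver P μ₀ (ξ n) (B n))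
    (hindep : iIndepFun (fun n ω => (ξ n ω, fun t : ℝ≥0 => B n t ω)) P)
    -- the initial position and the Brownian motion of the McKean-Vlasov system
    (ξ' : Ω → Euc d) (B' : ℝ≥0 → Ω → Euc d) (hdriver' : IsDriver P μ₀ ξ' B') :
    -- the particle systems are well posed and their costs are well defined
    (∀ (N : ℕ) [NeZero N] (c : Controls m T U M L),
      (∃ (X : Fin N → ℝ → Ω → Euc d) (Y : Fin m → ℝ → Ω → Euc d),
        IsParticleSolution P k σ Y₀ c (fun n => ξ n) (fun n => B n) X Y) ∧
      ∀ (X : Fin N → ℝ → Ω → Euc d) (Y : Fin m → ℝ → Ω → Euc d),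
        IsParticleSolution P k σ Y₀ c (fun n => ξ n) (fun n => B n) X Y →
        (∀ᵐ ω ∂P, PathCostConverges 𝓛 Ψ c (fun t i => Y i t ω)
          (fun t => W1.empirical fun n => X n t ω)) ∧
        Integrable (particlePathCost 𝓛 Ψ c X Y) P ∧
        ∀ (X' : Fin N → ℝ → Ω → Euc d) (Y' : Fin m → ℝ → Ω → Euc d),
          IsParticleSolution P k σ Y₀ c (fun n => ξ n) (fun n => B n) X' Y' →
          ∀ᵐ ω ∂P, ∀ t ∈ Set.Icc 0 T,
            (∀ n, X n t ω = X' n t ω) ∧ ∀ i, Y i t ω = Y' i t ω) ∧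
    -- the McKean-Vlasov system is well posed and its cost is well defined
    (∀ c : Controls m T U M L,
      (∃ (X : ℝ → Ω → Euc d) (Y : Fin m → ℝ → Euc d) (μ : ℝ → W1 d),
        IsMeanFieldSolution P k σ Y₀ c ξ' B' X Y μ) ∧
      ∀ (X : ℝ → Ω → Euc d) (Y : Fin m → ℝ → Euc d) (μ : ℝ → W1 d),
        IsMeanFieldSolution P k σ Y₀ c ξ' B' X Y μ →
        PathCostConverges 𝓛 Ψ c (fun t i => Y i t) μ ∧
        ∀ (X' : ℝ → Ω → Euc d) (Y' : Fin m → ℝ → Euc d) (μ' : ℝ → W1 d),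
          IsMeanFieldSolution P k σ Y₀ c ξ' B' X' Y' μ' →
          (∀ᵐ ω ∂P, ∀ t ∈ Set.Icc 0 T, X t ω = X' t ω) ∧
            ∀ i, ∀ t ∈ Set.Icc 0 T, Y i t = Y' i t) ∧
    -- Γ-convergence, and pointwise convergence, of the costs as the number of followers diverges
    GammaConverges
      (fun N (c : Controls m T U M L) =>
        particleCost (N := N + 1) P k σ Y₀ 𝓛 Ψ (fun n => ξ n) (fun n => B n) c)
      (fun c => meanFieldCost P k σ Y₀ 𝓛 Ψ ξ' B' c) ∧
    ∀ c : Controls m T U M L, Tendsto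
      (fun N : ℕ =>
        particleCost (N := N + 1) P k σ Y₀ 𝓛 Ψ (fun n => ξ n) (fun n => B n) c)
      atTop (𝓝 (meanFieldCost P k σ Y₀ 𝓛 Ψ ξ' B' c)) := by
  have hμ₁ := integrable_norm_of_integrable_norm_rpow hp.le hμ₀
  choose w hw using fun n => (hdriver n).exists_isNoisePath σ T
  obtain ⟨w', hw'⟩ := hdriver'.exists_isNoisePath σ T
  have hwi (n : ℕ) : Integrable (w n) P := (hw n).integrable (hdriver n) hμ₁
  have hwi' : Integrable w' P := hw'.integrable hdriver' hμ₁
  have hmap (n : ℕ) : P.map (w n) = P.map w' := (hw n).map_eq hw' (hdriver n) hdriver'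
  have hind := iIndepFun_noisePath hw hindep
  have hex (N : ℕ) [NeZero N] (c : Controls m T U M L) :
      ∃ (X : Fin N → ℝ → Ω → Euc d) (Y : Fin m → ℝ → Ω → Euc d),
        IsParticleSolution P k σ Y₀ c (fun n => ξ n) (fun n => B n) X Y := by
    obtain ⟨C, K, hC, hf⟩ := isCaratheodoryField_particleField hk hU hM m N T L
    exact ⟨_, _, isParticleSolution_solution hT.le hC (hf c) (fun n => hw n) Y₀⟩
  have hex' (c : Controls m T U M L) :=
    exists_isMeanFieldSolution hT.le hk hU hM c Y₀ hw' hwi'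
  have hclose (c₀ : Controls m T U M L) : ∃ I : ℝ, ∃ μ : ℝ → W1 d,
      ContinuousOn μ (Set.Icc 0 T) ∧ meanFieldCost P k σ Y₀ 𝓛 Ψ ξ' B' c₀ =
        I + ∫ t in (0 : ℝ)..T, Ψ (c₀.h t) (c₀.g (μ t)) ∧
      ∀ c : ℕ → Controls m T U M L, Tendsto c atTop (𝓝 c₀) → ∀ ε > 0, ∀ᶠ N in atTop,
        |particleCost (N := N + 1) P k σ Y₀ 𝓛 Ψ (fun n => ξ n) (fun n => B n) (c N) -
          (I + ∫ t in (0 : ℝ)..T, Ψ ((c N).h t) (c₀.g (μ t)))| ≤ ε := by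
    obtain ⟨X₀, Y₁, μ₁, h₀⟩ := hex' c₀
    obtain ⟨X, Y, μ, hs, hcost⟩ := exists_meanFieldCost_eq h₀ 𝓛 Ψ
    refine ⟨∫ t in (0 : ℝ)..T, 𝓛 t (fun i => Y i t) (μ t), μ,
      hs.continuousOn_law hT.le hk hU hM hw', hcost, fun c hc ε hε => ?_⟩
    have hN (N : ℕ) := exists_particleCost_eq (hex (N + 1) (c N)).choose_spec.choose_spec 𝓛 Ψ
    choose x y hxy hxyc using hN
    simp only [hxyc]
    exact hs.eventually_abs_integral_particlePathCost_sub_le hT hk hU hM h𝓛 hΨ hw hw' hwi hmap hind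
      hc hxy hε
  have hpt (c : Controls m T U M L) : Tendsto
      (fun N : ℕ => particleCost (N := N + 1) P k σ Y₀ 𝓛 Ψ (fun n => ξ n) (fun n => B n) c)
      atTop (𝓝 (meanFieldCost P k σ Y₀ 𝓛 Ψ ξ' B' c)) := by
    obtain ⟨I, μ, -, hI, hlim⟩ := hclose c
    rw [Metric.tendsto_nhds]
    intro ε hε
    filter_upwards [hlim (fun _ => c) tendsto_const_nhds (ε / 2) (half_pos hε)] with N hN
    rw [Real.dist_eq, hI]
    exact hN.trans_lt (half_lt_self hε)
  refine ⟨fun N _ c => ⟨hex N c, fun X Y h => ?_⟩, fun c => ⟨hex' c, fun X Y μ h => ?_⟩,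
    gammaConverges_of_eventually_lt (fun c₀ c hc a ha => ?_) hpt, hpt⟩
  · obtain ⟨C, K, hC, hf⟩ := isCaratheodoryField_particleField hk hU hM m N T L
    exact ⟨Eventually.of_forall fun ω => h.pathCostConverges hT.le hU h𝓛 hΨ ω,
      h.integrable_cost hT hC (hf c) (fun n => hw n) (fun n => hwi n) hU h𝓛 hΨ,
      fun X' Y' h' => h.ae_unique h' hT.le hC (hf c) fun n => hw n⟩
  · exact ⟨pathCostConverges_of_continuousOn hT.le hU h𝓛 hΨ c (continuousOn_pi.2 h.continuous_Y)
      (h.continuousOn_law hT.le hk hU hM hw'),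
      fun X' Y' μ' h' => h.ae_unique h' hT.le hk hU hM hw' hwi'⟩
  · obtain ⟨I, μ, hμ, hI, hlim⟩ := hclose c₀
    rw [hI] at ha
    set J : ℝ := ∫ t in (0 : ℝ)..T, Ψ (c₀.h t) (c₀.g (μ t)) with hJ
    filter_upwards [hlim c hc ((I + J - a) / 3) (by linarith),
      Controls.eventually_lt_integral_controlCost hT.le hU hΨ hΨconv hc
        (c₀.continuous_g.comp_continuousOn hμ) (fun t _ i => c₀.norm_g_le _ i)
        (a := J - (I + J - a) / 2) (by simp only [Function.comp_apply]; linarith)] with N h1 h2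
    have h3 := (abs_le.1 h1).1
    simp only [Function.comp_apply] at h2
    linarith
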